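/- \textbf{Setting.} Consider the LTI system $\dot x(t)=Ax(t)+Bu(t)$, $y(t)=Cx(t)$ with $x\in\mathbb R^n$, $u\in\mathbb R^m$, $y\in\mathbb R^l$, of relative degree $r\ge 2$, i.e. $CA^iB=0$ for $i=0,\dots,r-2$ and $CA^{r-1}B\ne 0$. For a sampling period $h>0$, sampling instants $t_k=kh$ ($k=0,1,2,\dots$), integers $0<q_1<\dots<q_{r-1}$ and gains $K_0,\dots,K_{r-1}\in\mathbb R^{m\times l}$, the delayed sampled-data controller is $$u(t)=K_0y(t_k)+\sum_{i=1}^{r-1}K_i\,y(t_k-q_ih),\qquad t\in[t_k,t_{k+1}),\ k=0,1,2,\dots,\qquad(1)$$ where $y(t)=0$ for $t<0$. Given $\bar K_0,\dots,\bar K_{r-1}\in\mathbb R^{m\times l}$, the derivative-dependent controller is $$u(t)=\bar K_0y(t)+\bar K_1\dot y(t)+\dots+\bar K_{r-1}y^{(r-1)}(t),\qquad t\ge 0.\qquad(2)$$ A controller exponentially stabilizes the system with decay rate $\alpha$ if the closed loop has a solution on $[0,\infty)$ for every initial state and there is a constant $c$ such that $\|x(t)\|\le c\,e^{-\alpha t}\|x(0)\|$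 for all closed-loop solutions and all $t\ge 0$. Put $q_0=0$ and $$M=\Bigl[\tfrac{(-q_ih)^j}{j!}I_l\Bigr]_{i,j=0}^{r-1}\quad(\text{with }0^0=1),\qquad \bar C=\begin{bmatrix}C\\CA\\ \vdots\\ CA^{r-1}\end{bmatrix},\qquad D=A+B[K_0,K_1,\dots,K_{r-1}]M\bar C.$$ \textbf{Theorem.} (i) Let $h>0$, integers $0<q_1<\dots<q_{r-1}$, gains $K_0,\dots,K_{r-1}\in\mathbb R^{m\times l}$ and $\alpha>0$ be given. Suppose there are (symmetric) positive-definite matrices $P\in\mathbb R^{n\times n}$ and $W_0,\dots,W_{r-1},R_1,\dots,R_{r-1}\in\mathbb R^{m\times m}$ such that $\Phi\le 0$, where $\Phi=\{\Phi_{ij}\}_{i,j=1}^4$ is the symmetric block matrix with $$\Phi_{11}=PD+D^TP+2\alpha P+h^2e^{2\alpha h}\sum_{i=0}^{r-1}(K_iCA)^TW_i(K_iCA),$$ $$\Phi_{12}=\mathbf 1_r^T\otimes PB,\quad \Phi_{13}=\mathbf 1_{r-1}^T\otimes PB,\quad \Phi_{14}=(CA^{r-1}D)^TH,\quad \Phi_{23}=0,$$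 $$\Phi_{24}=\mathbf 1_r\otimes(CA^{r-1}B)^TH,\quad \Phi_{34}=\mathbf 1_{r-1}\otimes(CA^{r-1}B)^TH,\quad \Phi_{44}=-H,$$ $$\Phi_{22}=-\tfrac{\pi^2}{4}\operatorname{diag}\{W_0,e^{-2\alpha q_1h}W_1,\dots,e^{-2\alpha q_{r-1}h}W_{r-1}\},$$ $$\Phi_{33}=-(r!)^2\operatorname{diag}\Bigl\{\tfrac{e^{-2\alpha q_1h}}{(q_1h)^r}R_1,\dots,\tfrac{e^{-2\alpha q_{r-1}h}}{(q_{r-1}h)^r}R_{r-1}\Bigr\},\qquad H=\sum_{i=1}^{r-1}(q_ih)^rK_i^TR_iK_i,$$ and $\mathbf 1_s\in\mathbb R^s$ is the vector of ones. Then controller (1) exponentially stabilizes the system with decay rate $\alpha$. (ii) Suppose that, for some $\bar K_0,\dots,\bar K_{r-1}\in\mathbb R^{m\times l}$, controller (2) exponentially stabilizes the system with a decay rate $\alpha'>0$. Then for every $\alpha<\alpha'$ there is $h_0>0$ such that for every $h\in(0,h_0)$, with $q_i=i\lfloor h^{\frac1r-1}\rfloor$ ($i=1,\dots,r-1$), one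 has $0<q_1<\dots<q_{r-1}$, the matrix $M$ is invertible, and controller (1) with gains $[K_0,\dots,K_{r-1}]=[\bar K_0,\dots,\bar K_{r-1}]M^{-1}$ exponentially stabilizes the system with decay rate $\alpha$. -/

import Mathlib

open scoped Nat Matrix

noncomputable section

namespace SampledData

/-- The system `x' = A x + B u`, `y = C x` has relative degree `r`:
`C A^i B = 0` for `i = 0, …, r - 2` and `C A^(r-1) B ≠ 0`. -/
def HasRelativeDegree {n m l : ℕ} (A : Matrix (Fin n) (Fin n) ℝ) (B : Matrix (Fin n) (Fin m) ℝ)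
    (C : Matrix (Fin l) (Fin n) ℝ) (r : ℕ) : Prop :=
  (∀ i : ℕ, i + 2 ≤ r → C * A ^ i * B = 0) ∧ C * A ^ (r - 1) * B ≠ 0

/-- `x` is a state trajectory on `[0, ∞)` of `x' = A x + B u`: it is continuous and satisfies the
equation with the right derivative (the inputs considered here are right continuous, with jumps
at most at the sampling instants). -/
def IsTrajectory {n m : ℕ} (A : Matrix (Fin n) (Fin n) ℝ) (B : Matrix (Fin n) (Fin m) ℝ)
    (u : ℝ → Fin m → ℝ) (x : ℝ → Fin n → ℝ) : Prop :=
  ContinuousOn x (Set.Ici 0) ∧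
    ∀ t : ℝ, 0 ≤ t → HasDerivWithinAt x (A *ᵥ x t + B *ᵥ u t) (Set.Ici t) t

/-- The output: `y(t) = C x(t)` for `t ≥ 0`, and `y(t) = 0` for `t < 0`. -/
def output {n l : ℕ} (C : Matrix (Fin l) (Fin n) ℝ) (x : ℝ → Fin n → ℝ) (t : ℝ) : Fin l → ℝ :=
  if 0 ≤ t then C *ᵥ x t else 0

/-- `x` is a closed-loop trajectory under the derivative-dependent controller
`u(t) = K₀ y(t) + K₁ y'(t) + ⋯ + K_{r-1} y^{(r-1)}(t)`, `t ≥ 0`. Only the values of the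
family `Kbar` at indices `< r` are used. -/
def IsDerivativeLoop {n m l : ℕ} (A : Matrix (Fin n) (Fin n) ℝ) (B : Matrix (Fin n) (Fin m) ℝ)
    (C : Matrix (Fin l) (Fin n) ℝ) (r : ℕ) (Kbar : ℕ → Matrix (Fin m) (Fin l) ℝ)
    (x : ℝ → Fin n → ℝ) : Prop :=
  ∃ u : ℝ → Fin m → ℝ, IsTrajectory A B u x ∧
    ∀ t : ℝ, 0 ≤ t →
      u t = ∑ i ∈ Finset.range r,
        Kbar i *ᵥ iteratedDerivWithin i (output C x) (Set.Ici 0) t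

/-- `x` is a closed-loop trajectory under the delayed sampled-data controller
`u(t) = K₀ y(t_k) + ∑_{i=1}^{r-1} K_i y(t_k - q_i h)`, `t ∈ [t_k, t_{k+1})`, `t_k = k h`.
The term with `K₀` is the one with `i = 0`, under the convention `q 0 = 0`. -/
def IsSampledLoop {n m l : ℕ} (A : Matrix (Fin n) (Fin n) ℝ) (B : Matrix (Fin n) (Fin m) ℝ)
    (C : Matrix (Fin l) (Fin n) ℝ) (r : ℕ) (h : ℝ) (q : ℕ → ℕ)
    (K : ℕ → Matrix (Fin m) (Fin l) ℝ) (x : ℝ → Fin n → ℝ) : Prop :=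
  ∃ u : ℝ → Fin m → ℝ, IsTrajectory A B u x ∧
    ∀ k : ℕ, ∀ t ∈ Set.Ico ((k : ℝ) * h) (((k : ℝ) + 1) * h),
      u t = ∑ i ∈ Finset.range r, K i *ᵥ output C x ((k : ℝ) * h - (q i : ℝ) * h)

/-- A closed loop, given by its set of trajectories, is exponentially stable with decay rate `α`:
every initial state starts a trajectory, and there is a constant `c` such that
`‖x(t)‖ ≤ c e^{-α t} ‖x(0)‖` (Euclidean norm) for all trajectories and all `t ≥ 0`. -/
def IsExpStable {n : ℕ} (Loop : (ℝ → Fin n → ℝ) → Prop) (α : ℝ) : Prop :=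
  (∀ x₀ : Fin n → ℝ, ∃ x, Loop x ∧ x 0 = x₀) ∧
    ∃ c : ℝ, ∀ x, Loop x → ∀ t : ℝ, 0 ≤ t →
      ‖WithLp.toLp 2 (x t)‖ ≤ c * Real.exp (-α * t) * ‖WithLp.toLp 2 (x 0)‖

/-! Block matrices. The index `(a, i)` is coordinate `a` of block `i`. -/

/-- The block row `[K₀, K₁, …, K_{r-1}]`. -/
def gainRow {m l : ℕ} (r : ℕ) (K : ℕ → Matrix (Fin m) (Fin l) ℝ) :
    Matrix (Fin m) (Fin l × Fin r) ℝ :=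
  Matrix.of fun a p => K p.2 a p.1

/-- The Vandermonde-type matrix `M`, with blocks `((-q_i h)^j / j!) I_l`, `i, j = 0, …, r - 1`.
As `q 0 = 0`, its first block row is `[I_l, 0, …, 0]`. -/
def vandermondeM (l r : ℕ) (h : ℝ) (q : ℕ → ℕ) : Matrix (Fin l × Fin r) (Fin l × Fin r) ℝ :=
  Matrix.of fun p s =>
    ((-((q p.2 : ℝ) * h)) ^ (s.2 : ℕ) / ((s.2 : ℕ)! : ℝ)) * (1 : Matrix (Fin l) (Fin l) ℝ) p.1 s.1

/-- The block column `col {C, C A, …, C A^(r-1)}`. -/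
def outputCol {n l : ℕ} (A : Matrix (Fin n) (Fin n) ℝ) (C : Matrix (Fin l) (Fin n) ℝ) (r : ℕ) :
    Matrix (Fin l × Fin r) (Fin n) ℝ :=
  Matrix.of fun p b => (C * A ^ (p.2 : ℕ)) p.1 b

/-- `D = A + B [K₀, …, K_{r-1}] M col {C, C A, …, C A^(r-1)}`. -/
def matD {n m l : ℕ} (A : Matrix (Fin n) (Fin n) ℝ) (B : Matrix (Fin n) (Fin m) ℝ)
    (C : Matrix (Fin l) (Fin n) ℝ) (r : ℕ) (h : ℝ) (q : ℕ → ℕ)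
    (K : ℕ → Matrix (Fin m) (Fin l) ℝ) : Matrix (Fin n) (Fin n) ℝ :=
  A + B * (gainRow r K * vandermondeM l r h q * outputCol A C r)

/-- `H = ∑_{i=1}^{r-1} (q_i h)^r K_iᵀ R_i K_i`. -/
def matH {m l : ℕ} (r : ℕ) (h : ℝ) (q : ℕ → ℕ) (K : ℕ → Matrix (Fin m) (Fin l) ℝ)
    (R : ℕ → Matrix (Fin m) (Fin m) ℝ) : Matrix (Fin l) (Fin l) ℝ :=
  ∑ i ∈ Finset.Icc 1 (r - 1), ((q i : ℝ) * h) ^ r • ((K i)ᵀ * R i * K i)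

/-- `1_sᵀ ⊗ X = [X, …, X]` (`s` blocks). -/
def repeatRow {a b : ℕ} (s : ℕ) (X : Matrix (Fin a) (Fin b) ℝ) :
    Matrix (Fin a) (Fin b × Fin s) ℝ :=
  X.submatrix id Prod.fst

/-- `1_s ⊗ X = col {X, …, X}` (`s` blocks). -/
def repeatCol {a b : ℕ} (s : ℕ) (X : Matrix (Fin a) (Fin b) ℝ) :
    Matrix (Fin a × Fin s) (Fin b) ℝ :=
  X.submatrix Prod.fst id

/-- `Φ₁₁ = P D + Dᵀ P + 2 α P + h² e^{2 α h} ∑_{i=0}^{r-1} (K_i C A)ᵀ W_i (K_i C A)`. -/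
def Phi11 {n m l : ℕ} (A : Matrix (Fin n) (Fin n) ℝ) (B : Matrix (Fin n) (Fin m) ℝ)
    (C : Matrix (Fin l) (Fin n) ℝ) (r : ℕ) (h : ℝ) (q : ℕ → ℕ)
    (K : ℕ → Matrix (Fin m) (Fin l) ℝ) (α : ℝ) (P : Matrix (Fin n) (Fin n) ℝ)
    (W : ℕ → Matrix (Fin m) (Fin m) ℝ) : Matrix (Fin n) (Fin n) ℝ :=
  P * matD A B C r h q K + (matD A B C r h q K)ᵀ * P + (2 * α) • P +
    (h ^ 2 * Real.exp (2 * α * h)) •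
      ∑ i ∈ Finset.range r, (K i * C * A)ᵀ * W i * (K i * C * A)

/-- `Φ₂₂ = -(π²/4) diag {W₀, e^{-2 α q₁ h} W₁, …, e^{-2 α q_{r-1} h} W_{r-1}}` (with `q 0 = 0`). -/
def Phi22 {m : ℕ} (r : ℕ) (h : ℝ) (q : ℕ → ℕ) (α : ℝ) (W : ℕ → Matrix (Fin m) (Fin m) ℝ) :
    Matrix (Fin m × Fin r) (Fin m × Fin r) ℝ :=
  (-(Real.pi ^ 2 / 4)) • Matrix.blockDiagonal
    fun i : Fin r => Real.exp (-2 * α * ((q i : ℝ) * h)) • W i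

/-- `Φ₃₃ = -(r!)² diag {e^{-2 α q_i h} (q_i h)^{-r} R_i}`, `i = 1, …, r - 1`. -/
def Phi33 {m : ℕ} (r : ℕ) (h : ℝ) (q : ℕ → ℕ) (α : ℝ) (R : ℕ → Matrix (Fin m) (Fin m) ℝ) :
    Matrix (Fin m × Fin (r - 1)) (Fin m × Fin (r - 1)) ℝ :=
  (-((r ! : ℝ) ^ 2)) • Matrix.blockDiagonal
    fun i : Fin (r - 1) =>
      (Real.exp (-2 * α * ((q (i + 1) : ℝ) * h)) / ((q (i + 1) : ℝ) * h) ^ r) • R (i + 1)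

/-- The symmetric 4 × 4 block matrix `Φ`; the block `Φ₂₃` is zero. -/
def Phi {n m l : ℕ} (A : Matrix (Fin n) (Fin n) ℝ) (B : Matrix (Fin n) (Fin m) ℝ)
    (C : Matrix (Fin l) (Fin n) ℝ) (r : ℕ) (h : ℝ) (q : ℕ → ℕ)
    (K : ℕ → Matrix (Fin m) (Fin l) ℝ) (α : ℝ) (P : Matrix (Fin n) (Fin n) ℝ)
    (W R : ℕ → Matrix (Fin m) (Fin m) ℝ) :
    Matrix ((Fin n ⊕ (Fin m × Fin r)) ⊕ ((Fin m × Fin (r - 1)) ⊕ Fin l))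
      ((Fin n ⊕ (Fin m × Fin r)) ⊕ ((Fin m × Fin (r - 1)) ⊕ Fin l)) ℝ :=
  let D := matD A B C r h q K
  let H := matH r h q K R
  let Phi12 := repeatRow r (P * B)
  let Phi13 := repeatRow (r - 1) (P * B)
  let Phi14 := (C * A ^ (r - 1) * D)ᵀ * H
  let Phi24 := repeatCol r ((C * A ^ (r - 1) * B)ᵀ * H)
  let Phi34 := repeatCol (r - 1) ((C * A ^ (r - 1) * B)ᵀ * H)
  let upperRight := Matrix.fromBlocks Phi13 Phi14 0 Phi24
  Matrix.fromBlocks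
    (Matrix.fromBlocks (Phi11 A B C r h q K α P W) Phi12 Phi12ᵀ (Phi22 r h q α W))
    upperRight
    upperRightᵀ
    (Matrix.fromBlocks (Phi33 r h q α R) Phi34 Phi34ᵀ (-H))

end SampledData

end

/-! Each delayed measurement `y(t_k - q_i h)` is the Taylor polynomial of `y` at `t` with step `-q_i
h`, plus its remainder, plus the error of sampling the delayed signal. The relative degree gives
`y^(j) = C A^j x` for `j < r`, so the polynomials add up to the state feedback inside `D`. Once all
delayed instants are nonnegative the loop reads `x' = D x + B ∑ d_i + B ∑ e_i`, with sampling errors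
`d_i` and gain-weighted remainders `e_i` (`velocity_eq`).

Both errors are small in `L²` with weight `e^(2αt)`. Wirtinger's inequality bounds `d_i` through `y'
= C A x` (`sampled_delay_bound_vec`). Jensen's inequality for the integral remainder, followed by
Fubini, bounds `e_i` through `C A^(r-1) x'` (`taylor_delay_bound_vec`). The constants are those in
`Phi`. Testing `Phi ≤ 0` on `(x, d, e, C A^(r-1) x')` gives a pointwise dissipation inequality
(`isExpStable_of_Phi`). After integration the error terms cancel up to integrals over an initial
window, which Gronwall's lemma bounds by the initial state (`exists_energy_bound`). No
Lyapunov-Krasovskii functional has to be differentiated: `e^(2αt) xᵀ P x` stays bounded, and this is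
decay at rate `α`.

For part (ii) the factor `M` cancels, so `D` is the closed-loop matrix of the derivative controller,
and a finite-horizon Gramian supplies `P` (`exists_lyapunov`). Let `η` be the smallest delay, of
order `h^(1/r)`. The gains are `O(η^(-(r-1)))` (`exists_gain_bound`). With `W_i = η⁻¹ I` and `R_i =
η^(r-1) I` the added state and velocity terms are `O(η)`, while the weights on the errors are of
order `1/η`. Hence dissipation holds for small `η` (`exists_small_delay`). -/

noncomputable section

namespace SampledData

/-! ### Wirtinger inequalities for sampled and delayed signals. -/

section Integrals

open Set MeasureTheory Filter Topology intervalIntegral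

/-- Measurable real functions that are bounded on bounded sets. -/
def IsLocBdd (g : ℝ → ℝ) : Prop :=
  Measurable g ∧ ∀ b : ℝ, ∃ c : ℝ, ∀ t, |t| ≤ b → |g t| ≤ c

namespace IsLocBdd

theorem of_continuous {g : ℝ → ℝ} (hg : Continuous g) : IsLocBdd g := by
  refine ⟨hg.measurable, fun b => ?_⟩
  obtain ⟨c, hc⟩ := (isCompact_Icc (a := -b) (b := b)).exists_bound_of_continuousOn
    hg.continuousOn
  exact ⟨c, fun t ht => hc t (abs_le.mp ht)⟩

theorem mul {f g : ℝ → ℝ} (hf : IsLocBdd f) (hg : IsLocBdd g) :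
    IsLocBdd (fun t => f t * g t) := by
  refine ⟨hf.1.mul hg.1, fun b => ?_⟩
  obtain ⟨c, hc⟩ := hf.2 b
  obtain ⟨d, hd⟩ := hg.2 b
  refine ⟨c * d, fun t ht => ?_⟩
  rw [abs_mul]
  exact mul_le_mul (hc t ht) (hd t ht) (abs_nonneg _) ((abs_nonneg _).trans (hc t ht))

theorem add {f g : ℝ → ℝ} (hf : IsLocBdd f) (hg : IsLocBdd g) :
    IsLocBdd (fun t => f t + g t) := by
  refine ⟨hf.1.add hg.1, fun b => ?_⟩
  obtain ⟨c, hc⟩ := hf.2 b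
  obtain ⟨d, hd⟩ := hg.2 b
  exact ⟨c + d, fun t ht => (abs_add_le _ _).trans (add_le_add (hc t ht) (hd t ht))⟩

theorem const (c : ℝ) : IsLocBdd (fun _ => c) := of_continuous continuous_const

theorem const_mul {g : ℝ → ℝ} (hg : IsLocBdd g) (c : ℝ) : IsLocBdd (fun t => c * g t) :=
  (const c).mul hg

theorem sub {f g : ℝ → ℝ} (hf : IsLocBdd f) (hg : IsLocBdd g) :
    IsLocBdd (fun t => f t - g t) := by
  simpa [sub_eq_add_neg] using hf.add (hg.const_mul (-1))

theorem sq {g : ℝ → ℝ} (hg : IsLocBdd g) : IsLocBdd (fun t => g t ^ 2) := by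
  simpa [pow_two] using hg.mul hg

theorem sum {ι : Type*} (s : Finset ι) {f : ι → ℝ → ℝ} (hf : ∀ i ∈ s, IsLocBdd (f i)) :
    IsLocBdd (fun t => ∑ i ∈ s, f i t) := by
  classical
  induction s using Finset.induction_on with
  | empty => simpa using const 0
  | insert a s ha ih =>
    simp only [Finset.sum_insert ha]
    exact (hf a (by simp)).add (ih fun i hi => hf i (by simp [hi]))

theorem comp_sub {g : ℝ → ℝ} (hg : IsLocBdd g) (c : ℝ) : IsLocBdd (fun t => g (t - c)) := by
  refine ⟨hg.1.comp (measurable_id.sub_const c), fun b => ?_⟩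
  obtain ⟨d, hd⟩ := hg.2 (b + |c|)
  exact ⟨d, fun t ht => hd _ ((abs_sub _ _).trans (by linarith))⟩

theorem step {h : ℝ} (hh : 0 < h) (w : ℕ → ℝ) : IsLocBdd (fun t => w ⌊t / h⌋₊) := by
  refine ⟨(measurable_from_nat (f := w)).comp
    (Nat.measurable_floor.comp (measurable_id.div_const h)), fun b => ?_⟩
  refine ⟨∑ k ∈ Finset.range (⌊b / h⌋₊ + 1), |w k|, fun t ht => ?_⟩
  refine Finset.single_le_sum (f := fun k => |w k|) (fun _ _ => abs_nonneg _) ?_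
  rw [Finset.mem_range, Nat.lt_succ_iff]
  exact Nat.floor_le_floor (div_le_div_of_nonneg_right ((le_abs_self t).trans ht) hh.le)

/-- The purpose of the class: held inputs jump at the sampling instants, so continuity is
unavailable, and integrability follows instead from closure under algebraic operations. -/
theorem intervalIntegrable {g : ℝ → ℝ} (hg : IsLocBdd g) (a b : ℝ) :
    IntervalIntegrable g volume a b := by
  obtain ⟨c, hc⟩ := hg.2 (max |a| |b|)
  refine (intervalIntegrable_const (c := c)).mono_fun hg.1.aestronglyMeasurable ?_
  filter_upwards [ae_restrict_mem measurableSet_uIoc] with t ht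
  refine (hc t ?_).trans (le_abs_self c)
  have := Set.uIoc_subset_uIcc ht
  rw [Set.mem_uIcc] at this
  rcases this with ⟨h1, h2⟩ | ⟨h1, h2⟩
  · exact abs_le_max_abs_abs h1 h2
  · rw [max_comm]; exact abs_le_max_abs_abs h1 h2

end IsLocBdd

/-- Put `w = f - f a` and differentiate `c tan(c (b - t)) w²`. Since `1 / cos² = 1 + tan²`,
completing the square `(g - c tan(c (b - t)) w)²` bounds the derivative by `g² - c² w²`. The
function vanishes at both ends: `w a = 0` and `tan 0 = 0`. The strict bound on `c (b - a)` keeps the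
tangent finite at `a`. -/
theorem wirtinger_of_lt {f g : ℝ → ℝ} {a b c : ℝ} (hab : a ≤ b) (hc : 0 < c)
    (hcb : c * (b - a) < Real.pi / 2)
    (hf : ContinuousOn f (Icc a b)) (hg : ContinuousOn g (Icc a b))
    (hd : ∀ t ∈ Ioo a b, HasDerivWithinAt f (g t) (Ioi t) t) :
    c ^ 2 * ∫ t in a..b, (f t - f a) ^ 2 ≤ ∫ t in a..b, g t ^ 2 := by
  have hcos : ∀ t ∈ Icc a b, 0 < Real.cos (c * (b - t)) := fun t ht => by
    refine Real.cos_pos_of_mem_Ioo ⟨?_, ?_⟩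
    · have := mul_nonneg hc.le (sub_nonneg.2 ht.2)
      linarith [Real.pi_pos]
    · refine lt_of_le_of_lt (mul_le_mul_of_nonneg_left ?_ hc.le) hcb
      linarith [ht.1]
  have hcont : ContinuousOn (fun t => c * Real.tan (c * (b - t)) * (f t - f a) ^ 2) (Icc a b) := by
    refine ContinuousOn.mul (continuousOn_const.mul ?_) ((hf.sub continuousOn_const).pow 2)
    refine Real.continuousOn_tan.comp (by fun_prop) fun t ht => (hcos t ht).ne'
  have hI1 : IntervalIntegrable (fun t => (f t - f a) ^ 2) volume a b :=
    (((hf.sub continuousOn_const).pow 2).intervalIntegrable_of_Icc hab)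
  have hI2 : IntervalIntegrable (fun t => g t ^ 2) volume a b :=
    ((hg.pow 2).intervalIntegrable_of_Icc hab)
  have hI : IntegrableOn (fun t => g t ^ 2 - c ^ 2 * (f t - f a) ^ 2) (Icc a b) := by
    rw [integrableOn_Icc_iff_integrableOn_Ioc, ← intervalIntegrable_iff_integrableOn_Ioc_of_le hab]
    exact hI2.sub (hI1.const_mul _)
  have key := sub_le_integral_of_hasDeriv_right_of_le hab hcont
    (g' := fun t => c * (-(c / Real.cos (c * (b - t)) ^ 2)) * (f t - f a) ^ 2 +
      c * Real.tan (c * (b - t)) * (2 * (f t - f a) * g t)) ?_ hI ?_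
  · rw [integral_sub hI2 (hI1.const_mul _), intervalIntegral.integral_const_mul] at key
    simp at key
    linarith
  · intro t ht
    have h1 : HasDerivAt (fun t => Real.tan (c * (b - t))) (-(c / Real.cos (c * (b - t)) ^ 2)) t := by
      have h2 : HasDerivAt (fun t => c * (b - t)) (-c) t := by
        simpa using ((hasDerivAt_id t).const_sub b).const_mul c
      have := (Real.hasDerivAt_tan (hcos t (Ioo_subset_Icc_self ht)).ne').comp t h2
      refine this.congr_deriv ?_
      ring
    have h3 := ((h1.const_mul c).hasDerivWithinAt (s := Ioi t)).mul
      (((hd t ht).sub_const (f a)).pow 2)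
    refine h3.congr_deriv ?_
    simp
  · intro t ht
    have h0 := (hcos t (Ioo_subset_Icc_self ht)).ne'
    have h1 : 1 / Real.cos (c * (b - t)) ^ 2 = 1 + Real.tan (c * (b - t)) ^ 2 := by
      rw [Real.tan_eq_sin_div_cos]
      field_simp
      exact (Real.cos_sq_add_sin_sq _).symm
    have h2 : c / Real.cos (c * (b - t)) ^ 2 = c * (1 + Real.tan (c * (b - t)) ^ 2) := by
      rw [← h1]; ring
    simp only [h2]
    nlinarith [sq_nonneg (g t - c * Real.tan (c * (b - t)) * (f t - f a))]

/-- Wirtinger's inequality for a function vanishing at the left endpoint. -/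
theorem wirtinger {f g : ℝ → ℝ} {a b h : ℝ} (hab : a ≤ b) (hh : 0 < h) (hbh : b - a ≤ h)
    (hf : ContinuousOn f (Icc a b)) (hg : ContinuousOn g (Icc a b))
    (hd : ∀ t ∈ Ioo a b, HasDerivWithinAt f (g t) (Ioi t) t) :
    Real.pi ^ 2 / 4 * ∫ t in a..b, (f t - f a) ^ 2 ≤ h ^ 2 * ∫ t in a..b, g t ^ 2 := by
  set I := ∫ t in a..b, (f t - f a) ^ 2
  set J := ∫ t in a..b, g t ^ 2
  have h0 : 0 < Real.pi / (2 * h) := by positivity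
  -- The optimal constant `c = π / (2h)` may put the tangent at its pole, so it is reached as a
  -- limit from the left.
  have h1 : Tendsto (fun c : ℝ => c ^ 2 * I) (𝓝[<] (Real.pi / (2 * h)))
      (𝓝 ((Real.pi / (2 * h)) ^ 2 * I)) :=
    (Continuous.tendsto (by fun_prop) _).mono_left nhdsWithin_le_nhds
  have h2 : (Real.pi / (2 * h)) ^ 2 * I ≤ J := by
    refine le_of_tendsto h1 ?_
    filter_upwards [Ioo_mem_nhdsLT h0] with c hc
    refine wirtinger_of_lt hab hc.1 ?_ hf hg hd
    have : c * h < Real.pi / 2 := by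
      have := hc.2
      rw [lt_div_iff₀ (by positivity)] at this
      linarith
    exact lt_of_le_of_lt (mul_le_mul_of_nonneg_left hbh hc.1.le) this
  calc Real.pi ^ 2 / 4 * I = h ^ 2 * ((Real.pi / (2 * h)) ^ 2 * I) := by field_simp; ring
    _ ≤ h ^ 2 * J := by gcongr

/-- Exponentially weighted form of Wirtinger's inequality. -/
theorem wirtinger_exp {f g : ℝ → ℝ} {a b h α : ℝ} (hab : a ≤ b) (hh : 0 < h) (hbh : b - a ≤ h)
    (hα : 0 ≤ α) (hf : ContinuousOn f (Icc a b)) (hg : ContinuousOn g (Icc a b))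
    (hd : ∀ t ∈ Ioo a b, HasDerivWithinAt f (g t) (Ioi t) t) :
    Real.pi ^ 2 / 4 * ∫ t in a..b, Real.exp (2 * α * t) * (f t - f a) ^ 2 ≤
      h ^ 2 * Real.exp (2 * α * h) * ∫ t in a..b, Real.exp (2 * α * t) * g t ^ 2 := by
  have hexp : ContinuousOn (fun t => Real.exp (2 * α * t)) (Icc a b) := by fun_prop
  have hI1 : ContinuousOn (fun t => (f t - f a) ^ 2) (Icc a b) := (hf.sub continuousOn_const).pow 2
  have hI2 : ContinuousOn (fun t => g t ^ 2) (Icc a b) := hg.pow 2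
  have h1 : ∫ t in a..b, Real.exp (2 * α * t) * (f t - f a) ^ 2 ≤
      Real.exp (2 * α * b) * ∫ t in a..b, (f t - f a) ^ 2 := by
    rw [← intervalIntegral.integral_const_mul]
    refine integral_mono_on hab ((hexp.mul hI1).intervalIntegrable_of_Icc hab)
      ((continuousOn_const.mul hI1).intervalIntegrable_of_Icc hab) fun t ht => ?_
    have := ht.2
    gcongr
  have h2 : Real.exp (2 * α * a) * ∫ t in a..b, g t ^ 2 ≤
      ∫ t in a..b, Real.exp (2 * α * t) * g t ^ 2 := by
    rw [← intervalIntegral.integral_const_mul]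
    refine integral_mono_on hab ((continuousOn_const.mul hI2).intervalIntegrable_of_Icc hab)
      ((hexp.mul hI2).intervalIntegrable_of_Icc hab) fun t ht => ?_
    have := ht.1
    gcongr
  -- The weight varies by a factor of at most `e^(2αh)` over the interval, which is the source of
  -- this factor in `Phi11`.
  have h3 : Real.exp (2 * α * b) ≤ Real.exp (2 * α * h) * Real.exp (2 * α * a) := by
    rw [← Real.exp_add]
    gcongr
    nlinarith
  have hJ : 0 ≤ ∫ t in a..b, g t ^ 2 := integral_nonneg hab fun t _ => sq_nonneg _
  have hW := wirtinger hab hh hbh hf hg hd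
  calc _ ≤ Real.pi ^ 2 / 4 * (Real.exp (2 * α * b) * ∫ t in a..b, (f t - f a) ^ 2) := by gcongr
    _ = Real.exp (2 * α * b) * (Real.pi ^ 2 / 4 * ∫ t in a..b, (f t - f a) ^ 2) := by ring
    _ ≤ Real.exp (2 * α * b) * (h ^ 2 * ∫ t in a..b, g t ^ 2) := by gcongr
    _ ≤ Real.exp (2 * α * h) * Real.exp (2 * α * a) * (h ^ 2 * ∫ t in a..b, g t ^ 2) := by gcongr
    _ = h ^ 2 * Real.exp (2 * α * h) * (Real.exp (2 * α * a) * ∫ t in a..b, g t ^ 2) := by ring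
    _ ≤ _ := by gcongr

theorem floor_div_eq {h t : ℝ} (hh : 0 < h) {k : ℕ} (h1 : (k : ℝ) * h ≤ t)
    (h2 : t < ((k : ℝ) + 1) * h) : ⌊t / h⌋₊ = k := by
  have : 0 ≤ t / h := div_nonneg (le_trans (by positivity) h1) hh.le
  rw [Nat.floor_eq_iff this]
  exact ⟨(le_div_iff₀ hh).2 h1, (div_lt_iff₀ hh).2 h2⟩

/-- Wirtinger's inequality summed over the sampling intervals. -/
theorem sampled_wirtinger {f g : ℝ → ℝ} {h α : ℝ} (hh : 0 < h) (hα : 0 ≤ α)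
    (hf : Continuous f) (hg : Continuous g)
    (hd : ∀ t, 0 ≤ t → HasDerivWithinAt f (g t) (Ici t) t) (N : ℕ) {t : ℝ} (ht : (N : ℝ) * h ≤ t) :
    Real.pi ^ 2 / 4 * ∫ s in (N * h : ℝ)..t, Real.exp (2 * α * s) * (f s - f (⌊s / h⌋₊ * h)) ^ 2 ≤
      h ^ 2 * Real.exp (2 * α * h) * ∫ s in (N * h : ℝ)..t, Real.exp (2 * α * s) * g s ^ 2 := by
  have hp1 : IsLocBdd (fun s => Real.exp (2 * α * s) * (f s - f (⌊s / h⌋₊ * h)) ^ 2) :=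
    (IsLocBdd.of_continuous (by fun_prop)).mul
      ((IsLocBdd.of_continuous hf).sub (IsLocBdd.step hh fun k => f (k * h))).sq
  have hp2 : IsLocBdd (fun s => Real.exp (2 * α * s) * g s ^ 2) :=
    IsLocBdd.of_continuous (by fun_prop)
  have local_ineq : ∀ (k : ℕ) (t : ℝ), (k : ℝ) * h ≤ t → t ≤ ((k : ℝ) + 1) * h →
      Real.pi ^ 2 / 4 *
        ∫ s in (k * h : ℝ)..t, Real.exp (2 * α * s) * (f s - f (⌊s / h⌋₊ * h)) ^ 2 ≤
      h ^ 2 * Real.exp (2 * α * h) * ∫ s in (k * h : ℝ)..t, Real.exp (2 * α * s) * g s ^ 2 := by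
    intro k t h1 h2
    have hk : (0 : ℝ) ≤ k * h := by positivity
    have := wirtinger_exp (α := α) h1 hh (by linarith) hα hf.continuousOn hg.continuousOn
      fun s hs => (hd s (hk.trans hs.1.le)).mono Ioi_subset_Ici_self
    refine le_trans (le_of_eq ?_) this
    congr 1
    -- The open interval matters: if `t = (k + 1) h`, the floor jumps at the right endpoint.
    refine integral_congr_Ioo_of_le h1 fun s hs => ?_
    rw [floor_div_eq hh hs.1.le (hs.2.trans_le h2)]
  have grid : ∀ k : ℕ, N ≤ k → Real.pi ^ 2 / 4 *
        ∫ s in (N * h : ℝ)..(k * h), Real.exp (2 * α * s) * (f s - f (⌊s / h⌋₊ * h)) ^ 2 ≤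
      h ^ 2 * Real.exp (2 * α * h) *
        ∫ s in (N * h : ℝ)..(k * h), Real.exp (2 * α * s) * g s ^ 2 := by
    intro k hk
    induction k, hk using Nat.le_induction with
    | base => simp
    | succ k hk ih =>
      have h1 := local_ineq k ((k + 1 : ℕ) * h) (by push_cast; nlinarith) (by push_cast; rfl)
      rw [← integral_add_adjacent_intervals (hp1.intervalIntegrable _ (k * h))
        (hp1.intervalIntegrable _ _), ← integral_add_adjacent_intervals
        (hp2.intervalIntegrable _ (k * h)) (hp2.intervalIntegrable _ _)]
      linarith
  have ht0 : 0 ≤ t / h := div_nonneg (le_trans (by positivity) ht) hh.le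
  have hk1 : (⌊t / h⌋₊ : ℝ) * h ≤ t := (le_div_iff₀ hh).1 (Nat.floor_le ht0)
  have hk2 : t ≤ ((⌊t / h⌋₊ : ℝ) + 1) * h := ((div_lt_iff₀ hh).1 (Nat.lt_floor_add_one _)).le
  have hNk : N ≤ ⌊t / h⌋₊ := Nat.le_floor ((le_div_iff₀ hh).2 ht)
  rw [← integral_add_adjacent_intervals (hp1.intervalIntegrable _ (⌊t / h⌋₊ * h))
    (hp1.intervalIntegrable _ _), ← integral_add_adjacent_intervals
    (hp2.intervalIntegrable _ (⌊t / h⌋₊ * h)) (hp2.intervalIntegrable _ _)]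
  linarith [grid _ hNk, local_ineq _ t hk1 hk2]

theorem integral_mono_of_isLocBdd {g : ℝ → ℝ} (hg : IsLocBdd g) (hg0 : ∀ t, 0 ≤ g t) {a b c d : ℝ}
    (hca : c ≤ a) (hab : a ≤ b) (hbd : b ≤ d) : ∫ s in a..b, g s ≤ ∫ s in c..d, g s :=
  integral_mono_interval hca hab hbd (Eventually.of_forall hg0) (hg.intervalIntegrable _ _)

/-- The effect of sampling on a delayed signal. -/
theorem sampled_delay_bound {f g : ℝ → ℝ} {h α : ℝ} (hh : 0 < h) (hα : 0 ≤ α)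
    (hf : Continuous f) (hg : Continuous g)
    (hd : ∀ t, 0 ≤ t → HasDerivWithinAt f (g t) (Ici t) t) {q N : ℕ} (hq : q ≤ N) {t : ℝ}
    (ht : (N : ℝ) * h ≤ t) :
    Real.pi ^ 2 / 4 * ∫ s in (N * h : ℝ)..t, Real.exp (2 * α * (s - q * h)) *
        (f (⌊s / h⌋₊ * h - q * h) - f (s - q * h)) ^ 2 ≤
      h ^ 2 * Real.exp (2 * α * h) *
        ∫ s in (N * h - q * h : ℝ)..t, Real.exp (2 * α * s) * g s ^ 2 := by
  have hp2 : IsLocBdd (fun s => Real.exp (2 * α * s) * g s ^ 2) :=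
    IsLocBdd.of_continuous (by fun_prop)
  have hqh : (0 : ℝ) ≤ q * h := by positivity
  have h1 : ∫ s in (N * h : ℝ)..t, Real.exp (2 * α * (s - q * h)) *
        (f (⌊s / h⌋₊ * h - q * h) - f (s - q * h)) ^ 2 =
      ∫ s in ((N - q : ℕ) * h : ℝ)..(t - q * h), Real.exp (2 * α * s) *
        (f s - f (⌊s / h⌋₊ * h)) ^ 2 := by
    -- The delay is a whole number of sampling periods, so shifting time by `q h` maps the sampling
    -- grid to itself and lowers the floor by exactly `q`.
    have := integral_comp_sub_right (a := (N * h : ℝ)) (b := t) (fun s => Real.exp (2 * α * s) *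
        (f s - f (⌊s / h⌋₊ * h)) ^ 2) (q * h : ℝ)
    rw [Nat.cast_sub hq, sub_mul, ← this]
    refine integral_congr fun s hs => ?_
    rw [uIcc_of_le ht] at hs
    have hs2 : (q : ℝ) ≤ s / h := by
      rw [le_div_iff₀ hh]
      refine le_trans ?_ hs.1
      gcongr
    have e : (s - q * h) / h = s / h - q := by field_simp
    have h3 : q ≤ ⌊s / h⌋₊ := Nat.le_floor hs2
    simp only [e, Nat.floor_sub_natCast, Nat.cast_sub h3, sub_mul]
    ring
  have h2 : ((N - q : ℕ) : ℝ) * h = N * h - q * h := by rw [Nat.cast_sub hq]; ring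
  have h3 := sampled_wirtinger (t := t - q * h) hh hα hf hg hd (N - q) (by linarith)
  rw [h1]
  refine h3.trans ?_
  rw [h2]
  gcongr
  exact integral_mono_of_isLocBdd hp2 (fun s => by positivity) le_rfl (by linarith) (by linarith)

end Integrals

/-! ### The Taylor remainder of a delayed signal in weighted `L²`. -/

section TaylorRemainder

open Set MeasureTheory Filter Topology intervalIntegral

/-- The remainder of the Taylor polynomial of order `r - 1` at `s`, evaluated at `s - η`. The
functions `F j` play the role of the successive derivatives. -/
def taylorRem (r : ℕ) (F : ℕ → ℝ → ℝ) (η s : ℝ) : ℝ :=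
  F 0 (s - η) - ∑ j ∈ Finset.range r, (-η) ^ j / (j ! : ℝ) * F j s

/-- Moving the expansion point makes the derivative telescope: only the term with the highest `F`
survives. -/
theorem hasDerivWithinAt_taylor_sum {F : ℕ → ℝ → ℝ} {k : ℕ} {t σ : ℝ} {S : Set ℝ}
    (hd : ∀ j, j < k + 1 → HasDerivWithinAt (F j) (F (j + 1) t) S t) :
    HasDerivWithinAt (fun τ => ∑ j ∈ Finset.range (k + 1), (σ - τ) ^ j / (j ! : ℝ) * F j τ)
      ((σ - t) ^ k / (k ! : ℝ) * F (k + 1) t) S t := by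
  induction k with
  | zero => simpa using hd 0 (by simp)
  | succ k ih =>
    have h1 := ih fun j hj => hd j (by omega)
    have h2 : HasDerivWithinAt (fun τ => (σ - τ) ^ (k + 1) / ((k + 1)! : ℝ))
        (-((σ - t) ^ k / (k ! : ℝ))) S t := by
      have h3 : HasDerivAt (fun τ => (σ - τ)) (-1) t := by
        simpa using (hasDerivAt_id t).const_sub σ
      refine (((h3.pow (k + 1)).div_const ((k + 1)! : ℝ)).hasDerivWithinAt).congr_deriv ?_
      have : (k ! : ℝ) ≠ 0 := by positivity
      rw [Nat.factorial_succ]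
      push_cast
      field_simp
    have h4 := h1.add (h2.mul (hd (k + 1) (by omega)))
    refine (h4.congr_deriv ?_).congr_of_eventuallyEq ?_ ?_
    · ring
    · refine Eventually.of_forall fun τ => ?_
      simp only [Finset.sum_range_succ _ (k + 1)]; rfl
    · simp only [Finset.sum_range_succ _ (k + 1)]; rfl

/-- The fundamental theorem of calculus along the expansion point, from `s - η`, where only the term
`j = 0` remains, to `s`. The top function `F (k + 1)` is only a locally bounded right derivative,
because the `r`-th output derivative jumps with the input. -/
theorem taylorRem_eq {F : ℕ → ℝ → ℝ} {k : ℕ} {η s : ℝ} (hη : 0 ≤ η) (hs : η ≤ s)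
    (hc : ∀ j, j < k + 1 → Continuous (F j))
    (hd : ∀ j, j < k + 1 → ∀ t, 0 ≤ t → HasDerivWithinAt (F j) (F (j + 1) t) (Ici t) t)
    (hF : IsLocBdd (F (k + 1))) :
    taylorRem (k + 1) F η s =
      -∫ t in (s - η)..s, (s - η - t) ^ k / (k ! : ℝ) * F (k + 1) t := by
  have h := integral_eq_sub_of_hasDeriv_right_of_le (a := s - η) (b := s)
    (f := fun τ => ∑ j ∈ Finset.range (k + 1), (s - η - τ) ^ j / (j ! : ℝ) * F j τ)
    (f' := fun t => (s - η - t) ^ k / (k ! : ℝ) * F (k + 1) t) (by linarith) ?_ ?_ ?_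
  · rw [h, taylorRem, neg_sub]
    congr 1
    · rw [Finset.sum_range_succ', Finset.sum_eq_zero] <;> simp
    · refine Finset.sum_congr rfl fun j _ => ?_
      rw [show s - η - s = -η by ring]
  · refine (continuous_finsetSum _ fun j hj => ?_).continuousOn
    exact Continuous.mul (by fun_prop) (hc j (Finset.mem_range.1 hj))
  · intro t ht
    exact (hasDerivWithinAt_taylor_sum fun j hj => hd j hj t (by linarith [ht.1])).mono
      Ioi_subset_Ici_self
  · exact ((IsLocBdd.of_continuous (by fun_prop)).mul hF).intervalIntegrable _ _

/-- Jensen's inequality with a nonnegative weight. -/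
theorem sq_integral_mul_le {ρ g : ℝ → ℝ} {a b m : ℝ} (hab : a ≤ b) (hρ : Continuous ρ)
    (hg : IsLocBdd g) (hρ0 : ∀ t ∈ Icc a b, 0 ≤ ρ t) (hm : 0 < m)
    (hmρ : ∫ t in a..b, ρ t = m) :
    (∫ t in a..b, ρ t * g t) ^ 2 ≤ m * ∫ t in a..b, ρ t * g t ^ 2 := by
  set p := (∫ t in a..b, ρ t * g t) / m with hp
  have hρ' := IsLocBdd.of_continuous hρ
  -- Here `p` is the weighted mean of `g`, and the pointwise inequality is `ρ (g - p)² ≥ 0`.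
  have e1 : ∫ t in a..b, (2 * p * (ρ t * g t) - p ^ 2 * ρ t) ≤ ∫ t in a..b, ρ t * g t ^ 2 := by
    refine integral_mono_on hab
      ((((hρ'.mul hg).const_mul (2 * p)).sub (hρ'.const_mul _)).intervalIntegrable _ _)
      ((hρ'.mul hg.sq).intervalIntegrable _ _) fun t ht => ?_
    nlinarith [mul_nonneg (hρ0 t ht) (sq_nonneg (g t - p))]
  rw [intervalIntegral.integral_sub (((hρ'.mul hg).const_mul _).intervalIntegrable _ _)
    ((hρ'.const_mul _).intervalIntegrable _ _), intervalIntegral.integral_const_mul,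
    intervalIntegral.integral_const_mul, hmρ] at e1
  have e2 : ∫ t in a..b, ρ t * g t = m * p := by rw [hp]; field_simp
  rw [e2] at e1 ⊢
  nlinarith

/-- Jensen's inequality for the weight `(t - (s - η))^k`, of mass `η^(k+1) / (k + 1)`. Combined with
the `1 / k!` of the remainder formula, this turns the factor `(k + 1)!²` on the left into `k + 1` on
the right. -/
theorem taylorRem_sq_le {F : ℕ → ℝ → ℝ} {k : ℕ} {η s : ℝ} (hη : 0 < η) (hs : η ≤ s)
    (hc : ∀ j, j < k + 1 → Continuous (F j))
    (hd : ∀ j, j < k + 1 → ∀ t, 0 ≤ t → HasDerivWithinAt (F j) (F (j + 1) t) (Ici t) t)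
    (hF : IsLocBdd (F (k + 1))) :
    ((k + 1)! : ℝ) ^ 2 / η ^ (k + 1) * taylorRem (k + 1) F η s ^ 2 ≤
      ((k : ℝ) + 1) * ∫ t in (s - η)..s, (t - (s - η)) ^ k * F (k + 1) t ^ 2 := by
  have h1 : ∫ t in (s - η)..s, (t - (s - η)) ^ k = η ^ (k + 1) / ((k : ℝ) + 1) := by
    rw [integral_comp_sub_right (fun t => t ^ k) (s - η), integral_pow]
    simp
  have h2 := sq_integral_mul_le (ρ := fun t => (t - (s - η)) ^ k) (a := s - η) (b := s)
    (by linarith) (by fun_prop) hF (fun t ht => pow_nonneg (by linarith [ht.1]) _)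
    (by positivity) h1
  have h3 : taylorRem (k + 1) F η s ^ 2 =
      (∫ t in (s - η)..s, (t - (s - η)) ^ k * F (k + 1) t) ^ 2 / (k ! : ℝ) ^ 2 := by
    rw [taylorRem_eq hη.le hs hc hd hF, neg_sq, ← div_pow]
    have : ∫ t in (s - η)..s, (s - η - t) ^ k / (k ! : ℝ) * F (k + 1) t =
        (-1) ^ k * ((∫ t in (s - η)..s, (t - (s - η)) ^ k * F (k + 1) t) / (k ! : ℝ)) := by
      rw [← intervalIntegral.integral_div, ← intervalIntegral.integral_const_mul]
      refine integral_congr fun t _ => ?_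
      rw [show s - η - t = (-1) * (t - (s - η)) by ring, mul_pow]
      ring
    rw [this, mul_pow, ← pow_mul, mul_comm k 2, pow_mul]
    simp
  have hk : (k ! : ℝ) ≠ 0 := by positivity
  rw [h3, Nat.factorial_succ]
  push_cast
  set I := ∫ t in (s - η)..s, (t - (s - η)) ^ k * F (k + 1) t
  set J := ∫ t in (s - η)..s, (t - (s - η)) ^ k * F (k + 1) t ^ 2
  calc _ = ((k : ℝ) + 1) ^ 2 / η ^ (k + 1) * I ^ 2 := by field_simp
    _ ≤ ((k : ℝ) + 1) ^ 2 / η ^ (k + 1) * (η ^ (k + 1) / ((k : ℝ) + 1) * J) := by gcongr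
    _ = _ := by field_simp

theorem integrable_moving_average {G : ℝ → ℝ} (hG : IsLocBdd G) {ρ : ℝ → ℝ} (hρ : Continuous ρ)
    (a b η : ℝ) :
    Integrable (Function.uncurry fun s θ => ρ θ * G (s - η + θ))
      ((volume.restrict (Ioc a b)).prod (volume.restrict (Ioc 0 η))) := by
  obtain ⟨c, hc⟩ := hG.2 (|a| + |b| + 2 * η)
  obtain ⟨d, hd⟩ := (IsLocBdd.of_continuous hρ).2 η
  rw [Measure.prod_restrict]
  refine Measure.integrableOn_of_bounded (M := d * c) ?_ ?_ ?_
  · rw [Measure.prod_prod]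
    exact (ENNReal.mul_lt_top measure_Ioc_lt_top measure_Ioc_lt_top).ne
  · refine Measurable.aestronglyMeasurable ?_
    have := hG.1
    have := hρ.measurable
    fun_prop
  · filter_upwards [ae_restrict_mem (measurableSet_Ioc.prod measurableSet_Ioc)] with p hp
    obtain ⟨⟨h1, h2⟩, h3, h4⟩ := hp
    have hd' := hd p.2 (abs_le.2 ⟨by linarith, h4⟩)
    have hc' := hc (p.1 - η + p.2) (abs_le.2
      ⟨by linarith [neg_abs_le a, abs_nonneg b], by linarith [le_abs_self b, abs_nonneg a]⟩)
    simp only [Function.uncurry, Real.norm_eq_abs, abs_mul]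
    exact mul_le_mul hd' hc' (abs_nonneg _) ((abs_nonneg _).trans hd')

/-- After `t = s - η + θ` and Fubini, each fixed `θ` contributes `θ^k` times an integral of `G` over
a window inside `[a - η, b]`. The mass `η^(k+1) / (k + 1)` of `θ^k` cancels the prefactor. -/
theorem integral_moving_average_le {G : ℝ → ℝ} (hG : IsLocBdd G) (hG0 : ∀ t, 0 ≤ G t) (k : ℕ)
    {a b η : ℝ} (hab : a ≤ b) (hη : 0 ≤ η) :
    ∫ s in a..b, (((k : ℝ) + 1) * ∫ t in (s - η)..s, (t - (s - η)) ^ k * G t) ≤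
      η ^ (k + 1) * ∫ s in (a - η)..b, G s := by
  have h1 : ∀ s, ∫ t in (s - η)..s, (t - (s - η)) ^ k * G t =
      ∫ θ in (0 : ℝ)..η, θ ^ k * G (s - η + θ) := fun s => by
    have := integral_comp_add_left (a := 0) (b := η) (fun t => (t - (s - η)) ^ k * G t) (s - η)
    simp only [add_sub_cancel_left, add_zero, sub_add_cancel] at this
    exact this.symm
  have hI := integrable_moving_average hG (ρ := fun θ => θ ^ k) (by fun_prop) a b η
  have h2 : ∫ s in a..b, ∫ θ in (0 : ℝ)..η, θ ^ k * G (s - η + θ) =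
      ∫ θ in (0 : ℝ)..η, ∫ s in a..b, θ ^ k * G (s - η + θ) := by
    simp only [integral_of_le hab, integral_of_le hη]
    exact integral_integral_swap hI
  have h3 : ∀ θ ∈ Icc 0 η, ∫ s in a..b, θ ^ k * G (s - η + θ) ≤
      θ ^ k * ∫ s in (a - η)..b, G s := fun θ hθ => by
    rw [intervalIntegral.integral_const_mul]
    have e : ∫ s in a..b, G (s - η + θ) = ∫ s in (a - (η - θ))..(b - (η - θ)), G s := by
      rw [← integral_comp_sub_right]
      refine integral_congr fun s _ => ?_
      congr 1
      ring
    rw [e]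
    refine mul_le_mul_of_nonneg_left (integral_mono_of_isLocBdd hG hG0 ?_ ?_ ?_)
      (pow_nonneg hθ.1 _) <;> linarith [hθ.1, hθ.2]
  simp only [h1]
  rw [intervalIntegral.integral_const_mul, h2]
  have h4 : ∫ θ in (0 : ℝ)..η, ∫ s in a..b, θ ^ k * G (s - η + θ) ≤
      ∫ θ in (0 : ℝ)..η, θ ^ k * ∫ s in (a - η)..b, G s := by
    refine integral_mono_on hη ?_ (Continuous.intervalIntegrable (by fun_prop) _ _) h3
    rw [intervalIntegrable_iff_integrableOn_Ioc_of_le hη]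
    simp only [integral_of_le hab]
    exact hI.integral_prod_right
  rw [intervalIntegral.integral_mul_const, integral_pow] at h4
  calc _ ≤ ((k : ℝ) + 1) * ((η ^ (k + 1) - 0 ^ (k + 1)) / (k + 1) * ∫ s in (a - η)..b, G s) := by
        gcongr
    _ = _ := by field_simp; simp

/-- The weighted `L²` bound for the Taylor remainder of a delayed signal. -/
theorem taylor_delay_bound {F : ℕ → ℝ → ℝ} {k : ℕ} {η α : ℝ} (hη : 0 < η) (hα : 0 ≤ α)
    (hc : ∀ j, j < k + 1 → Continuous (F j))
    (hd : ∀ j, j < k + 1 → ∀ t, 0 ≤ t → HasDerivWithinAt (F j) (F (j + 1) t) (Ici t) t)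
    (hF : IsLocBdd (F (k + 1))) {T t : ℝ} (hT : η ≤ T) (ht : T ≤ t) :
    ((k + 1)! : ℝ) ^ 2 / η ^ (k + 1) *
        ∫ s in T..t, Real.exp (2 * α * (s - η)) * taylorRem (k + 1) F η s ^ 2 ≤
      η ^ (k + 1) * ∫ s in (T - η)..t, Real.exp (2 * α * s) * F (k + 1) s ^ 2 := by
  have hG : IsLocBdd fun s => Real.exp (2 * α * s) * F (k + 1) s ^ 2 :=
    (IsLocBdd.of_continuous (by fun_prop)).mul hF.sq
  refine le_trans ?_ (integral_moving_average_le hG (fun s => by positivity) k ht hη.le)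
  rw [← intervalIntegral.integral_const_mul]
  have hI := (integrable_moving_average hG (ρ := fun θ => θ ^ k) (by fun_prop) T t η)
  have hrem : Continuous (taylorRem (k + 1) F η) := by
    unfold taylorRem
    refine ((hc 0 (by omega)).comp (by fun_prop)).sub (continuous_finsetSum _ fun j hj => ?_)
    exact continuous_const.mul (hc j (Finset.mem_range.1 hj))
  refine integral_mono_on ht (Continuous.intervalIntegrable (by fun_prop) _ _) ?_ fun s hs => ?_
  · have h1 : ∀ s, ∫ t in (s - η)..s, (t - (s - η)) ^ k * (Real.exp (2 * α * t) *
        F (k + 1) t ^ 2) = ∫ θ in (0 : ℝ)..η, θ ^ k * (Real.exp (2 * α * (s - η + θ)) *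
        F (k + 1) (s - η + θ) ^ 2) := fun s => by
      have := integral_comp_add_left (a := 0) (b := η) (fun t => (t - (s - η)) ^ k *
        (Real.exp (2 * α * t) * F (k + 1) t ^ 2)) (s - η)
      simp only [add_sub_cancel_left, add_zero, sub_add_cancel] at this
      exact this.symm
    simp only [h1]
    rw [intervalIntegrable_iff_integrableOn_Ioc_of_le ht]
    simp only [integral_of_le hη.le]
    exact hI.integral_prod_left.const_mul _
  · have h1 := taylorRem_sq_le hη (hT.trans hs.1) hc hd hF
    calc _ = Real.exp (2 * α * (s - η)) *
          (((k + 1)! : ℝ) ^ 2 / η ^ (k + 1) * taylorRem (k + 1) F η s ^ 2) := by ring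
      _ ≤ Real.exp (2 * α * (s - η)) * (((k : ℝ) + 1) *
          ∫ t in (s - η)..s, (t - (s - η)) ^ k * F (k + 1) t ^ 2) := by gcongr
      _ = ((k : ℝ) + 1) * ∫ t in (s - η)..s, Real.exp (2 * α * (s - η)) *
          ((t - (s - η)) ^ k * F (k + 1) t ^ 2) := by
        rw [intervalIntegral.integral_const_mul]; ring
      -- Since `s - η ≤ t` on the window, `e^(2α(s - η)) ≤ e^(2αt)`. The weight evaluated at the
      -- delayed time can therefore be moved inside the integral.
      _ ≤ _ := by
        refine mul_le_mul_of_nonneg_left ?_ (by positivity)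
        have hp : IsLocBdd fun t => (t - (s - η)) ^ k := IsLocBdd.of_continuous (by fun_prop)
        refine integral_mono_on (by linarith)
          (((hp.mul hF.sq).const_mul _).intervalIntegrable _ _)
          ((hp.mul hG).intervalIntegrable _ _) fun τ hτ => ?_
        have h2 : 0 ≤ (τ - (s - η)) ^ k := pow_nonneg (by linarith [hτ.1]) _
        rw [mul_left_comm]
        have := hτ.1
        gcongr

end TaylorRemainder

/-! ### Matrix flows, existence of sampled-data trajectories, and their growth on bounded intervals.
-/

section Existence

open Set MeasureTheory Filter Topology intervalIntegral

/-- The flow `e^{t A}`. -/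
def flow {n : ℕ} (A : Matrix (Fin n) (Fin n) ℝ) (t : ℝ) : Matrix (Fin n) (Fin n) ℝ :=
  NormedSpace.exp (t • A)

section Flow

attribute [local instance] Matrix.linftyOpNormedAddCommGroup Matrix.linftyOpNormedRing
  Matrix.linftyOpNormedAlgebra

theorem flow_zero {n : ℕ} (A : Matrix (Fin n) (Fin n) ℝ) : flow A 0 = 1 := by
  simp [flow]

theorem hasDerivAt_flow_apply {n : ℕ} (A : Matrix (Fin n) (Fin n) ℝ) (t : ℝ) (a b : Fin n) :
    HasDerivAt (fun s => flow A s a b) ((A * flow A t) a b) t := by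
  have h := hasDerivAt_exp_smul_const' (𝕂 := ℝ) A t
  let L : Matrix (Fin n) (Fin n) ℝ →L[ℝ] ℝ := LinearMap.toContinuousLinearMap
    { toFun := fun M => M a b, map_add' := fun _ _ => rfl, map_smul' := fun _ _ => rfl }
  exact L.hasFDerivAt.comp_hasDerivAt t h

theorem flow_mul_flow_neg {n : ℕ} (A : Matrix (Fin n) (Fin n) ℝ) (t : ℝ) :
    flow A t * flow A (-t) = 1 := by
  unfold flow
  rw [← Matrix.exp_add_of_commute]
  · simp
  · exact (Commute.refl A).smul_left t |>.smul_right (-t)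

theorem flow_mul_comm {n : ℕ} (A : Matrix (Fin n) (Fin n) ℝ) (t : ℝ) :
    flow A t * A = A * flow A t :=
  ((((Commute.refl A).smul_right t).exp_right).eq).symm

theorem exists_mulVec_bound {n m : ℕ} (A : Matrix (Fin n) (Fin m) ℝ) :
    ∃ a : ℝ, 0 ≤ a ∧ ∀ v, ‖A *ᵥ v‖ ≤ a * ‖v‖ :=
  ⟨‖A‖, norm_nonneg _, fun v => Matrix.linfty_opNorm_mulVec A v⟩

end Flow

theorem continuous_flow_apply {n : ℕ} (A : Matrix (Fin n) (Fin n) ℝ) (a b : Fin n) :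
    Continuous (fun s => flow A s a b) :=
  continuous_iff_continuousAt.2 fun t => (hasDerivAt_flow_apply A t a b).continuousAt

theorem continuous_flow {n : ℕ} (A : Matrix (Fin n) (Fin n) ℝ) : Continuous (flow A) :=
  continuous_matrix fun a b => continuous_flow_apply A a b

theorem continuous_flow_neg_mul {n m : ℕ} (A : Matrix (Fin n) (Fin n) ℝ)
    (B : Matrix (Fin n) (Fin m) ℝ) : Continuous fun s => flow A (-s) * B :=
  ((continuous_flow A).comp continuous_neg).matrix_mul continuous_const

theorem hasDerivWithinAt_flow_mulVec {n : ℕ} (A : Matrix (Fin n) (Fin n) ℝ) {z : ℝ → Fin n → ℝ}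
    {z' : Fin n → ℝ} {t : ℝ} {S : Set ℝ} (hz : HasDerivWithinAt z z' S t) :
    HasDerivWithinAt (fun s => flow A s *ᵥ z s) (A *ᵥ (flow A t *ᵥ z t) + flow A t *ᵥ z') S t := by
  rw [hasDerivWithinAt_pi] at hz ⊢
  intro a
  have h := HasDerivWithinAt.fun_sum (u := Finset.univ) fun b _ =>
    ((hasDerivAt_flow_apply A t a b).hasDerivWithinAt (s := S)).mul (hz b)
  refine h.congr_deriv ?_
  simp only [Finset.sum_add_distrib, Matrix.mulVec_mulVec, Pi.add_apply]
  rfl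

/-- The solution of `x' = A x + B u`, `x 0 = x₀`, with `u` equal to `w k` on the `k`-th sampling
interval. -/
def stepSolution {n m : ℕ} (A : Matrix (Fin n) (Fin n) ℝ) (B : Matrix (Fin n) (Fin m) ℝ) (h : ℝ)
    (x₀ : Fin n → ℝ) (w : ℕ → Fin m → ℝ) (t : ℝ) : Fin n → ℝ :=
  flow A t *ᵥ fun a => x₀ a + ∫ s in (0 : ℝ)..t, ((flow A (-s) * B) *ᵥ w ⌊s / h⌋₊) a

theorem stepSolution_zero {n m : ℕ} (A : Matrix (Fin n) (Fin n) ℝ) (B : Matrix (Fin n) (Fin m) ℝ)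
    (h : ℝ) (x₀ : Fin n → ℝ) (w : ℕ → Fin m → ℝ) : stepSolution A B h x₀ w 0 = x₀ := by
  simp [stepSolution, flow_zero]

/-- Causality: before time `k h` only the held values with index less than `k` enter the variation
of constants formula. -/
theorem stepSolution_congr {n m : ℕ} (A : Matrix (Fin n) (Fin n) ℝ) (B : Matrix (Fin n) (Fin m) ℝ)
    {h : ℝ} (hh : 0 < h) (x₀ : Fin n → ℝ) {w w' : ℕ → Fin m → ℝ} {k : ℕ}
    (hw : ∀ j < k, w j = w' j) {t : ℝ} (ht0 : 0 ≤ t) (ht : t ≤ k * h) :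
    stepSolution A B h x₀ w t = stepSolution A B h x₀ w' t := by
  unfold stepSolution
  congr 1
  funext a
  congr 1
  refine integral_congr_Ioo_of_le ht0 fun s hs => ?_
  have h1 : ⌊s / h⌋₊ < k := by
    rw [Nat.floor_lt (div_nonneg hs.1.le hh.le), div_lt_iff₀ hh]
    exact hs.2.trans_le ht
  simp only [hw _ h1]

theorem isLocBdd_stepSolution_integrand {n m : ℕ} (A : Matrix (Fin n) (Fin n) ℝ)
    (B : Matrix (Fin n) (Fin m) ℝ) {h : ℝ} (hh : 0 < h) (w : ℕ → Fin m → ℝ) (a : Fin n) :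
    IsLocBdd fun s => ((flow A (-s) * B) *ᵥ w ⌊s / h⌋₊) a := by
  refine IsLocBdd.sum Finset.univ fun b _ => IsLocBdd.mul (IsLocBdd.of_continuous ?_)
    (IsLocBdd.step hh fun k => w k b)
  exact (continuous_flow_neg_mul A B).matrix_elem a b

theorem eventually_floor_div_eq {h t : ℝ} (hh : 0 < h) (ht : 0 ≤ t) :
    ∀ᶠ s in 𝓝[≥] t, ⌊s / h⌋₊ = ⌊t / h⌋₊ := by
  have h1 : t < (⌊t / h⌋₊ + 1) * h := (div_lt_iff₀ hh).1 (Nat.lt_floor_add_one _)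
  filter_upwards [Ico_mem_nhdsGE h1] with s hs
  refine floor_div_eq hh (le_trans ?_ hs.1) hs.2
  exact (le_div_iff₀ hh).1 (Nat.floor_le (div_nonneg ht hh.le))

/-- The held input is constant immediately to the right of every instant, so the integrand is right
continuous and the primitive has the required right derivative even at a jump. -/
theorem isTrajectory_stepSolution {n m : ℕ} (A : Matrix (Fin n) (Fin n) ℝ)
    (B : Matrix (Fin n) (Fin m) ℝ) {h : ℝ} (hh : 0 < h) (x₀ : Fin n → ℝ) (w : ℕ → Fin m → ℝ) :
    IsTrajectory A B (fun t => w ⌊t / h⌋₊) (stepSolution A B h x₀ w) := by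
  have hloc := isLocBdd_stepSolution_integrand A B hh w
  constructor
  · refine Continuous.continuousOn ?_
    refine (continuous_flow A).matrix_mulVec (continuous_pi fun a => continuous_const.add ?_)
    exact continuous_primitive (fun c d => (hloc a).intervalIntegrable c d) 0
  · intro t ht
    have h1 : HasDerivWithinAt (fun t => fun a => x₀ a +
        ∫ s in (0 : ℝ)..t, ((flow A (-s) * B) *ᵥ w ⌊s / h⌋₊) a)
        ((flow A (-t) * B) *ᵥ w ⌊t / h⌋₊) (Ici t) t := by
      rw [hasDerivWithinAt_pi]
      intro a
      refine HasDerivWithinAt.const_add _ ?_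
      refine integral_hasDerivWithinAt_right ((hloc a).intervalIntegrable _ _) (t := Ioi t)
        ((hloc a).1.stronglyMeasurable.stronglyMeasurableAtFilter) ?_
      have h2 : Continuous fun s => ((flow A (-s) * B) *ᵥ w ⌊t / h⌋₊) a :=
        (continuous_apply a).comp
          ((continuous_flow_neg_mul A B).matrix_mulVec continuous_const)
      refine (h2.continuousWithinAt (s := Ici t)).congr_of_eventuallyEq ?_ rfl |>.mono
        Ioi_subset_Ici_self
      filter_upwards [eventually_floor_div_eq hh ht] with s hs
      rw [hs]
    refine (hasDerivWithinAt_flow_mulVec A h1).congr_deriv ?_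
    rw [Matrix.mulVec_mulVec (M := flow A t), ← Matrix.mul_assoc, flow_mul_flow_neg,
      Matrix.one_mul]
    rfl

/-- Strong recursion on the index. The entries not yet computed are filled with `default`, which is
harmless because `G w k` depends only on entries before `k`. -/
theorem exists_causal_fixedPoint {β : Type*} [Inhabited β] (G : (ℕ → β) → ℕ → β)
    (hG : ∀ k w w', (∀ j < k, w j = w' j) → G w k = G w' k) : ∃ w : ℕ → β, ∀ k, w k = G w k := by
  let w : ℕ → β := fun k => Nat.strongRec (motive := fun _ => β)
    (fun k ih => G (fun j => if hj : j < k then ih j hj else default) k) k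
  refine ⟨w, fun k => ?_⟩
  have h1 : w k = G (fun j => if j < k then w j else default) k := by
    simp only [w]
    rw [Nat.strongRec]
    simp only [dite_eq_ite]
  rw [h1]
  exact hG _ _ _ fun j hj => by simp [hj]

/-- The held value on interval `k` uses the state at times at most `k h`, which depends only on
earlier held values. The loop is thus a causal fixed-point equation. -/
theorem exists_isSampledLoop {n m l : ℕ} (A : Matrix (Fin n) (Fin n) ℝ)
    (B : Matrix (Fin n) (Fin m) ℝ) (C : Matrix (Fin l) (Fin n) ℝ) (r : ℕ) {h : ℝ} (hh : 0 < h)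
    (q : ℕ → ℕ) (K : ℕ → Matrix (Fin m) (Fin l) ℝ) (x₀ : Fin n → ℝ) :
    ∃ x, IsSampledLoop A B C r h q K x ∧ x 0 = x₀ := by
  obtain ⟨w, hw⟩ := exists_causal_fixedPoint (fun (w : ℕ → Fin m → ℝ) (k : ℕ) =>
    ∑ i ∈ Finset.range r, K i *ᵥ
      output C (stepSolution A B h x₀ w) ((k : ℝ) * h - (q i : ℝ) * h)) (by
    intro k w w' hww
    refine Finset.sum_congr rfl fun i _ => ?_
    unfold output
    split_ifs with h0
    · rw [stepSolution_congr A B hh x₀ hww h0]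
      have : (0 : ℝ) ≤ q i * h := by positivity
      linarith
    · rfl)
  refine ⟨stepSolution A B h x₀ w, ⟨_, isTrajectory_stepSolution A B hh x₀ w, ?_⟩,
    stepSolution_zero A B h x₀ w⟩
  intro k t ht
  simp only [floor_div_eq hh ht.1 ht.2]
  exact hw k

/-- On every bounded time interval, the closed-loop trajectories depend boundedly on the initial
state. -/
theorem exists_bound_of_isSampledLoop {n m l : ℕ} (A : Matrix (Fin n) (Fin n) ℝ)
    (B : Matrix (Fin n) (Fin m) ℝ) (C : Matrix (Fin l) (Fin n) ℝ) (r : ℕ) {h : ℝ} (hh : 0 < h)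
    (q : ℕ → ℕ) (K : ℕ → Matrix (Fin m) (Fin l) ℝ) (k : ℕ) :
    ∃ c : ℝ, 0 ≤ c ∧ ∀ x, IsSampledLoop A B C r h q K x →
      ∀ t, 0 ≤ t → t ≤ k * h → ‖x t‖ ≤ c * ‖x 0‖ := by
  induction k with
  | zero =>
    refine ⟨1, zero_le_one, fun x _ t h0 h1 => ?_⟩
    have : t = 0 := le_antisymm (by simpa using h1) h0
    simp [this]
  | succ k ih =>
    obtain ⟨c, hc0, hc⟩ := ih
    obtain ⟨a, ha0, ha⟩ := exists_mulVec_bound A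
    obtain ⟨b, hb0, hb⟩ := exists_mulVec_bound B
    choose d hd0 hd using fun i => exists_mulVec_bound (K i * C)
    set e := b * ∑ i ∈ Finset.range r, d i * c with he
    have he0 : 0 ≤ e :=
      mul_nonneg hb0 (Finset.sum_nonneg fun i _ => mul_nonneg (hd0 i) hc0)
    -- The Gronwall bound over one period, with `e ‖x 0‖` bounding the forcing. The rate is `a + 1`
    -- instead of `a` so that it is nonzero and can be divided by.
    set c' := (c + e / (a + 1)) * Real.exp ((a + 1) * h) with hc'
    have hexp : 1 ≤ Real.exp ((a + 1) * h) := Real.one_le_exp (by positivity)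
    have hcc' : c ≤ c' := by
      have : 0 ≤ e / (a + 1) := by positivity
      nlinarith
    refine ⟨c', hc0.trans hcc', fun x hx t h0 h1 => ?_⟩
    rcases le_total t (k * h) with htk | htk
    · exact (hc x hx t h0 htk).trans (mul_le_mul_of_nonneg_right hcc' (norm_nonneg _))
    have hx' := hc x hx
    obtain ⟨u, ⟨hcont, hder⟩, hu⟩ := hx
    push_cast at h1
    have hk0 : (0 : ℝ) ≤ k * h := by positivity
    have hub : ∀ s ∈ Ico ((k : ℝ) * h) (((k : ℝ) + 1) * h), ‖B *ᵥ u s‖ ≤ e * ‖x 0‖ := by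
      intro s hs
      rw [he, mul_assoc, hu k s hs]
      refine (hb _).trans (mul_le_mul_of_nonneg_left ?_ hb0)
      rw [Finset.sum_mul]
      refine (norm_sum_le _ _).trans (Finset.sum_le_sum fun i _ => ?_)
      unfold output
      have hq : (0 : ℝ) ≤ q i * h := by positivity
      split_ifs with h2
      · rw [Matrix.mulVec_mulVec, mul_assoc]
        refine (hd i _).trans (mul_le_mul_of_nonneg_left (hx' _ h2 (by linarith)) (hd0 i))
      · rw [Matrix.mulVec_zero, norm_zero]
        exact mul_nonneg (mul_nonneg (hd0 i) hc0) (norm_nonneg _)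
    have hg := norm_le_gronwallBound_of_norm_deriv_right_le (f := x) (a := k * h)
      (b := (k + 1) * h) (δ := c * ‖x 0‖) (K := a + 1) (ε := e * ‖x 0‖)
      (hcont.mono fun s hs => hk0.trans hs.1) (fun s hs => hder s (hk0.trans hs.1))
      (hx' _ hk0 le_rfl) (fun s hs => by
        refine (norm_add_le _ _).trans (add_le_add ((ha _).trans ?_) (hub s hs))
        exact mul_le_mul_of_nonneg_right (by linarith) (norm_nonneg _)) t ⟨htk, h1⟩
    refine hg.trans ?_
    rw [gronwallBound_of_K_ne_0 (by positivity)]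
    have h3 : Real.exp ((a + 1) * (t - k * h)) ≤ Real.exp ((a + 1) * h) := by
      gcongr
      linarith
    have h4 : 0 ≤ c * ‖x 0‖ := by positivity
    have h5 : 0 ≤ e * ‖x 0‖ / (a + 1) := by positivity
    have e1 : c' * ‖x 0‖ = (c * ‖x 0‖ + e * ‖x 0‖ / (a + 1)) * Real.exp ((a + 1) * h) := by
      rw [hc']; ring
    rw [e1]
    nlinarith [mul_le_mul_of_nonneg_left h3 h4, mul_le_mul_of_nonneg_left h3 h5]

end Existence

/-! ### Euclidean norms and the vector forms of the sampling and Taylor bounds. -/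

section VectorBounds

open Set MeasureTheory Filter Topology intervalIntegral

/-- The squared Euclidean norm. -/
def sqNorm {ι : Type*} [Fintype ι] (v : ι → ℝ) : ℝ := v ⬝ᵥ v

theorem sqNorm_eq_sum {ι : Type*} [Fintype ι] (v : ι → ℝ) : sqNorm v = ∑ a, v a ^ 2 := by
  simp [sqNorm, dotProduct, pow_two]

theorem sqNorm_nonneg {ι : Type*} [Fintype ι] (v : ι → ℝ) : 0 ≤ sqNorm v := by
  rw [sqNorm_eq_sum]; positivity

theorem norm_toLp_sq {n : ℕ} (v : Fin n → ℝ) : ‖WithLp.toLp 2 v‖ ^ 2 = sqNorm v := by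
  rw [EuclideanSpace.norm_sq_eq, sqNorm_eq_sum]
  simp

/-- `‖v‖` is the sup norm, used for Gronwall and operator bounds. This lemma and the next pass
between it and the Euclidean norm of the energy estimates. -/
theorem norm_sq_le_sqNorm {n : ℕ} (v : Fin n → ℝ) : ‖v‖ ^ 2 ≤ sqNorm v := by
  have h : ‖v‖ ≤ √(sqNorm v) := by
    rw [pi_norm_le_iff_of_nonneg (Real.sqrt_nonneg _)]
    intro a
    refine Real.abs_le_sqrt ?_
    rw [sqNorm_eq_sum]
    exact Finset.single_le_sum (f := fun a => v a ^ 2) (fun _ _ => sq_nonneg _) (Finset.mem_univ a)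
  calc ‖v‖ ^ 2 ≤ √(sqNorm v) ^ 2 := by gcongr
    _ = _ := Real.sq_sqrt (sqNorm_nonneg v)

theorem sqNorm_le_of_norm_le {n : ℕ} {v : Fin n → ℝ} {c : ℝ} (h : ‖v‖ ≤ c) :
    sqNorm v ≤ n * c ^ 2 := by
  rw [sqNorm_eq_sum]
  calc ∑ a, v a ^ 2 ≤ ∑ _a : Fin n, c ^ 2 := Finset.sum_le_sum fun a _ => by
        rw [← sq_abs]
        have := (norm_le_pi_norm v a).trans h
        gcongr
        exact this
    _ = n * c ^ 2 := by simp

namespace IsLocBdd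

theorem mulVec {n m : ℕ} (G : Matrix (Fin m) (Fin n) ℝ) {z : ℝ → Fin n → ℝ}
    (hz : ∀ a, IsLocBdd fun s => z s a) (a : Fin m) : IsLocBdd fun s => (G *ᵥ z s) a :=
  sum Finset.univ fun b _ => (hz b).const_mul (G a b)

theorem sqNorm {m : ℕ} {z : ℝ → Fin m → ℝ}
    (hz : ∀ a, IsLocBdd fun s => z s a) : IsLocBdd fun s => sqNorm (z s) := by
  simp only [sqNorm_eq_sum]
  exact sum Finset.univ fun a _ => (hz a).sq

theorem exp_mul {f : ℝ → ℝ} (hf : IsLocBdd f) (α c : ℝ) :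
    IsLocBdd fun s => Real.exp (2 * α * (s - c)) * f s :=
  (of_continuous (by fun_prop)).mul hf

end IsLocBdd

theorem integral_exp_sqNorm {m : ℕ} {z : ℝ → Fin m → ℝ} (hz : ∀ a, IsLocBdd fun s => z s a)
    (α c a b : ℝ) : ∫ s in a..b, Real.exp (2 * α * (s - c)) * sqNorm (z s) =
      ∑ i, ∫ s in a..b, Real.exp (2 * α * (s - c)) * z s i ^ 2 := by
  rw [← intervalIntegral.integral_finsetSum fun i _ =>
    ((hz i).sq.exp_mul α c).intervalIntegrable a b]
  refine integral_congr fun s _ => ?_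
  simp only [sqNorm_eq_sum, Finset.mul_sum]

section Signals

variable {n l m : ℕ} {A : Matrix (Fin n) (Fin n) ℝ} {C : Matrix (Fin l) (Fin n) ℝ}
  {X g : ℝ → Fin n → ℝ}

theorem hasDerivWithinAt_mulVec {n m : ℕ} (G : Matrix (Fin m) (Fin n) ℝ) {x : ℝ → Fin n → ℝ}
    {x' : Fin n → ℝ} {t : ℝ} {S : Set ℝ} (hx : HasDerivWithinAt x x' S t) :
    HasDerivWithinAt (fun s => G *ᵥ x s) (G *ᵥ x') S t :=
  (Matrix.mulVecLin G).toContinuousLinearMap.hasFDerivAt.comp_hasDerivWithinAt t hx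

/-- The scalar bound for each coordinate of `G C X`. Because the input does not enter the first
derivative of the output, that derivative is `C A X`, hence continuous. -/
theorem sampled_delay_bound_vec (hX : Continuous X)
    (hd : ∀ t, 0 ≤ t → HasDerivWithinAt X (g t) (Ici t) t)
    (hCB : ∀ t, 0 ≤ t → C *ᵥ g t = (C * A) *ᵥ X t)
    {h α : ℝ} (hh : 0 < h) (hα : 0 ≤ α) {q N : ℕ} (hq : q ≤ N) {t : ℝ}
    (ht : (N : ℝ) * h ≤ t) (G : Matrix (Fin m) (Fin l) ℝ) :
    Real.pi ^ 2 / 4 * ∫ s in (N * h : ℝ)..t, Real.exp (2 * α * (s - q * h)) *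
        sqNorm (G *ᵥ (C *ᵥ X (⌊s / h⌋₊ * h - q * h) - C *ᵥ X (s - q * h))) ≤
      h ^ 2 * Real.exp (2 * α * h) *
        ∫ s in (N * h - q * h : ℝ)..t, Real.exp (2 * α * (s - 0)) *
          sqNorm (G *ᵥ ((C * A) *ᵥ X s)) := by
  have hc : ∀ a, Continuous fun s => (G *ᵥ (C *ᵥ X s)) a := fun a => (continuous_apply a).comp
    (continuous_const.matrix_mulVec (continuous_const.matrix_mulVec hX))
  have hc' : ∀ a, Continuous fun s => (G *ᵥ ((C * A) *ᵥ X s)) a := fun a =>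
    (continuous_apply a).comp (continuous_const.matrix_mulVec (continuous_const.matrix_mulVec hX))
  have e : ∀ s a, (G *ᵥ (C *ᵥ X (⌊s / h⌋₊ * h - q * h) - C *ᵥ X (s - q * h))) a =
      (G *ᵥ (C *ᵥ X (⌊s / h⌋₊ * h - q * h))) a - (G *ᵥ (C *ᵥ X (s - q * h))) a := fun s a => by
    rw [Matrix.mulVec_sub]; rfl
  rw [integral_exp_sqNorm, integral_exp_sqNorm fun a => IsLocBdd.of_continuous (hc' a),
    Finset.mul_sum, Finset.mul_sum]
  · refine Finset.sum_le_sum fun a _ => ?_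
    simp only [e, sub_zero]
    refine sampled_delay_bound (f := fun s => (G *ᵥ (C *ᵥ X s)) a) hh hα (hc a) (hc' a) ?_ hq ht
    intro s hs
    have := hasDerivWithinAt_mulVec G (hasDerivWithinAt_mulVec C (hd s hs))
    rw [hCB s hs] at this
    exact (hasDerivWithinAt_pi.1 this) a
  · intro a
    simp only [e]
    exact (IsLocBdd.step hh fun k => (G *ᵥ (C *ᵥ X (k * h - q * h))) a).sub
      (IsLocBdd.of_continuous ((hc a).comp (continuous_sub_right _)))

/-- The Taylor remainder of the output of a trajectory. -/
def outputRem (A : Matrix (Fin n) (Fin n) ℝ) (C : Matrix (Fin l) (Fin n) ℝ) (r : ℕ) (η : ℝ)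
    (X : ℝ → Fin n → ℝ) (s : ℝ) : Fin l → ℝ :=
  C *ᵥ X (s - η) - ∑ j ∈ Finset.range r, ((-η) ^ j / (j ! : ℝ)) • ((C * A ^ j) *ᵥ X s)

theorem continuous_outputRem (hX : Continuous X) (r : ℕ) (η : ℝ) :
    Continuous (outputRem A C r η X) := by
  unfold outputRem
  refine (continuous_const.matrix_mulVec (hX.comp (continuous_sub_right _))).sub
    (continuous_finsetSum _ fun j _ => ?_)
  have h := continuous_const (y := C * A ^ j) |>.matrix_mulVec hX
  exact h.const_smul ((-η) ^ j / (j ! : ℝ))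

/-- The scalar bound for each coordinate of `G C X`. The derivatives up to order `k` are functions
of the state alone, and the input first appears at order `k + 1`. -/
theorem taylor_delay_bound_vec {k : ℕ} (hX : Continuous X)
    (hd : ∀ t, 0 ≤ t → HasDerivWithinAt X (g t) (Ici t) t)
    (hg : ∀ a, IsLocBdd fun s => g s a)
    (hCB : ∀ j, j < k → ∀ t, 0 ≤ t → (C * A ^ j) *ᵥ g t = (C * A ^ (j + 1)) *ᵥ X t)
    {η α T t : ℝ} (hη : 0 < η) (hα : 0 ≤ α) (hT : η ≤ T) (ht : T ≤ t)
    (G : Matrix (Fin m) (Fin l) ℝ) :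
    ((k + 1)! : ℝ) ^ 2 / η ^ (k + 1) * ∫ s in T..t, Real.exp (2 * α * (s - η)) *
        sqNorm (G *ᵥ outputRem A C (k + 1) η X s) ≤
      η ^ (k + 1) * ∫ s in (T - η)..t, Real.exp (2 * α * (s - 0)) *
          sqNorm (G *ᵥ ((C * A ^ k) *ᵥ g s)) := by
  have hg' := IsLocBdd.mulVec G (IsLocBdd.mulVec (C * A ^ k) hg)
  rw [integral_exp_sqNorm, integral_exp_sqNorm hg', Finset.mul_sum, Finset.mul_sum]
  · refine Finset.sum_le_sum fun a _ => ?_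
    -- The family switches from state to velocity at index `k + 1`: there `(C A^k) g` cannot be
    -- replaced by `(C A^(k+1)) X`.
    let F : ℕ → ℝ → ℝ := fun j s =>
      if j < k + 1 then (G *ᵥ ((C * A ^ j) *ᵥ X s)) a else (G *ᵥ ((C * A ^ k) *ᵥ g s)) a
    have hFk : F (k + 1) = fun s => (G *ᵥ ((C * A ^ k) *ᵥ g s)) a := by
      funext s; simp [F]
    have hFj : ∀ j, j < k + 1 → F j = fun s => (G *ᵥ ((C * A ^ j) *ᵥ X s)) a := fun j hj => by
      funext s; exact if_pos hj
    have key := taylor_delay_bound (F := F) (k := k) hη hα ?_ ?_ ?_ hT ht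
    · simp only [hFk] at key
      simp only [sub_zero]
      refine le_trans (le_of_eq ?_) key
      congr 1
      refine integral_congr fun s _ => ?_
      congr 2
      rw [taylorRem, outputRem, Matrix.mulVec_sub, Matrix.mulVec_sum, Pi.sub_apply,
        Finset.sum_apply, hFj 0 (by omega)]
      congr 1
      · simp
      · refine Finset.sum_congr rfl fun j hj => ?_
        rw [hFj j (Finset.mem_range.1 hj), Matrix.mulVec_smul, Pi.smul_apply, smul_eq_mul]
    · intro j hj
      rw [hFj j hj]
      exact (continuous_apply a).comp
        (continuous_const.matrix_mulVec (continuous_const.matrix_mulVec hX))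
    · intro j hj s hs
      have h1 := (hasDerivWithinAt_pi.1
        (hasDerivWithinAt_mulVec G (hasDerivWithinAt_mulVec (C * A ^ j) (hd s hs)))) a
      rw [hFj j hj]
      rcases Nat.lt_succ_iff_lt_or_eq.1 hj with hj' | rfl
      · rw [hFj (j + 1) (by omega)]
        rwa [hCB j hj' s hs] at h1
      · rw [hFk]
        exact h1
    · rw [hFk]
      exact hg' a
  · exact IsLocBdd.mulVec G fun a =>
      IsLocBdd.of_continuous ((continuous_apply a).comp (continuous_outputRem hX _ _))

/-- Comparison of an energy integral over a window with its delayed version. -/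
theorem integral_delay_sub_le {m : ℕ} {z : ℝ → Fin m → ℝ} (hz : ∀ a, IsLocBdd fun s => z s a)
    {α η T t b : ℝ} (hα : 0 ≤ α) (hη : 0 ≤ η) (hT : η ≤ T)
    (hb : ∀ s, 0 ≤ s → s ≤ T → sqNorm (z s) ≤ b) :
    (∫ s in (T - η)..t, Real.exp (2 * α * (s - 0)) * sqNorm (z s)) -
      (∫ s in T..t, Real.exp (2 * α * (s - 0)) * sqNorm (z s)) ≤
      T * (Real.exp (2 * α * T) * b) := by
  have hI := (IsLocBdd.sqNorm hz).exp_mul α 0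
  -- Only the integral over `[T - η, T]` remains, a window contained in `[0, T]`.
  rw [← integral_add_adjacent_intervals (hI.intervalIntegrable (T - η) T)
    (hI.intervalIntegrable T t), add_sub_cancel_right]
  have hT0 : 0 ≤ T := hη.trans hT
  calc _ ≤ ∫ s in (0 : ℝ)..T, Real.exp (2 * α * (s - 0)) * sqNorm (z s) :=
        integral_mono_of_isLocBdd hI (fun s => mul_nonneg (Real.exp_nonneg _) (sqNorm_nonneg _))
          (by linarith) (by linarith) le_rfl
    _ ≤ ∫ s in (0 : ℝ)..T, Real.exp (2 * α * T) * b := by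
        refine integral_mono_on hT0 (hI.intervalIntegrable _ _)
          (Continuous.intervalIntegrable (by fun_prop) _ _) fun s hs => ?_
        have h1 := hb s hs.1 hs.2
        have h2 := hs.2
        have h3 := sqNorm_nonneg (z s)
        rw [sub_zero]
        gcongr
    _ = _ := by rw [intervalIntegral.integral_const, sub_zero, smul_eq_mul]

end Signals

end VectorBounds

/-! ### The closed loop as a state feedback perturbed by sampling and Taylor errors. -/

section ClosedLoop

open Set MeasureTheory Filter Topology intervalIntegral

variable {n m l : ℕ}

theorem gainRow_mulVec (r : ℕ) (K : ℕ → Matrix (Fin m) (Fin l) ℝ) (z : Fin l × Fin r → ℝ) :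
    gainRow r K *ᵥ z = ∑ i : Fin r, K i *ᵥ fun b => z (b, i) := by
  funext a
  simp only [Matrix.mulVec, dotProduct, gainRow, Matrix.of_apply, Finset.sum_apply,
    Fintype.sum_prod_type]
  exact Finset.sum_comm

theorem vandermondeM_mulVec (r : ℕ) (h : ℝ) (q : ℕ → ℕ) (z : Fin l × Fin r → ℝ) (b : Fin l)
    (i : Fin r) : (vandermondeM l r h q *ᵥ z) (b, i) =
      ∑ j : Fin r, (-((q i : ℝ) * h)) ^ (j : ℕ) / ((j : ℕ)! : ℝ) * z (b, j) := by
  simp only [Matrix.mulVec, dotProduct, vandermondeM, Matrix.of_apply, Fintype.sum_prod_type]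
  rw [Finset.sum_eq_single b]
  · simp
  · intro c _ hc
    simp [Matrix.one_apply_ne hc.symm]
  · simp

/-- Block row `i` of `M`, applied to the column of output derivatives, is the Taylor polynomial
predicting the output at delay `q_i h`. -/
theorem feedback_mulVec (A : Matrix (Fin n) (Fin n) ℝ) (C : Matrix (Fin l) (Fin n) ℝ) (r : ℕ)
    (h : ℝ) (q : ℕ → ℕ) (K : ℕ → Matrix (Fin m) (Fin l) ℝ) (v : Fin n → ℝ) :
    (gainRow r K * vandermondeM l r h q * outputCol A C r) *ᵥ v =
      ∑ i ∈ Finset.range r, K i *ᵥ ∑ j ∈ Finset.range r,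
        ((-((q i : ℝ) * h)) ^ j / (j ! : ℝ)) • ((C * A ^ j) *ᵥ v) := by
  rw [← Matrix.mulVec_mulVec, ← Matrix.mulVec_mulVec, gainRow_mulVec,
    ← Fin.sum_univ_eq_sum_range (fun i => K i *ᵥ ∑ j ∈ Finset.range r,
        ((-((q i : ℝ) * h)) ^ j / (j ! : ℝ)) • ((C * A ^ j) *ᵥ v))]
  refine Finset.sum_congr rfl fun i _ => ?_
  congr 1
  funext b
  rw [vandermondeM_mulVec, Finset.sum_apply, ← Fin.sum_univ_eq_sum_range (fun j =>
    (((-((q i : ℝ) * h)) ^ j / (j ! : ℝ)) • ((C * A ^ j) *ᵥ v)) b)]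
  rfl

/-- A trajectory, extended to negative times by its initial value. -/
def extState (x : ℝ → Fin n → ℝ) (t : ℝ) : Fin n → ℝ := x (max 0 t)

theorem extState_of_nonneg (x : ℝ → Fin n → ℝ) {t : ℝ} (ht : 0 ≤ t) : extState x t = x t := by
  simp [extState, ht]

/-- The input that the delayed sampled-data controller generates. -/
def heldInput (C : Matrix (Fin l) (Fin n) ℝ) (r : ℕ) (h : ℝ) (q : ℕ → ℕ)
    (K : ℕ → Matrix (Fin m) (Fin l) ℝ) (x : ℝ → Fin n → ℝ) (t : ℝ) : Fin m → ℝ :=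
  ∑ i ∈ Finset.range r, K i *ᵥ output C x ((⌊t / h⌋₊ : ℝ) * h - (q i : ℝ) * h)

/-- The closed-loop velocity `A x + B u`. -/
def velocity (A : Matrix (Fin n) (Fin n) ℝ) (B : Matrix (Fin n) (Fin m) ℝ)
    (C : Matrix (Fin l) (Fin n) ℝ) (r : ℕ) (h : ℝ) (q : ℕ → ℕ)
    (K : ℕ → Matrix (Fin m) (Fin l) ℝ) (x : ℝ → Fin n → ℝ) (t : ℝ) : Fin n → ℝ :=
  A *ᵥ extState x t + B *ᵥ heldInput C r h q K x t

variable {A : Matrix (Fin n) (Fin n) ℝ} {B : Matrix (Fin n) (Fin m) ℝ}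
  {C : Matrix (Fin l) (Fin n) ℝ} {r : ℕ} {h : ℝ} {q : ℕ → ℕ}
  {K : ℕ → Matrix (Fin m) (Fin l) ℝ} {x : ℝ → Fin n → ℝ}

theorem IsSampledLoop.continuous_extState (hx : IsSampledLoop A B C r h q K x) :
    Continuous (extState x) := by
  obtain ⟨u, ⟨hc, _⟩, _⟩ := hx
  exact hc.comp_continuous (by fun_prop) fun t => le_max_left 0 t

theorem IsSampledLoop.hasDerivWithinAt_extState (hh : 0 < h) (hx : IsSampledLoop A B C r h q K x)
    {t : ℝ} (ht : 0 ≤ t) :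
    HasDerivWithinAt (extState x) (velocity A B C r h q K x t) (Ici t) t := by
  obtain ⟨u, ⟨_, hd⟩, hu⟩ := hx
  have hut : u t = heldInput C r h q K x t :=
    hu ⌊t / h⌋₊ t ⟨(le_div_iff₀ hh).1 (Nat.floor_le (div_nonneg ht hh.le)),
      (div_lt_iff₀ hh).1 (Nat.lt_floor_add_one _)⟩
  have := hd t ht
  rw [hut, ← extState_of_nonneg x ht] at this
  exact this.congr (fun s hs => extState_of_nonneg x (ht.trans hs)) (extState_of_nonneg x ht)

theorem isLocBdd_velocity (hh : 0 < h) (hx : Continuous (extState x)) (a : Fin n) :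
    IsLocBdd fun t => velocity A B C r h q K x t a := by
  refine (IsLocBdd.mulVec A (fun b => IsLocBdd.of_continuous
    ((continuous_apply b).comp hx)) a).add (IsLocBdd.mulVec B (fun b => ?_) a)
  exact IsLocBdd.step hh fun k => (∑ i ∈ Finset.range r, K i *ᵥ
    output C x ((k : ℝ) * h - (q i : ℝ) * h)) b

/-- Differentiating `C A^j x` brings in the input only through `C A^j B`, which vanishes. This makes
the low-order output derivatives functions of the state. -/
theorem mulVec_velocity {j : ℕ} (hCB : C * A ^ j * B = 0) (t : ℝ) :
    (C * A ^ j) *ᵥ velocity A B C r h q K x t = (C * A ^ (j + 1)) *ᵥ extState x t := by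
  rw [velocity, Matrix.mulVec_add, Matrix.mulVec_mulVec, Matrix.mulVec_mulVec, hCB,
    Matrix.zero_mulVec, add_zero, Matrix.mul_assoc, ← pow_succ]

/-- The error caused by sampling the `i`-th delayed measurement. -/
def samplingError (C : Matrix (Fin l) (Fin n) ℝ) (h : ℝ) (q : ℕ → ℕ)
    (K : ℕ → Matrix (Fin m) (Fin l) ℝ) (x : ℝ → Fin n → ℝ) (i : ℕ) (s : ℝ) : Fin m → ℝ :=
  K i *ᵥ (C *ᵥ extState x (⌊s / h⌋₊ * h - q i * h) - C *ᵥ extState x (s - q i * h))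

/-- The error caused by replacing the `i`-th delayed measurement by a Taylor polynomial. -/
def delayError (A : Matrix (Fin n) (Fin n) ℝ) (C : Matrix (Fin l) (Fin n) ℝ) (r : ℕ) (h : ℝ)
    (q : ℕ → ℕ) (K : ℕ → Matrix (Fin m) (Fin l) ℝ) (x : ℝ → Fin n → ℝ) (i : ℕ) (s : ℝ) :
    Fin m → ℝ :=
  K i *ᵥ outputRem A C r (q i * h) (extState x) s

/-- From time `N h` on, no measurement falls before time zero, so the convention `y = 0` there plays
no role. Adding and subtracting the unsampled delayed output splits each measurement into
polynomial, sampling error and remainder. -/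
theorem velocity_eq (hr : 1 ≤ r) (hh : 0 < h) (hq0 : q 0 = 0) {N : ℕ} (hqN : ∀ i < r, q i ≤ N)
    {s : ℝ} (hs : N * h ≤ s) :
    velocity A B C r h q K x s = matD A B C r h q K *ᵥ extState x s +
      B *ᵥ ∑ i ∈ Finset.range r, samplingError C h q K x i s +
      B *ᵥ ∑ i ∈ Finset.range (r - 1), delayError A C r h q K x (i + 1) s := by
  have hN : N ≤ ⌊s / h⌋₊ := Nat.le_floor ((le_div_iff₀ hh).2 hs)
  -- The undelayed measurement has no Taylor remainder, as `q 0 = 0`. The remainders are therefore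
  -- indexed from `1`.
  have h0 : delayError A C r h q K x 0 s = 0 := by
    obtain ⟨k, rfl⟩ : ∃ k, r = k + 1 := ⟨r - 1, by omega⟩
    rw [delayError, outputRem, Finset.sum_range_succ', Finset.sum_eq_zero] <;> simp [hq0]
  have h1 : ∑ i ∈ Finset.range (r - 1), delayError A C r h q K x (i + 1) s =
      ∑ i ∈ Finset.range r, delayError A C r h q K x i s := by
    obtain ⟨k, rfl⟩ : ∃ k, r = k + 1 := ⟨r - 1, by omega⟩
    rw [Finset.sum_range_succ', h0, add_zero, Nat.add_sub_cancel]
  rw [h1, velocity, matD, Matrix.add_mulVec, ← Matrix.mulVec_mulVec, feedback_mulVec, add_assoc,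
    add_assoc, ← Matrix.mulVec_add, ← Matrix.mulVec_add, ← Finset.sum_add_distrib,
    ← Finset.sum_add_distrib]
  congr 2
  refine Finset.sum_congr rfl fun i hi => ?_
  have hqi : (q i : ℝ) ≤ ⌊s / h⌋₊ := by
    exact_mod_cast (hqN i (Finset.mem_range.1 hi)).trans hN
  have hpos : (0 : ℝ) ≤ ⌊s / h⌋₊ * h - q i * h := by nlinarith
  rw [samplingError, delayError, outputRem, ← Matrix.mulVec_add, ← Matrix.mulVec_add, output,
    if_pos hpos, extState_of_nonneg x hpos]
  congr 1
  abel

theorem exists_sqNorm_mulVec_le {k : ℕ} (M : Matrix (Fin m) (Fin k) ℝ) :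
    ∃ b : ℝ, 0 ≤ b ∧ ∀ v, sqNorm (M *ᵥ v) ≤ b * ‖v‖ ^ 2 := by
  obtain ⟨a, ha0, ha⟩ := exists_mulVec_bound M
  refine ⟨m * a ^ 2, by positivity, fun v => (sqNorm_le_of_norm_le (ha v)).trans (le_of_eq ?_)⟩
  ring

/-- Controls the initial phase, in which the decomposition of the loop is not yet valid. -/
theorem exists_bound_state_velocity (A : Matrix (Fin n) (Fin n) ℝ) (B : Matrix (Fin n) (Fin m) ℝ)
    (C : Matrix (Fin l) (Fin n) ℝ) (r : ℕ) (hh : 0 < h) (q : ℕ → ℕ)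
    (K : ℕ → Matrix (Fin m) (Fin l) ℝ) (N : ℕ) :
    ∃ c : ℝ, 0 ≤ c ∧ ∀ x, IsSampledLoop A B C r h q K x → ∀ t, 0 ≤ t → t ≤ N * h →
      ‖extState x t‖ ≤ c * ‖x 0‖ ∧ ‖velocity A B C r h q K x t‖ ≤ c * ‖x 0‖ := by
  obtain ⟨c, hc0, hc⟩ := exists_bound_of_isSampledLoop A B C r hh q K N
  obtain ⟨a, ha0, ha⟩ := exists_mulVec_bound A
  obtain ⟨b, hb0, hb⟩ := exists_mulVec_bound B
  choose d hd0 hd using fun i => exists_mulVec_bound (K i * C)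
  have hS : 0 ≤ ∑ i ∈ Finset.range r, d i * c :=
    Finset.sum_nonneg fun i _ => mul_nonneg (hd0 i) hc0
  refine ⟨c + (a * c + b * ∑ i ∈ Finset.range r, d i * c), by positivity,
    fun x hx t h0 h1 => ?_⟩
  have hxt : ‖extState x t‖ ≤ c * ‖x 0‖ := by
    rw [extState_of_nonneg x h0]; exact hc x hx t h0 h1
  have hu : ‖heldInput C r h q K x t‖ ≤ (∑ i ∈ Finset.range r, d i * c) * ‖x 0‖ := by
    rw [heldInput, Finset.sum_mul]
    refine (norm_sum_le _ _).trans (Finset.sum_le_sum fun i _ => ?_)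
    unfold output
    split_ifs with h2
    · rw [Matrix.mulVec_mulVec, mul_assoc]
      refine (hd i _).trans (mul_le_mul_of_nonneg_left (hc x hx _ h2 ?_) (hd0 i))
      have h3 : (⌊t / h⌋₊ : ℝ) * h ≤ t :=
        (le_div_iff₀ hh).1 (Nat.floor_le (div_nonneg h0 hh.le))
      have h4 : (0 : ℝ) ≤ q i * h := by positivity
      linarith
    · rw [Matrix.mulVec_zero, norm_zero]
      exact mul_nonneg (mul_nonneg (hd0 i) hc0) (norm_nonneg _)
  have hv : ‖velocity A B C r h q K x t‖ ≤
      a * (c * ‖x 0‖) + b * ((∑ i ∈ Finset.range r, d i * c) * ‖x 0‖) := by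
    refine (norm_add_le _ _).trans (add_le_add ((ha _).trans ?_) ((hb _).trans ?_)) <;> gcongr
  have hx0 := norm_nonneg (x 0)
  have h5 : 0 ≤ (a * c + b * ∑ i ∈ Finset.range r, d i * c) * ‖x 0‖ := by positivity
  have h6 : 0 ≤ c * ‖x 0‖ := by positivity
  constructor <;> linarith

end ClosedLoop

/-! ### From the dissipation inequality to exponential decay. -/

section LyapunovArgument

open Set MeasureTheory Filter Topology intervalIntegral

variable {n m l : ℕ}

theorem integral_sum_sub {ι : Type*} (s : Finset ι) {f g : ι → ℝ → ℝ} (c d : ι → ℝ)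
    (hf : ∀ i ∈ s, IsLocBdd (f i)) (hg : ∀ i ∈ s, IsLocBdd (g i)) (a b : ℝ) :
    ∫ t in a..b, ∑ i ∈ s, (c i * f i t - d i * g i t) =
      ∑ i ∈ s, (c i * (∫ t in a..b, f i t) - d i * ∫ t in a..b, g i t) := by
  rw [intervalIntegral.integral_finsetSum fun i hi =>
    (((hf i hi).const_mul _).sub ((hg i hi).const_mul _)).intervalIntegrable _ _]
  refine Finset.sum_congr rfl fun i hi => ?_
  rw [intervalIntegral.integral_sub (((hf i hi).const_mul _).intervalIntegrable _ _)
    (((hg i hi).const_mul _).intervalIntegrable _ _), intervalIntegral.integral_const_mul,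
    intervalIntegral.integral_const_mul]

theorem hasDerivWithinAt_exp_mul_sqNorm {k : ℕ} {z : ℝ → Fin k → ℝ} {z' : Fin k → ℝ} {α t : ℝ}
    {S : Set ℝ} (hz : HasDerivWithinAt z z' S t) :
    HasDerivWithinAt (fun s => Real.exp (2 * α * s) * sqNorm (z s))
      (Real.exp (2 * α * t) * (2 * (z t ⬝ᵥ z') + 2 * α * sqNorm (z t))) S t := by
  have h1 : HasDerivWithinAt (fun s => sqNorm (z s)) (2 * (z t ⬝ᵥ z')) S t := by
    simp only [sqNorm_eq_sum]
    refine (HasDerivWithinAt.fun_sum (u := Finset.univ) fun a _ =>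
      ((hasDerivWithinAt_pi.1 hz) a).pow 2).congr_deriv ?_
    simp only [dotProduct, Finset.mul_sum]
    refine Finset.sum_congr rfl fun a _ => ?_
    simp; ring
  have h2 : HasDerivAt (fun s => Real.exp (2 * α * s)) (Real.exp (2 * α * t) * (2 * α)) t := by
    have : HasDerivAt (fun s => 2 * α * s) (2 * α) t := by
      simpa using (hasDerivAt_id t).const_mul (2 * α)
    exact this.exp
  refine (h2.hasDerivWithinAt.mul h1).congr_deriv ?_
  ring

variable {A : Matrix (Fin n) (Fin n) ℝ} {B : Matrix (Fin n) (Fin m) ℝ}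
  {C : Matrix (Fin l) (Fin n) ℝ} {r : ℕ} {h : ℝ} {q : ℕ → ℕ}
  {K : ℕ → Matrix (Fin m) (Fin l) ℝ}

/-- The dissipation inequality behind the Lyapunov argument, in terms of square roots `S`, `Sw i`,
`Sr i` of the weights. -/
def Dissipation (A : Matrix (Fin n) (Fin n) ℝ) (B : Matrix (Fin n) (Fin m) ℝ)
    (C : Matrix (Fin l) (Fin n) ℝ) (r : ℕ) (h : ℝ) (q : ℕ → ℕ)
    (K : ℕ → Matrix (Fin m) (Fin l) ℝ) (α : ℝ) (S : Matrix (Fin n) (Fin n) ℝ)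
    (Sw Sr : ℕ → Matrix (Fin m) (Fin m) ℝ) : Prop :=
  ∀ (v y : Fin n → ℝ) (d e : ℕ → Fin m → ℝ),
    y = matD A B C r h q K *ᵥ v + B *ᵥ ∑ i ∈ Finset.range r, d i +
      B *ᵥ ∑ i ∈ Finset.range (r - 1), e (i + 1) →
    2 * (S *ᵥ v ⬝ᵥ S *ᵥ y) + 2 * α * sqNorm (S *ᵥ v) +
      ∑ i ∈ Finset.range r, h ^ 2 * Real.exp (2 * α * h) *
        sqNorm (Sw i *ᵥ (K i *ᵥ ((C * A) *ᵥ v))) +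
      ∑ i ∈ Finset.range (r - 1), (q (i + 1) * h) ^ r *
        sqNorm (Sr (i + 1) *ᵥ (K (i + 1) *ᵥ ((C * A ^ (r - 1)) *ᵥ y))) ≤
    ∑ i ∈ Finset.range r, Real.pi ^ 2 / 4 * Real.exp (-2 * α * (q i * h)) *
        sqNorm (Sw i *ᵥ d i) +
      ∑ i ∈ Finset.range (r - 1), (r ! : ℝ) ^ 2 / (q (i + 1) * h) ^ r *
        Real.exp (-2 * α * (q (i + 1) * h)) * sqNorm (Sr (i + 1) *ᵥ e (i + 1))

/-- Integrate the dissipation inequality from `T = N h`. The sampling and Taylor bounds dominate the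
integrated errors by the same energies that the inequality subtracts, but over windows starting one
delay earlier. The excess lies in `[0, T]` and is bounded by the initial state. -/
theorem exists_energy_bound (hr : 2 ≤ r) (hCB : ∀ i, i + 2 ≤ r → C * A ^ i * B = 0) (hh : 0 < h)
    (hq0 : q 0 = 0) {N : ℕ} (hqN : ∀ i < r, q i ≤ N) (hqpos : ∀ i < r - 1, 0 < q (i + 1))
    {α : ℝ} (hα : 0 ≤ α) {S : Matrix (Fin n) (Fin n) ℝ} {Sw Sr : ℕ → Matrix (Fin m) (Fin m) ℝ}
    (hdis : Dissipation A B C r h q K α S Sw Sr) :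
    ∃ c : ℝ, ∀ x, IsSampledLoop A B C r h q K x → ∀ t, N * h ≤ t →
      Real.exp (2 * α * t) * sqNorm (S *ᵥ x t) ≤ c * ‖x 0‖ ^ 2 := by
  obtain ⟨c, hc0, hc⟩ := exists_bound_state_velocity A B C r hh q K N
  obtain ⟨bS, hbS0, hbS⟩ := exists_sqNorm_mulVec_le S
  choose bw hbw0 hbw using fun i => exists_sqNorm_mulVec_le (Sw i * K i * (C * A))
  choose br hbr0 hbr using fun i => exists_sqNorm_mulVec_le (Sr i * K i * (C * A ^ (r - 1)))
  set T : ℝ := N * h with hT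
  have hT0 : 0 ≤ T := by positivity
  set cw := h ^ 2 * Real.exp (2 * α * h)
  have hcw : 0 ≤ cw := by positivity
  refine ⟨Real.exp (2 * α * T) * (bS * c ^ 2) +
    (∑ i ∈ Finset.range r, cw * (T * (Real.exp (2 * α * T) * (bw i * c ^ 2))) +
      ∑ i ∈ Finset.range (r - 1), (q (i + 1) * h) ^ r *
        (T * (Real.exp (2 * α * T) * (br (i + 1) * c ^ 2)))), fun x hx t ht => ?_⟩
  have hX := hx.continuous_extState
  have hd := fun s hs => hx.hasDerivWithinAt_extState (t := s) hh hs
  have hg := isLocBdd_velocity (A := A) (B := B) (C := C) (r := r) (q := q) (K := K) hh hX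
  have hqi : ∀ i < r, (q i : ℝ) * h ≤ T := fun i hi => by
    rw [hT]
    have : (q i : ℝ) ≤ N := by exact_mod_cast hqN i hi
    gcongr
  have hXb := fun s hs0 hs => (hc x hx s hs0 hs).1
  have hgb := fun s hs0 hs => (hc x hx s hs0 hs).2
  set X := extState x
  set g := velocity A B C r h q K x
  -- the four families of energy densities
  set f₁ : ℕ → ℝ → ℝ := fun i s => Real.exp (2 * α * (s - q i * h)) *
    sqNorm ((Sw i * K i) *ᵥ (C *ᵥ X (⌊s / h⌋₊ * h - q i * h) - C *ᵥ X (s - q i * h)))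
  set f₂ : ℕ → ℝ → ℝ := fun i s => Real.exp (2 * α * (s - 0)) *
    sqNorm ((Sw i * K i) *ᵥ ((C * A) *ᵥ X s))
  set f₃ : ℕ → ℝ → ℝ := fun i s => Real.exp (2 * α * (s - q (i + 1) * h)) *
    sqNorm ((Sr (i + 1) * K (i + 1)) *ᵥ outputRem A C r (q (i + 1) * h) X s)
  set f₄ : ℕ → ℝ → ℝ := fun i s => Real.exp (2 * α * (s - 0)) *
    sqNorm ((Sr (i + 1) * K (i + 1)) *ᵥ ((C * A ^ (r - 1)) *ᵥ g s))
  have hXl : ∀ a, IsLocBdd fun s => X s a := fun a =>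
    IsLocBdd.of_continuous ((continuous_apply a).comp hX)
  have hf₁ : ∀ i, IsLocBdd (f₁ i) := fun i => by
    refine IsLocBdd.exp_mul (IsLocBdd.sqNorm (IsLocBdd.mulVec _ fun a => ?_)) α _
    exact (IsLocBdd.step hh fun k => (C *ᵥ X (k * h - q i * h)) a).sub
      ((IsLocBdd.mulVec C hXl a).comp_sub _)
  have hf₂ : ∀ i, IsLocBdd (f₂ i) := fun i =>
    IsLocBdd.exp_mul (IsLocBdd.sqNorm (IsLocBdd.mulVec _ (IsLocBdd.mulVec _ hXl))) α _
  have hf₃ : ∀ i, IsLocBdd (f₃ i) := fun i => by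
    refine IsLocBdd.exp_mul (IsLocBdd.sqNorm (IsLocBdd.mulVec _ fun a => ?_)) α _
    exact IsLocBdd.of_continuous ((continuous_apply a).comp (continuous_outputRem hX _ _))
  have hf₄ : ∀ i, IsLocBdd (f₄ i) := fun i =>
    IsLocBdd.exp_mul (IsLocBdd.sqNorm (IsLocBdd.mulVec _ (IsLocBdd.mulVec _ hg))) α _
  set w₃ : ℕ → ℝ := fun i => (r ! : ℝ) ^ 2 / (q (i + 1) * h) ^ r
  set w₄ : ℕ → ℝ := fun i => (q (i + 1) * h) ^ r
  have hw₄ : ∀ i, 0 ≤ w₄ i := fun i => by positivity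
  have hsum₁ : IsLocBdd fun s => ∑ i ∈ Finset.range r,
      (Real.pi ^ 2 / 4 * f₁ i s - cw * f₂ i s) :=
    IsLocBdd.sum _ fun i _ => ((hf₁ i).const_mul _).sub ((hf₂ i).const_mul _)
  have hsum₂ : IsLocBdd fun s => ∑ i ∈ Finset.range (r - 1), (w₃ i * f₃ i s - w₄ i * f₄ i s) :=
    IsLocBdd.sum _ fun i _ => ((hf₃ i).const_mul _).sub ((hf₄ i).const_mul _)
  have hSX : ∀ s, 0 ≤ s → HasDerivWithinAt (fun s => S *ᵥ X s) (S *ᵥ g s) (Ici s) s :=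
    fun s hs => hasDerivWithinAt_mulVec S (hd s hs)
  have hcont : Continuous fun s => Real.exp (2 * α * s) * sqNorm (S *ᵥ X s) := by
    have h1 : Continuous fun s => S *ᵥ X s := continuous_const.matrix_mulVec hX
    simp only [sqNorm_eq_sum]
    fun_prop
  have hφ : IntegrableOn (fun s => (∑ i ∈ Finset.range r,
      (Real.pi ^ 2 / 4 * f₁ i s - cw * f₂ i s)) +
      ∑ i ∈ Finset.range (r - 1), (w₃ i * f₃ i s - w₄ i * f₄ i s)) (Icc T t) := by
    rw [integrableOn_Icc_iff_integrableOn_Ioc, ← intervalIntegrable_iff_integrableOn_Ioc_of_le ht]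
    exact (hsum₁.add hsum₂).intervalIntegrable T t
  have key := sub_le_integral_of_hasDeriv_right_of_le ht hcont.continuousOn
    (fun s hs => (hasDerivWithinAt_exp_mul_sqNorm (α := α)
      (hSX s (hT0.trans hs.1.le))).mono Ioi_subset_Ici_self) hφ
    (fun s hs => by
      have h1 := hdis (X s) (g s) (fun i => samplingError C h q K x i s)
        (fun i => delayError A C r h q K x i s) (velocity_eq (by omega) hh hq0 hqN hs.1.le)
      have h2 := mul_le_mul_of_nonneg_left h1 (Real.exp_nonneg (2 * α * s))
      have e1 : ∀ η, Real.exp (2 * α * (s - η)) =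
          Real.exp (2 * α * s) * Real.exp (-2 * α * η) := fun η => by
        rw [← Real.exp_add]; congr 1; ring
      have e2 : Real.exp (2 * α * (s - 0)) = Real.exp (2 * α * s) := by rw [sub_zero]
      have e3 : ∑ i ∈ Finset.range r, (Real.pi ^ 2 / 4 * f₁ i s - cw * f₂ i s) =
          Real.exp (2 * α * s) * (∑ i ∈ Finset.range r, Real.pi ^ 2 / 4 *
            Real.exp (-2 * α * (q i * h)) * sqNorm (Sw i *ᵥ samplingError C h q K x i s)) -
          Real.exp (2 * α * s) * ∑ i ∈ Finset.range r, h ^ 2 * Real.exp (2 * α * h) *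
            sqNorm (Sw i *ᵥ (K i *ᵥ ((C * A) *ᵥ X s))) := by
        rw [Finset.mul_sum, Finset.mul_sum, ← Finset.sum_sub_distrib]
        refine Finset.sum_congr rfl fun i _ => ?_
        have a1 : f₁ i s = Real.exp (2 * α * s) * Real.exp (-2 * α * (q i * h)) *
            sqNorm (Sw i *ᵥ samplingError C h q K x i s) := by
          simp only [f₁]
          rw [e1, samplingError, Matrix.mulVec_mulVec]
        have a2 : f₂ i s = Real.exp (2 * α * s) *
            sqNorm (Sw i *ᵥ (K i *ᵥ ((C * A) *ᵥ X s))) := by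
          simp only [f₂]
          rw [e2, ← Matrix.mulVec_mulVec _ (Sw i)]
        rw [a1, a2]
        ring
      have e4 : ∑ i ∈ Finset.range (r - 1), (w₃ i * f₃ i s - w₄ i * f₄ i s) =
          Real.exp (2 * α * s) * (∑ i ∈ Finset.range (r - 1), (r ! : ℝ) ^ 2 /
            (q (i + 1) * h) ^ r * Real.exp (-2 * α * (q (i + 1) * h)) *
            sqNorm (Sr (i + 1) *ᵥ delayError A C r h q K x (i + 1) s)) -
          Real.exp (2 * α * s) * ∑ i ∈ Finset.range (r - 1), (q (i + 1) * h) ^ r *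
            sqNorm (Sr (i + 1) *ᵥ (K (i + 1) *ᵥ ((C * A ^ (r - 1)) *ᵥ g s))) := by
        rw [Finset.mul_sum, Finset.mul_sum, ← Finset.sum_sub_distrib]
        refine Finset.sum_congr rfl fun i _ => ?_
        have a1 : f₃ i s = Real.exp (2 * α * s) * Real.exp (-2 * α * (q (i + 1) * h)) *
            sqNorm (Sr (i + 1) *ᵥ delayError A C r h q K x (i + 1) s) := by
          simp only [f₃]
          rw [e1, delayError, Matrix.mulVec_mulVec]
        have a2 : f₄ i s = Real.exp (2 * α * s) *
            sqNorm (Sr (i + 1) *ᵥ (K (i + 1) *ᵥ ((C * A ^ (r - 1)) *ᵥ g s))) := by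
          simp only [f₄]
          rw [e2, ← Matrix.mulVec_mulVec _ (Sr (i + 1))]
        rw [a1, a2]
        ring
      simp only [e3, e4]
      linarith)
  -- The integrals over `[T, t]` cancel, leaving a bound independent of `t`.
  have hb₁ : ∀ i ∈ Finset.range r, Real.pi ^ 2 / 4 * (∫ s in T..t, f₁ i s) -
      cw * (∫ s in T..t, f₂ i s) ≤
      cw * (T * (Real.exp (2 * α * T) * (bw i * (c * ‖x 0‖) ^ 2))) := fun i hi => by
    have hi := Finset.mem_range.1 hi
    have h1 := sampled_delay_bound_vec hX hd
      (fun s _ => by simpa using mulVec_velocity (hCB 0 hr) s) hh hα (hqN i hi) ht (Sw i * K i)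
    have h2 := integral_delay_sub_le (t := t)
      (IsLocBdd.mulVec (Sw i * K i) (IsLocBdd.mulVec (C * A) hXl)) hα
      (show (0 : ℝ) ≤ q i * h by positivity) (hqi i hi) (b := bw i * (c * ‖x 0‖) ^ 2)
      fun s h0 hs => by
        rw [Matrix.mulVec_mulVec]
        refine (hbw i _).trans ?_
        have := hXb s h0 hs
        have := hbw0 i
        gcongr
    have h3 := mul_le_mul_of_nonneg_left h2 hcw
    rw [mul_sub] at h3
    linarith
  have hb₂ : ∀ i ∈ Finset.range (r - 1), w₃ i * (∫ s in T..t, f₃ i s) -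
      w₄ i * (∫ s in T..t, f₄ i s) ≤
      w₄ i * (T * (Real.exp (2 * α * T) * (br (i + 1) * (c * ‖x 0‖) ^ 2))) := fun i hi => by
    have hi := Finset.mem_range.1 hi
    have hη : (0 : ℝ) < q (i + 1) * h := by
      have := hqpos i hi
      positivity
    obtain ⟨k, rfl⟩ : ∃ k, r = k + 1 := ⟨r - 1, by omega⟩
    have h1 := taylor_delay_bound_vec (k := k) (A := A) (C := C) hX hd hg
      (fun j hj s _ => mulVec_velocity (hCB j (by omega)) s) hη hα (hqi (i + 1) (by omega)) ht
      (Sr (i + 1) * K (i + 1))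
    have h2 := integral_delay_sub_le (t := t)
      (IsLocBdd.mulVec (Sr (i + 1) * K (i + 1)) (IsLocBdd.mulVec (C * A ^ k) hg)) hα
      hη.le (hqi (i + 1) (by omega)) (b := br (i + 1) * (c * ‖x 0‖) ^ 2)
      fun s h0 hs => by
        rw [Matrix.mulVec_mulVec]
        refine (hbr (i + 1) _).trans ?_
        have := hgb s h0 hs
        have := hbr0 (i + 1)
        gcongr
    have h3 := mul_le_mul_of_nonneg_left h2 (hw₄ i)
    rw [mul_sub] at h3
    simp only [w₃, w₄, f₃, f₄, Nat.add_sub_cancel] at h3 ⊢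
    linarith
  have hV : sqNorm (S *ᵥ X T) ≤ bS * (c * ‖x 0‖) ^ 2 := by
    refine (hbS _).trans ?_
    have := hXb T hT0 le_rfl
    gcongr
  have hV' := mul_le_mul_of_nonneg_left hV (Real.exp_nonneg (2 * α * T))
  rw [intervalIntegral.integral_add (hsum₁.intervalIntegrable _ _) (hsum₂.intervalIntegrable _ _),
    integral_sum_sub _ (fun _ => Real.pi ^ 2 / 4) (fun _ => cw) (fun i _ => hf₁ i)
      (fun i _ => hf₂ i),
    integral_sum_sub _ w₃ w₄ (fun i _ => hf₃ i) (fun i _ => hf₄ i)] at key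
  have hs₁ := Finset.sum_le_sum hb₁
  have hs₂ := Finset.sum_le_sum hb₂
  rw [← extState_of_nonneg x (hT0.trans ht)]
  have e₁ : ∑ i ∈ Finset.range r, cw * (T * (Real.exp (2 * α * T) * (bw i * (c * ‖x 0‖) ^ 2))) =
      (∑ i ∈ Finset.range r, cw * (T * (Real.exp (2 * α * T) * (bw i * c ^ 2)))) * ‖x 0‖ ^ 2 := by
    rw [Finset.sum_mul]
    exact Finset.sum_congr rfl fun i _ => by ring
  have e₂ : ∑ i ∈ Finset.range (r - 1), w₄ i * (T * (Real.exp (2 * α * T) *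
        (br (i + 1) * (c * ‖x 0‖) ^ 2))) =
      (∑ i ∈ Finset.range (r - 1), w₄ i * (T * (Real.exp (2 * α * T) *
        (br (i + 1) * c ^ 2)))) * ‖x 0‖ ^ 2 := by
    rw [Finset.sum_mul]
    exact Finset.sum_congr rfl fun i _ => by ring
  rw [add_mul, add_mul, ← e₁, ← e₂, mul_assoc (Real.exp (2 * α * T)), mul_assoc bS, ← mul_pow]
  linarith

/-- Exponential stability of the sampled-data loop from the dissipation inequality. -/
theorem isExpStable_of_dissipation (hr : 2 ≤ r) (hCB : ∀ i, i + 2 ≤ r → C * A ^ i * B = 0)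
    (hh : 0 < h) (hq0 : q 0 = 0) (hq : ∀ i, i + 1 < r → q i < q (i + 1))
    {α : ℝ} (hα : 0 ≤ α) {S : Matrix (Fin n) (Fin n) ℝ} {ν : ℝ}
    (hS : ∀ v, sqNorm v ≤ ν * sqNorm (S *ᵥ v)) {Sw Sr : ℕ → Matrix (Fin m) (Fin m) ℝ}
    (hdis : Dissipation A B C r h q K α S Sw Sr) :
    IsExpStable (IsSampledLoop A B C r h q K) α := by
  refine ⟨exists_isSampledLoop A B C r hh q K, ?_⟩
  have hmono : ∀ j, ∀ i, i ≤ j → j < r → q i ≤ q j := fun j => by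
    induction j with
    | zero => intro i hi _; rw [Nat.le_zero.1 hi]
    | succ j ih =>
      intro i hi hj
      rcases Nat.le_succ_iff.1 hi with hi | rfl
      · exact (ih i hi (by omega)).trans (hq j hj).le
      · exact le_rfl
  obtain ⟨c, hc⟩ := exists_energy_bound hr hCB hh hq0 (N := q (r - 1))
    (fun i hi => hmono (r - 1) i (by omega) (by omega))
    (fun i hi => (Nat.zero_le _).trans_lt (hq i (by omega))) hα hdis
  obtain ⟨c₁, hc₁0, hc₁⟩ := exists_bound_of_isSampledLoop A B C r hh q K (q (r - 1))
  set T : ℝ := q (r - 1) * h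
  -- The first summand covers times after `T`, by the energy bound. The second covers `[0, T]`, with
  -- `e^(2αT)` compensating the decay demanded there.
  set M := max |ν| 0 * max c 0 + n * c₁ ^ 2 * Real.exp (2 * |α| * T) with hM
  have hM1 : 0 ≤ max |ν| 0 * max c 0 := by positivity
  have hM2 : 0 ≤ n * c₁ ^ 2 * Real.exp (2 * |α| * T) := by positivity
  refine ⟨√M, fun x hx t ht => ?_⟩
  suffices h1 : sqNorm (x t) ≤ M * Real.exp (-2 * α * t) * ‖x 0‖ ^ 2 by
    refine (sq_le_sq₀ (norm_nonneg _) (by positivity)).1 ?_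
    rw [norm_toLp_sq, mul_pow, mul_pow, Real.sq_sqrt (by positivity), norm_toLp_sq,
      ← Real.exp_nat_mul]
    have e : ((2 : ℕ) : ℝ) * (-α * t) = -2 * α * t := by push_cast; ring
    rw [e]
    refine h1.trans ?_
    have := norm_sq_le_sqNorm (x 0)
    gcongr
  have hexp : Real.exp (-2 * α * t) * Real.exp (2 * α * t) = 1 := by
    rw [← Real.exp_add, ← Real.exp_zero]; congr 1; ring
  have hN0 : 0 ≤ ‖x 0‖ ^ 2 := by positivity
  rcases le_total T t with h1 | h1
  · have h2 := hc x hx t h1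
    have h3 : sqNorm (x t) ≤ max |ν| 0 * sqNorm (S *ᵥ x t) :=
      (hS _).trans (mul_le_mul_of_nonneg_right ((le_abs_self ν).trans (le_max_left _ _))
        (sqNorm_nonneg _))
    have h4 : sqNorm (S *ᵥ x t) ≤ Real.exp (-2 * α * t) * (max c 0 * ‖x 0‖ ^ 2) := by
      calc sqNorm (S *ᵥ x t) = Real.exp (-2 * α * t) *
            (Real.exp (2 * α * t) * sqNorm (S *ᵥ x t)) := by rw [← mul_assoc, hexp, one_mul]
        _ ≤ Real.exp (-2 * α * t) * (max c 0 * ‖x 0‖ ^ 2) := by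
          exact mul_le_mul_of_nonneg_left
            (h2.trans (mul_le_mul_of_nonneg_right (le_max_left _ _) hN0)) (Real.exp_nonneg _)
    calc sqNorm (x t) ≤ max |ν| 0 * (Real.exp (-2 * α * t) * (max c 0 * ‖x 0‖ ^ 2)) := by
          refine h3.trans ?_
          gcongr
      _ = max |ν| 0 * max c 0 * Real.exp (-2 * α * t) * ‖x 0‖ ^ 2 := by ring
      _ ≤ _ := by
        gcongr
        linarith
  · have h2 := sqNorm_le_of_norm_le (hc₁ x hx t ht h1)
    have h3 : 1 ≤ Real.exp (2 * |α| * T) * Real.exp (-2 * α * t) := by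
      rw [← Real.exp_add]
      refine Real.one_le_exp ?_
      rw [abs_of_nonneg hα]
      nlinarith
    calc sqNorm (x t) ≤ n * c₁ ^ 2 * ‖x 0‖ ^ 2 * 1 := by rw [mul_pow] at h2; linarith
      _ ≤ n * c₁ ^ 2 * ‖x 0‖ ^ 2 * (Real.exp (2 * |α| * T) * Real.exp (-2 * α * t)) := by gcongr
      _ = n * c₁ ^ 2 * Real.exp (2 * |α| * T) * Real.exp (-2 * α * t) * ‖x 0‖ ^ 2 := by ring
      _ ≤ _ := by
        gcongr
        linarith

end LyapunovArgument

/-! ### The matrix inequality as a dissipation inequality. -/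

section MatrixInequality

open Set Filter Topology

variable {n m l : ℕ}

theorem exists_sqrt_form {k : ℕ} {W : Matrix (Fin k) (Fin k) ℝ} (hW : W.PosSemidef) :
    ∃ S : Matrix (Fin k) (Fin k) ℝ, W = Sᵀ * S ∧ ∀ v y, S *ᵥ v ⬝ᵥ S *ᵥ y = v ⬝ᵥ W *ᵥ y := by
  open scoped MatrixOrder in
  obtain ⟨S, hS⟩ := CStarAlgebra.nonneg_iff_eq_star_mul_self.mp hW.nonneg
  have hS' : W = Sᵀ * S := by
    rw [hS, Matrix.star_eq_conjTranspose, Matrix.conjTranspose_eq_transpose_of_trivial]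
  refine ⟨S, hS', fun v y => ?_⟩
  rw [hS', ← Matrix.mulVec_mulVec, Matrix.dotProduct_mulVec v, Matrix.vecMul_transpose]

/-- From `P = Sᵀ S`, the matrix `P⁻¹ Sᵀ` is a left inverse of `S`, so `S v` controls `v`. -/
theorem exists_sqrt_form_of_posDef {P : Matrix (Fin n) (Fin n) ℝ} (hP : P.PosDef) :
    ∃ S : Matrix (Fin n) (Fin n) ℝ, (∀ v y, S *ᵥ v ⬝ᵥ S *ᵥ y = v ⬝ᵥ P *ᵥ y) ∧
      ∃ ν : ℝ, ∀ v, sqNorm v ≤ ν * sqNorm (S *ᵥ v) := by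
  obtain ⟨S, hS, hS'⟩ := exists_sqrt_form hP.posSemidef
  obtain ⟨b, hb0, hb⟩ := exists_sqNorm_mulVec_le (P⁻¹ * Sᵀ)
  refine ⟨S, hS', b, fun v => ?_⟩
  have h1 : (P⁻¹ * Sᵀ) *ᵥ (S *ᵥ v) = v := by
    rw [Matrix.mulVec_mulVec, Matrix.mul_assoc, ← hS,
      Matrix.nonsing_inv_mul _ ((Matrix.isUnit_iff_isUnit_det _).1 hP.isUnit), Matrix.one_mulVec]
  have h2 := hb (S *ᵥ v)
  rw [h1] at h2
  exact h2.trans (mul_le_mul_of_nonneg_left (norm_sq_le_sqNorm _) hb0)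

variable {A : Matrix (Fin n) (Fin n) ℝ} {B : Matrix (Fin n) (Fin m) ℝ}
  {C : Matrix (Fin l) (Fin n) ℝ} {r : ℕ} {h : ℝ} {q : ℕ → ℕ}
  {K : ℕ → Matrix (Fin m) (Fin l) ℝ}

/-- Exponential stability from a dissipation inequality with quadratic forms `P`, `W i`, `R i`. -/
theorem isExpStable_of_quadraticForms (hr : 2 ≤ r) (hCB : ∀ i, i + 2 ≤ r → C * A ^ i * B = 0)
    (hh : 0 < h) (hq0 : q 0 = 0) (hq : ∀ i, i + 1 < r → q i < q (i + 1))
    {α : ℝ} (hα : 0 ≤ α) {P : Matrix (Fin n) (Fin n) ℝ} {W R : ℕ → Matrix (Fin m) (Fin m) ℝ}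
    (hP : P.PosDef) (hW : ∀ i < r, (W i).PosSemidef) (hR : ∀ i, 1 ≤ i → i < r → (R i).PosSemidef)
    (hdis : ∀ (v y : Fin n → ℝ) (d e : ℕ → Fin m → ℝ),
      y = matD A B C r h q K *ᵥ v + B *ᵥ ∑ i ∈ Finset.range r, d i +
        B *ᵥ ∑ i ∈ Finset.range (r - 1), e (i + 1) →
      2 * (v ⬝ᵥ P *ᵥ y) + 2 * α * (v ⬝ᵥ P *ᵥ v) +
        ∑ i ∈ Finset.range r, h ^ 2 * Real.exp (2 * α * h) *
          (K i *ᵥ ((C * A) *ᵥ v) ⬝ᵥ W i *ᵥ (K i *ᵥ ((C * A) *ᵥ v))) +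
        ∑ i ∈ Finset.range (r - 1), (q (i + 1) * h) ^ r *
          (K (i + 1) *ᵥ ((C * A ^ (r - 1)) *ᵥ y) ⬝ᵥ
            R (i + 1) *ᵥ (K (i + 1) *ᵥ ((C * A ^ (r - 1)) *ᵥ y))) ≤
      ∑ i ∈ Finset.range r, Real.pi ^ 2 / 4 * Real.exp (-2 * α * (q i * h)) *
          (d i ⬝ᵥ W i *ᵥ d i) +
        ∑ i ∈ Finset.range (r - 1), (r ! : ℝ) ^ 2 / (q (i + 1) * h) ^ r *
          Real.exp (-2 * α * (q (i + 1) * h)) * (e (i + 1) ⬝ᵥ R (i + 1) *ᵥ e (i + 1))) :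
    IsExpStable (IsSampledLoop A B C r h q K) α := by
  obtain ⟨S, hS, ν, hν⟩ := exists_sqrt_form_of_posDef hP
  have hW' : ∀ i, ∃ S : Matrix (Fin m) (Fin m) ℝ, i < r →
      ∀ v, sqNorm (S *ᵥ v) = v ⬝ᵥ W i *ᵥ v := fun i => by
    by_cases hi : i < r
    · obtain ⟨S, _, hS⟩ := exists_sqrt_form (hW i hi)
      exact ⟨S, fun _ v => hS v v⟩
    · exact ⟨0, fun h => absurd h hi⟩
  have hR' : ∀ i, ∃ S : Matrix (Fin m) (Fin m) ℝ, 1 ≤ i → i < r →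
      ∀ v, sqNorm (S *ᵥ v) = v ⬝ᵥ R i *ᵥ v := fun i => by
    by_cases hi : 1 ≤ i ∧ i < r
    · obtain ⟨S, _, hS⟩ := exists_sqrt_form (hR i hi.1 hi.2)
      exact ⟨S, fun _ _ v => hS v v⟩
    · exact ⟨0, fun h1 h2 => absurd ⟨h1, h2⟩ hi⟩
  choose Sw hSw using hW'
  choose Sr hSr using hR'
  refine isExpStable_of_dissipation (Sw := Sw) (Sr := Sr) hr hCB hh hq0 hq hα hν
    fun v y d e hy => ?_
  have h1 : ∀ i ∈ Finset.range r, ∀ v, sqNorm (Sw i *ᵥ v) = v ⬝ᵥ W i *ᵥ v :=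
    fun i hi => hSw i (Finset.mem_range.1 hi)
  have h2 : ∀ i ∈ Finset.range (r - 1), ∀ v,
      sqNorm (Sr (i + 1) *ᵥ v) = v ⬝ᵥ R (i + 1) *ᵥ v :=
    fun i hi => hSr (i + 1) (by omega) (by have := Finset.mem_range.1 hi; omega)
  refine le_trans (le_of_eq ?_) ((hdis v y d e hy).trans (le_of_eq ?_))
  · rw [hS, sqNorm, hS]
    congr 1
    · congr 1
      exact Finset.sum_congr rfl fun i hi => by rw [h1 i hi]
    · exact Finset.sum_congr rfl fun i hi => by rw [h2 i hi]
  · congr 1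
    · exact Finset.sum_congr rfl fun i hi => by rw [h1 i hi]
    · exact Finset.sum_congr rfl fun i hi => by rw [h2 i hi]

/-! Evaluation of the block matrix `Phi` as a quadratic form. -/

theorem dotProduct_transpose_mulVec {ι κ : Type*} [Fintype ι] [Fintype κ] (M : Matrix ι κ ℝ)
    (v : κ → ℝ) (w : ι → ℝ) : v ⬝ᵥ Mᵀ *ᵥ w = (M *ᵥ v) ⬝ᵥ w := by
  rw [Matrix.dotProduct_mulVec, Matrix.vecMul_transpose]

theorem repeatRow_mulVec {a b s : ℕ} (X : Matrix (Fin a) (Fin b) ℝ) (w : ℕ → Fin b → ℝ) :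
    repeatRow s X *ᵥ (fun p : Fin b × Fin s => w p.2 p.1) =
      X *ᵥ ∑ i ∈ Finset.range s, w i := by
  rw [← Fin.sum_univ_eq_sum_range]
  funext c
  simp only [Matrix.mulVec, dotProduct, repeatRow, Matrix.submatrix_apply, id,
    Fintype.sum_prod_type, Finset.sum_apply, Finset.mul_sum]

theorem repeatCol_eq_transpose {a b s : ℕ} (X : Matrix (Fin a) (Fin b) ℝ) :
    repeatCol s X = (repeatRow s Xᵀ)ᵀ := rfl

theorem dotProduct_blockDiagonal_mulVec {m s : ℕ} (W : ℕ → Matrix (Fin m) (Fin m) ℝ)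
    (w : ℕ → Fin m → ℝ) :
    (fun p : Fin m × Fin s => w p.2 p.1) ⬝ᵥ (Matrix.blockDiagonal fun i : Fin s => W i) *ᵥ
      (fun p : Fin m × Fin s => w p.2 p.1) = ∑ i ∈ Finset.range s, w i ⬝ᵥ W i *ᵥ w i := by
  rw [← Fin.sum_univ_eq_sum_range (fun i => w i ⬝ᵥ W i *ᵥ w i)]
  simp only [dotProduct, Fintype.sum_prod_type]
  rw [Finset.sum_comm]
  refine Finset.sum_congr rfl fun i _ => Finset.sum_congr rfl fun a _ => ?_
  congr 1
  simp only [Matrix.mulVec, dotProduct, Fintype.sum_prod_type, Matrix.blockDiagonal_apply]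
  refine Finset.sum_congr rfl fun b _ => ?_
  simp

theorem dotProduct_matH_mulVec (R : ℕ → Matrix (Fin m) (Fin m) ℝ) (z : Fin l → ℝ) :
    z ⬝ᵥ matH r h q K R *ᵥ z = ∑ i ∈ Finset.range (r - 1), (q (i + 1) * h) ^ r *
      (K (i + 1) *ᵥ z ⬝ᵥ R (i + 1) *ᵥ (K (i + 1) *ᵥ z)) := by
  rw [matH, Matrix.sum_mulVec, dotProduct_sum, Finset.range_eq_Ico,
    Finset.sum_Ico_add' (fun i => ((q i : ℝ) * h) ^ r * (K i *ᵥ z ⬝ᵥ R i *ᵥ (K i *ᵥ z)))]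
  refine Finset.sum_congr ?_ fun i _ => ?_
  · ext i
    simp only [Finset.mem_Icc, Finset.mem_Ico]
    omega
  · rw [Matrix.smul_mulVec, dotProduct_smul, smul_eq_mul, Matrix.mul_assoc,
      ← Matrix.mulVec_mulVec, dotProduct_transpose_mulVec, Matrix.mulVec_mulVec]

theorem dotProduct_Phi11_mulVec {α : ℝ} {P : Matrix (Fin n) (Fin n) ℝ} (hP : Pᵀ = P)
    (W : ℕ → Matrix (Fin m) (Fin m) ℝ) (v : Fin n → ℝ) :
    v ⬝ᵥ Phi11 A B C r h q K α P W *ᵥ v =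
      2 * (v ⬝ᵥ P *ᵥ (matD A B C r h q K *ᵥ v)) + 2 * α * (v ⬝ᵥ P *ᵥ v) +
        ∑ i ∈ Finset.range r, h ^ 2 * Real.exp (2 * α * h) *
          (K i *ᵥ ((C * A) *ᵥ v) ⬝ᵥ W i *ᵥ (K i *ᵥ ((C * A) *ᵥ v))) := by
  have h1 : v ⬝ᵥ ((matD A B C r h q K)ᵀ * P) *ᵥ v =
      v ⬝ᵥ P *ᵥ (matD A B C r h q K *ᵥ v) := by
    rw [← Matrix.mulVec_mulVec, dotProduct_transpose_mulVec, dotProduct_comm]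
    conv_lhs => rw [← hP]
    rw [← dotProduct_transpose_mulVec, Matrix.transpose_transpose]
  have h2 : v ⬝ᵥ (∑ i ∈ Finset.range r, (K i * C * A)ᵀ * W i * (K i * C * A)) *ᵥ v =
      ∑ i ∈ Finset.range r,
        (K i *ᵥ ((C * A) *ᵥ v) ⬝ᵥ W i *ᵥ (K i *ᵥ ((C * A) *ᵥ v))) := by
    rw [Matrix.sum_mulVec, dotProduct_sum]
    refine Finset.sum_congr rfl fun i _ => ?_
    rw [Matrix.mul_assoc _ (W i), ← Matrix.mulVec_mulVec, dotProduct_transpose_mulVec,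
      Matrix.mulVec_mulVec, Matrix.mulVec_mulVec, Matrix.mul_assoc (K i)]
  rw [Phi11, Matrix.add_mulVec, Matrix.add_mulVec, Matrix.add_mulVec, dotProduct_add,
    dotProduct_add, dotProduct_add, h1, Matrix.smul_mulVec, Matrix.smul_mulVec, dotProduct_smul,
    dotProduct_smul, h2, ← Matrix.mulVec_mulVec, smul_eq_mul, smul_eq_mul, Finset.mul_sum]
  ring

/-- Test the form on `(v, d, e, z)` with `z = C A^(r-1) y`. This choice of the last block performs
the Schur complement without inverting `H`, which may be singular. -/
theorem isExpStable_of_Phi (hr : 2 ≤ r) (hCB : ∀ i, i + 2 ≤ r → C * A ^ i * B = 0)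
    (hh : 0 < h) (hq0 : q 0 = 0) (hq : ∀ i, i + 1 < r → q i < q (i + 1))
    {α : ℝ} (hα : 0 ≤ α) {P : Matrix (Fin n) (Fin n) ℝ} {W R : ℕ → Matrix (Fin m) (Fin m) ℝ}
    (hP : P.PosDef) (hW : ∀ i < r, (W i).PosDef) (hR : ∀ i, 1 ≤ i → i < r → (R i).PosDef)
    (hPhi : (-Phi A B C r h q K α P W R).PosSemidef) :
    IsExpStable (IsSampledLoop A B C r h q K) α := by
  refine isExpStable_of_quadraticForms hr hCB hh hq0 hq hα hP (fun i hi => (hW i hi).posSemidef)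
    (fun i h1 h2 => (hR i h1 h2).posSemidef) fun v y d e hy => ?_
  have hPt : Pᵀ = P := by
    have := hP.isHermitian
    rwa [Matrix.IsHermitian, Matrix.conjTranspose_eq_transpose_of_trivial] at this
  set D := matD A B C r h q K
  set H := matH r h q K R
  set z := (C * A ^ (r - 1)) *ᵥ y
  set sd := ∑ i ∈ Finset.range r, d i
  set se := ∑ i ∈ Finset.range (r - 1), e (i + 1)
  have h0 := hPhi.dotProduct_mulVec_nonneg (Sum.elim (Sum.elim v fun p => d p.2 p.1)
    (Sum.elim (fun p => e (p.2 + 1) p.1) z))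
  rw [star_trivial, Matrix.neg_mulVec, dotProduct_neg] at h0
  simp only [Phi, Matrix.fromBlocks_mulVec, sumElim_dotProduct_sumElim,
    Matrix.transpose_zero, Matrix.fromBlocks_transpose, Matrix.zero_mulVec, Sum.elim_comp_inl,
    Sum.elim_comp_inr, dotProduct_add] at h0
  have e22 : (fun p : Fin m × Fin r => d p.2 p.1) ⬝ᵥ Phi22 r h q α W *ᵥ
      (fun p : Fin m × Fin r => d p.2 p.1) =
      -∑ i ∈ Finset.range r, Real.pi ^ 2 / 4 * Real.exp (-2 * α * (q i * h)) *
          (d i ⬝ᵥ W i *ᵥ d i) := by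
    rw [Phi22, Matrix.smul_mulVec, dotProduct_smul, dotProduct_blockDiagonal_mulVec
      (fun i => Real.exp (-2 * α * ((q i : ℝ) * h)) • W i) d, smul_eq_mul, neg_mul,
      Finset.mul_sum]
    congr 1
    refine Finset.sum_congr rfl fun i _ => ?_
    rw [Matrix.smul_mulVec, dotProduct_smul, smul_eq_mul]
    ring
  have e33 : (fun p : Fin m × Fin (r - 1) => e (p.2 + 1) p.1) ⬝ᵥ Phi33 r h q α R *ᵥ
      (fun p : Fin m × Fin (r - 1) => e (p.2 + 1) p.1) =
      -∑ i ∈ Finset.range (r - 1), (r ! : ℝ) ^ 2 / (q (i + 1) * h) ^ r *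
          Real.exp (-2 * α * (q (i + 1) * h)) * (e (i + 1) ⬝ᵥ R (i + 1) *ᵥ e (i + 1)) := by
    rw [Phi33, Matrix.smul_mulVec, dotProduct_smul, dotProduct_blockDiagonal_mulVec
      (fun i => (Real.exp (-2 * α * ((q (i + 1) : ℝ) * h)) / ((q (i + 1) : ℝ) * h) ^ r) •
        R (i + 1)) (fun i => e (i + 1)), smul_eq_mul, neg_mul, Finset.mul_sum]
    congr 1
    refine Finset.sum_congr rfl fun i _ => ?_
    rw [Matrix.smul_mulVec, dotProduct_smul, smul_eq_mul]
    ring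
  have e12 := repeatRow_mulVec (s := r) (P * B) d
  have e13 := repeatRow_mulVec (s := r - 1) (P * B) fun i => e (i + 1)
  have e24 := repeatRow_mulVec (s := r) ((C * A ^ (r - 1) * B)ᵀ * H)ᵀ d
  have e34 := repeatRow_mulVec (s := r - 1) ((C * A ^ (r - 1) * B)ᵀ * H)ᵀ fun i => e (i + 1)
  have hz : (C * A ^ (r - 1) * D) *ᵥ v + (C * A ^ (r - 1) * B) *ᵥ sd +
      (C * A ^ (r - 1) * B) *ᵥ se = z := by
    simp only [z, hy, Matrix.mulVec_add, ← Matrix.mulVec_mulVec]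
  -- The off-diagonal blocks of the last column contribute `2 zᵀ H z`, and the corner `-H` takes one
  -- copy away. What remains is the velocity term of the dissipation inequality.
  have hHz : z ⬝ᵥ H *ᵥ z = ((C * A ^ (r - 1) * D) *ᵥ v) ⬝ᵥ H *ᵥ z +
      ((C * A ^ (r - 1) * B) *ᵥ sd) ⬝ᵥ H *ᵥ z + ((C * A ^ (r - 1) * B) *ᵥ se) ⬝ᵥ H *ᵥ z := by
    conv_lhs => enter [1]; rw [← hz]
    rw [add_dotProduct, add_dotProduct]
  have hPy : v ⬝ᵥ P *ᵥ y = v ⬝ᵥ P *ᵥ (D *ᵥ v) + v ⬝ᵥ P *ᵥ (B *ᵥ sd) +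
      v ⬝ᵥ P *ᵥ (B *ᵥ se) := by
    rw [hy, Matrix.mulVec_add, Matrix.mulVec_add, dotProduct_add, dotProduct_add]
  have hmix : ∀ {k : ℕ} (M : Matrix (Fin l) (Fin k) ℝ) (w : Fin k → ℝ),
      (Mᵀ * H)ᵀ *ᵥ w ⬝ᵥ z = M *ᵥ w ⬝ᵥ H *ᵥ z := fun M w => by
    rw [← dotProduct_transpose_mulVec, Matrix.transpose_transpose, ← Matrix.mulVec_mulVec,
      dotProduct_transpose_mulVec]
  rw [e22, e33, dotProduct_Phi11_mulVec hPt] at h0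
  have hv : v ⬝ᵥ ((C * A ^ (r - 1) * D)ᵀ * H) *ᵥ z = (C * A ^ (r - 1) * D) *ᵥ v ⬝ᵥ H *ᵥ z := by
    rw [← Matrix.mulVec_mulVec, dotProduct_transpose_mulVec]
  simp only [repeatCol_eq_transpose, Matrix.transpose_transpose, dotProduct_transpose_mulVec,
    show matH r h q K R = H from rfl, show matD A B C r h q K = D from rfl,
    e12, e13, e24, e34, dotProduct_zero, Matrix.neg_mulVec, dotProduct_neg, dotProduct_comm _ v,
    dotProduct_comm z (_ᵀ *ᵥ _), hmix, hv, ← Matrix.mulVec_mulVec _ P] at h0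
  rw [← dotProduct_matH_mulVec]
  linarith

end MatrixInequality

/-! ### The derivative-dependent loop. -/

section DerivativeControl

open scoped Kronecker
open Set MeasureTheory Filter Topology intervalIntegral

variable {n m l : ℕ}

theorem IsExpStable.mono {Loop : (ℝ → Fin n → ℝ) → Prop} {α β : ℝ} (h : IsExpStable Loop β)
    (hαβ : α ≤ β) : IsExpStable Loop α := by
  obtain ⟨h1, c, hc⟩ := h
  refine ⟨h1, |c|, fun x hx t ht => (hc x hx t ht).trans ?_⟩
  gcongr
  exact le_abs_self c

section DerivativeLoop

variable {A : Matrix (Fin n) (Fin n) ℝ} {B : Matrix (Fin n) (Fin m) ℝ}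
  {C : Matrix (Fin l) (Fin n) ℝ} {r : ℕ}

theorem hasDerivWithinAt_flow_const (D : Matrix (Fin n) (Fin n) ℝ) (x₀ : Fin n → ℝ) (t : ℝ)
    (S : Set ℝ) : HasDerivWithinAt (fun s => flow D s *ᵥ x₀) (D *ᵥ (flow D t *ᵥ x₀)) S t := by
  simpa using hasDerivWithinAt_flow_mulVec D (hasDerivWithinAt_const t S x₀)

theorem gainRow_mul_outputCol_mulVec (A : Matrix (Fin n) (Fin n) ℝ) (C : Matrix (Fin l) (Fin n) ℝ)
    (r : ℕ) (K : ℕ → Matrix (Fin m) (Fin l) ℝ) (v : Fin n → ℝ) :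
    (gainRow r K * outputCol A C r) *ᵥ v = ∑ i ∈ Finset.range r, K i *ᵥ ((C * A ^ i) *ᵥ v) := by
  rw [← Matrix.mulVec_mulVec, gainRow_mulVec,
    ← Fin.sum_univ_eq_sum_range fun i => K i *ᵥ ((C * A ^ i) *ᵥ v)]
  rfl

/-- Along the flow the relative degree yields `y^(i) = C A^i x` for `i < r`, by induction on `i`.
Only this inclusion is needed: the assumed decay then applies to every flow line. -/
theorem isDerivativeLoop_flow (hCB : ∀ i, i + 2 ≤ r → C * A ^ i * B = 0)
    (Kbar : ℕ → Matrix (Fin m) (Fin l) ℝ) (x₀ : Fin n → ℝ) :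
    IsDerivativeLoop A B C r Kbar
      fun t => flow (A + B * (gainRow r Kbar * outputCol A C r)) t *ᵥ x₀ := by
  set F := gainRow r Kbar * outputCol A C r
  set D := A + B * F
  set x : ℝ → Fin n → ℝ := fun t => flow D t *ᵥ x₀
  have hD : ∀ t S, HasDerivWithinAt x (D *ᵥ x t) S t := hasDerivWithinAt_flow_const D x₀
  have hDx : ∀ v, D *ᵥ v = A *ᵥ v + B *ᵥ (F *ᵥ v) := fun v => by
    rw [Matrix.mulVec_mulVec, ← Matrix.add_mulVec]
  have hy : ∀ i, i < r → ∀ t, 0 ≤ t →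
      iteratedDerivWithin i (output C x) (Ici 0) t = (C * A ^ i) *ᵥ x t := by
    intro i
    induction i with
    | zero =>
      intro _ t ht
      simp [output, ht]
    | succ i ih =>
      intro hi t ht
      rw [iteratedDerivWithin_succ, derivWithin_congr (f := fun s => (C * A ^ i) *ᵥ x s)
        (s := Ici 0) (fun s hs => ih (by omega) s hs) (ih (by omega) t ht)]
      rw [(hasDerivWithinAt_mulVec (C * A ^ i) (hD t (Ici 0))).derivWithin
        (uniqueDiffOn_Ici 0 t ht), hDx, Matrix.mulVec_add, Matrix.mulVec_mulVec _ _ B,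
        hCB i (by omega), Matrix.zero_mulVec, add_zero, Matrix.mulVec_mulVec, Matrix.mul_assoc,
        ← pow_succ]
  refine ⟨fun t => F *ᵥ x t, ⟨?_, fun t _ => ?_⟩, fun t ht => ?_⟩
  · exact fun t _ => (hD t (Ici 0)).continuousWithinAt
  · have := hD t (Ici t)
    rwa [hDx] at this
  · refine (gainRow_mul_outputCol_mulVec A C r Kbar (x t)).trans ?_
    exact Finset.sum_congr rfl fun i hi => by rw [hy i (Finset.mem_range.1 hi) t ht]

theorem exists_flow_bound (hCB : ∀ i, i + 2 ≤ r → C * A ^ i * B = 0)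
    {Kbar : ℕ → Matrix (Fin m) (Fin l) ℝ} {α : ℝ}
    (hstab : IsExpStable (IsDerivativeLoop A B C r Kbar) α) :
    ∃ c : ℝ, ∀ v, ∀ t, 0 ≤ t →
      sqNorm (flow (A + B * (gainRow r Kbar * outputCol A C r)) t *ᵥ v) ≤
        c * Real.exp (-2 * α * t) * sqNorm v := by
  obtain ⟨_, c, hc⟩ := hstab
  refine ⟨c ^ 2, fun v t ht => ?_⟩
  have h1 := hc _ (isDerivativeLoop_flow hCB Kbar v) t ht
  simp only [flow_zero, Matrix.one_mulVec] at h1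
  have h2 := pow_le_pow_left₀ (norm_nonneg _) h1 2
  rw [norm_toLp_sq, mul_pow, mul_pow, norm_toLp_sq, ← Real.exp_nat_mul] at h2
  have e : ((2 : ℕ) : ℝ) * (-α * t) = -2 * α * t := by push_cast; ring
  rwa [e] at h2

end DerivativeLoop

/-! ### A converse Lyapunov theorem from a finite-horizon Gramian. -/

section Lyapunov

variable (D : Matrix (Fin n) (Fin n) ℝ) (α T : ℝ)

/-- The finite-horizon Gramian `∫₀ᵀ e^{2 α t} (e^{t D})ᵀ e^{t D} dt`. -/
def gramian : Matrix (Fin n) (Fin n) ℝ :=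
  Matrix.of fun i j => ∫ t in (0 : ℝ)..T, Real.exp (2 * α * t) * ((flow D t)ᵀ * flow D t) i j

theorem dotProduct_gramian_mulVec (v y : Fin n → ℝ) :
    v ⬝ᵥ gramian D α T *ᵥ y =
      ∫ t in (0 : ℝ)..T, Real.exp (2 * α * t) * (flow D t *ᵥ v ⬝ᵥ flow D t *ᵥ y) := by
  have hc : ∀ i j, IsLocBdd fun t => Real.exp (2 * α * t) * ((flow D t)ᵀ * flow D t) i j :=
    fun i j => IsLocBdd.of_continuous (Continuous.mul (by fun_prop)
      (((continuous_flow D).matrix_transpose.matrix_mul (continuous_flow D)).matrix_elem i j))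
  have h1 : ∀ t, Real.exp (2 * α * t) * (flow D t *ᵥ v ⬝ᵥ flow D t *ᵥ y) =
      ∑ i, ∑ j, v i * y j * (Real.exp (2 * α * t) * ((flow D t)ᵀ * flow D t) i j) := fun t => by
    rw [← dotProduct_transpose_mulVec, Matrix.mulVec_mulVec]
    simp only [Matrix.mulVec, dotProduct, Finset.mul_sum]
    refine Finset.sum_congr rfl fun i _ => Finset.sum_congr rfl fun j _ => ?_
    ring
  simp only [h1]
  rw [intervalIntegral.integral_finsetSum fun i _ => IsLocBdd.intervalIntegrable
    (IsLocBdd.sum _ fun j _ => (hc i j).const_mul (v i * y j)) _ _]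
  simp only [Matrix.mulVec, dotProduct, gramian, Matrix.of_apply, Finset.mul_sum]
  refine Finset.sum_congr rfl fun i _ => ?_
  rw [intervalIntegral.integral_finsetSum fun j _ =>
    ((hc i j).const_mul (v i * y j)).intervalIntegrable _ _]
  refine Finset.sum_congr rfl fun j _ => ?_
  rw [intervalIntegral.integral_const_mul]
  ring

theorem continuous_flow_mulVec (v : Fin n → ℝ) : Continuous fun t => flow D t *ᵥ v :=
  (continuous_flow D).matrix_mulVec continuous_const

theorem posDef_gramian {T : ℝ} (hT : 0 < T) : (gramian D α T).PosDef := by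
  refine Matrix.PosDef.of_dotProduct_mulVec_pos ?_ fun v hv => ?_
  · rw [Matrix.IsHermitian, Matrix.conjTranspose_eq_transpose_of_trivial]
    ext i j
    simp only [Matrix.transpose_apply, gramian, Matrix.of_apply]
    refine integral_congr fun t _ => ?_
    have h : ((flow D t)ᵀ * flow D t)ᵀ = (flow D t)ᵀ * flow D t := by
      rw [Matrix.transpose_mul, Matrix.transpose_transpose]
    have h' := congrFun (congrFun h i) j
    rw [Matrix.transpose_apply] at h'
    simp only [h']
  · rw [star_trivial, dotProduct_gramian_mulVec]
    have hc := continuous_flow_mulVec D v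
    refine intervalIntegral_pos_of_pos
      (Continuous.intervalIntegrable ((by fun_prop : Continuous fun t => Real.exp (2 * α * t)).mul
        (hc.dotProduct hc)) _ _) (fun t => mul_pos (Real.exp_pos _) ?_) hT
    have h1 : flow D t *ᵥ v ≠ 0 := fun h0 => hv (by
      have h2 := flow_mul_flow_neg D (-t)
      rw [neg_neg] at h2
      rw [← Matrix.one_mulVec v, ← h2, ← Matrix.mulVec_mulVec, h0, Matrix.mulVec_zero])
    exact lt_of_le_of_ne (sqNorm_nonneg _) fun h => h1 (dotProduct_self_eq_zero.1 h.symm)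

/-- `D` commutes with its flow, so the left side integrates the derivative of `e^(2αt) |e^(tD) v|²`.
-/
theorem gramian_lyapunov {T : ℝ} (hT : 0 ≤ T) (v : Fin n → ℝ) :
    2 * (v ⬝ᵥ gramian D α T *ᵥ (D *ᵥ v)) + 2 * α * (v ⬝ᵥ gramian D α T *ᵥ v) =
      Real.exp (2 * α * T) * sqNorm (flow D T *ᵥ v) - sqNorm v := by
  have hc := continuous_flow_mulVec D v
  have hc' := continuous_flow_mulVec D (D *ᵥ v)
  have he : Continuous fun t => Real.exp (2 * α * t) := by fun_prop
  have hl₁ : IsLocBdd fun t => Real.exp (2 * α * t) * (flow D t *ᵥ v ⬝ᵥ flow D t *ᵥ (D *ᵥ v)) :=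
    IsLocBdd.of_continuous (he.mul (hc.dotProduct hc'))
  have hl₂ : IsLocBdd fun t => Real.exp (2 * α * t) * (flow D t *ᵥ v ⬝ᵥ flow D t *ᵥ v) :=
    IsLocBdd.of_continuous (he.mul (hc.dotProduct hc))
  have hcs : Continuous fun t => sqNorm (flow D t *ᵥ v) := hc.dotProduct hc
  rw [dotProduct_gramian_mulVec, dotProduct_gramian_mulVec, ← intervalIntegral.integral_const_mul,
    ← intervalIntegral.integral_const_mul, ← intervalIntegral.integral_add
      ((hl₁.const_mul _).intervalIntegrable _ _) ((hl₂.const_mul _).intervalIntegrable _ _),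
    integral_eq_sub_of_hasDeriv_right_of_le
    (f := fun t => Real.exp (2 * α * t) * sqNorm (flow D t *ᵥ v)) hT (he.mul hcs).continuousOn]
  · simp [flow_zero]
  · intro t _
    refine (hasDerivWithinAt_exp_mul_sqNorm
      (hasDerivWithinAt_flow_const D v t (Ioi t))).congr_deriv ?_
    rw [Matrix.mulVec_mulVec (M := D), ← flow_mul_comm, ← Matrix.mulVec_mulVec, sqNorm]
    ring
  · exact ((hl₁.const_mul _).add (hl₂.const_mul _)).intervalIntegrable _ _

/-- A converse Lyapunov theorem for `x' = D x`. -/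
theorem exists_lyapunov {D : Matrix (Fin n) (Fin n) ℝ} {α β c : ℝ} (hαβ : α < β)
    (hc : ∀ v, ∀ t, 0 ≤ t → sqNorm (flow D t *ᵥ v) ≤ c * Real.exp (-2 * β * t) * sqNorm v) :
    ∃ P : Matrix (Fin n) (Fin n) ℝ, P.PosDef ∧ ∀ v,
      2 * (v ⬝ᵥ P *ᵥ (D *ᵥ v)) + 2 * α * (v ⬝ᵥ P *ᵥ v) ≤ -(1 / 2) * sqNorm v := by
  -- A horizon at which the end term is at most `|v|² / 2`. A finite one suffices, so no improper
  -- integral is needed.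
  obtain ⟨T, hT0, hT⟩ : ∃ T : ℝ, 0 < T ∧ c * Real.exp (-(2 * (β - α) * T)) ≤ 1 / 2 := by
    have h1 : Tendsto (fun T : ℝ => c * Real.exp (-(2 * (β - α) * T))) atTop (𝓝 (c * 0)) := by
      refine Tendsto.const_mul c (Real.tendsto_exp_neg_atTop_nhds_zero.comp ?_)
      exact tendsto_id.const_mul_atTop (by linarith)
    rw [mul_zero] at h1
    obtain ⟨T, hT, hT'⟩ := ((h1.eventually (gt_mem_nhds (show (0 : ℝ) < 1 / 2 by norm_num))).and
      (eventually_gt_atTop 0)).exists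
    exact ⟨T, hT', hT.le⟩
  refine ⟨gramian D α T, posDef_gramian D α hT0, fun v => ?_⟩
  rw [gramian_lyapunov D α hT0.le]
  have h1 := mul_le_mul_of_nonneg_left (hc v T hT0.le) (Real.exp_nonneg (2 * α * T))
  have h2 : Real.exp (2 * α * T) * (c * Real.exp (-2 * β * T) * sqNorm v) =
      c * Real.exp (-(2 * (β - α) * T)) * sqNorm v := by
    rw [show -(2 * (β - α) * T) = 2 * α * T + -2 * β * T by ring, Real.exp_add]
    ring
  rw [h2] at h1
  have h3 := mul_le_mul_of_nonneg_right hT (sqNorm_nonneg v)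
  linarith

end Lyapunov

/-! ### Inversion of `M` and growth of the gains. -/

section Vandermonde

/-- The scalar matrix `((-i)^j / j!)`, `i, j = 0, …, r - 1`. -/
def unitVandermonde (r : ℕ) : Matrix (Fin r) (Fin r) ℝ :=
  Matrix.of fun i j => (-(i : ℝ)) ^ (j : ℕ) / ((j : ℕ)! : ℝ)

theorem isUnit_det_unitVandermonde (r : ℕ) : IsUnit (unitVandermonde r).det := by
  have h1 : unitVandermonde r = Matrix.vandermonde (fun i : Fin r => -(i : ℝ)) *
      Matrix.diagonal fun j : Fin r => (((j : ℕ)! : ℝ))⁻¹ := by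
    ext i j
    rw [Matrix.mul_diagonal, Matrix.vandermonde_apply, unitVandermonde, Matrix.of_apply,
      div_eq_mul_inv]
  rw [h1, Matrix.det_mul, Matrix.det_diagonal, isUnit_iff_ne_zero]
  refine mul_ne_zero (Matrix.det_vandermonde_ne_zero_iff.2 fun i j hij => ?_)
    (Finset.prod_ne_zero_iff.2 fun j _ => by positivity)
  exact Fin.ext (by exact_mod_cast neg_injective hij)

variable {r : ℕ} {h : ℝ} {q : ℕ → ℕ} {p : ℕ}

/-- Equally spaced delays `q_i h = i (p h)` isolate the dependence on `h` in a diagonal factor,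
leaving a matrix that depends only on `r`. -/
theorem vandermondeM_eq_kronecker (l : ℕ) (hq : ∀ i, q i = i * p) :
    vandermondeM l r h q = (1 : Matrix (Fin l) (Fin l) ℝ) ⊗ₖ
      (unitVandermonde r * Matrix.diagonal fun j : Fin r => ((p : ℝ) * h) ^ (j : ℕ)) := by
  ext a b
  rw [Matrix.kronecker_apply, Matrix.mul_diagonal, vandermondeM, unitVandermonde, Matrix.of_apply,
    Matrix.of_apply, hq]
  push_cast
  rw [show -((a.2 : ℝ) * p * h) = -(a.2 : ℝ) * (p * h) by ring, mul_pow]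
  ring

theorem isUnit_det_vandermondeM (l : ℕ) (hq : ∀ i, q i = i * p) (hp : (p : ℝ) * h ≠ 0) :
    IsUnit (vandermondeM l r h q).det := by
  rw [vandermondeM_eq_kronecker l hq, Matrix.det_kronecker, Matrix.det_one, one_pow, one_mul,
    Matrix.det_mul, Matrix.det_diagonal]
  refine IsUnit.pow _ ((isUnit_det_unitVandermonde r).mul (isUnit_iff_ne_zero.2 ?_))
  exact Finset.prod_ne_zero_iff.2 fun j _ => pow_ne_zero _ hp

/-- The diagonal factor inverts explicitly, which exhibits the powers `(p h)^(-j)` responsible for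
the growth of the gains. -/
theorem gain_eq (hq : ∀ i, q i = i * p) (hp : (p : ℝ) * h ≠ 0)
    {K Kbar : ℕ → Matrix (Fin m) (Fin l) ℝ}
    (hK : gainRow r K = gainRow r Kbar * (vandermondeM l r h q)⁻¹) (i : Fin r) :
    K i = ∑ j : Fin r, ((((p : ℝ) * h) ^ (j : ℕ))⁻¹ * (unitVandermonde r)⁻¹ j i) • Kbar j := by
  have h1 : (unitVandermonde r * Matrix.diagonal fun j : Fin r => ((p : ℝ) * h) ^ (j : ℕ))⁻¹ =
      (Matrix.diagonal fun j : Fin r => (((p : ℝ) * h) ^ (j : ℕ))⁻¹) * (unitVandermonde r)⁻¹ := by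
    refine Matrix.inv_eq_right_inv ?_
    rw [Matrix.mul_assoc, ← Matrix.mul_assoc (Matrix.diagonal _), Matrix.diagonal_mul_diagonal]
    have h2 : (fun j : Fin r => ((p : ℝ) * h) ^ (j : ℕ) * (((p : ℝ) * h) ^ (j : ℕ))⁻¹) = 1 := by
      funext j
      exact mul_inv_cancel₀ (pow_ne_zero _ hp)
    rw [h2, Matrix.diagonal_one', Matrix.one_mul,
      Matrix.mul_nonsing_inv _ (isUnit_det_unitVandermonde r)]
  rw [vandermondeM_eq_kronecker l hq, Matrix.inv_kronecker, inv_one, h1] at hK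
  ext a b
  have h3 := congrFun (congrFun hK a) (b, i)
  rw [gainRow, Matrix.of_apply, Matrix.mul_apply, Fintype.sum_prod_type] at h3
  rw [h3, Finset.sum_eq_single b]
  · rw [Matrix.sum_apply]
    refine Finset.sum_congr rfl fun j _ => ?_
    rw [Matrix.kronecker_apply, Matrix.one_apply_eq, Matrix.diagonal_mul, Matrix.smul_apply,
      gainRow, Matrix.of_apply, smul_eq_mul]
    ring
  · intro c _ hc
    refine Finset.sum_eq_zero fun j _ => ?_
    rw [Matrix.kronecker_apply, Matrix.one_apply_ne hc]
    ring
  · simp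

/-- The gains grow at most like `η ^ (-(r - 1))`, where `η = p h` is the smallest delay. -/
theorem exists_gain_bound (r : ℕ) (Kbar : ℕ → Matrix (Fin m) (Fin l) ℝ) :
    ∃ L : ℝ, 0 ≤ L ∧ ∀ (h : ℝ) (q : ℕ → ℕ) (p : ℕ) (K : ℕ → Matrix (Fin m) (Fin l) ℝ),
      (∀ i, q i = i * p) → 0 < (p : ℝ) * h → (p : ℝ) * h ≤ 1 →
      gainRow r K = gainRow r Kbar * (vandermondeM l r h q)⁻¹ →
      ∀ i < r, ∀ v, (((p : ℝ) * h) ^ (r - 1)) ^ 2 * sqNorm (K i *ᵥ v) ≤ L * sqNorm v := by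
  choose b hb0 hb using fun j => exists_mulVec_bound (Kbar j)
  -- Independent of the delay: since `p h ≤ 1`, the factor `(p h)^(r-1)` absorbs every `(p h)^(-j)`
  -- with `j ≤ r - 1`.
  set L := ∑ i : Fin r, ∑ j : Fin r, |(unitVandermonde r)⁻¹ j i| * b j
  have hL0 : 0 ≤ L := Finset.sum_nonneg fun i _ => Finset.sum_nonneg fun j _ =>
    mul_nonneg (abs_nonneg _) (hb0 j)
  refine ⟨m * L ^ 2, by positivity, fun h q p K hq hp0 hp1 hK i hi v => ?_⟩
  set η := (p : ℝ) * h
  have h1 : ‖η ^ (r - 1) • (K i *ᵥ v)‖ ≤ L * ‖v‖ := by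
    have h2 := gain_eq hq hp0.ne' hK ⟨i, hi⟩
    simp only at h2
    rw [h2, Matrix.sum_mulVec, Finset.smul_sum]
    calc _ ≤ ∑ j : Fin r, |(unitVandermonde r)⁻¹ j ⟨i, hi⟩| * b j * ‖v‖ := by
          refine (norm_sum_le _ _).trans (Finset.sum_le_sum fun j _ => ?_)
          rw [Matrix.smul_mulVec, norm_smul, norm_smul, Real.norm_eq_abs, Real.norm_eq_abs,
            abs_mul, abs_of_pos (show 0 < η ^ (r - 1) by positivity),
            abs_of_pos (show 0 < (η ^ (j : ℕ))⁻¹ by positivity)]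
          have h3 : η ^ (r - 1) * (η ^ (j : ℕ))⁻¹ ≤ 1 := by
            rw [← div_eq_mul_inv]
            exact div_le_one_of_le₀ (pow_le_pow_of_le_one hp0.le hp1 (by omega)) (by positivity)
          calc _ = (η ^ (r - 1) * (η ^ (j : ℕ))⁻¹) *
                (|(unitVandermonde r)⁻¹ j ⟨i, hi⟩| * ‖Kbar j *ᵥ v‖) := by ring
            _ ≤ 1 * (|(unitVandermonde r)⁻¹ j ⟨i, hi⟩| * (b j * ‖v‖)) := by
              have := hb j v
              gcongr
            _ = _ := by ring
      _ = (∑ j : Fin r, |(unitVandermonde r)⁻¹ j ⟨i, hi⟩| * b j) * ‖v‖ := by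
          rw [Finset.sum_mul]
      _ ≤ L * ‖v‖ := by
          refine mul_le_mul_of_nonneg_right ?_ (norm_nonneg _)
          exact Finset.single_le_sum (f := fun i : Fin r =>
            ∑ j : Fin r, |(unitVandermonde r)⁻¹ j i| * b j)
            (fun i _ => Finset.sum_nonneg fun j _ => mul_nonneg (abs_nonneg _) (hb0 j))
            (Finset.mem_univ _)
  have h4 := sqNorm_le_of_norm_le h1
  have h5 : sqNorm (η ^ (r - 1) • (K i *ᵥ v)) = (η ^ (r - 1)) ^ 2 * sqNorm (K i *ᵥ v) := by
    rw [sqNorm, sqNorm, smul_dotProduct, dotProduct_smul, smul_eq_mul, smul_eq_mul]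
    ring
  rw [← h5]
  refine h4.trans ?_
  rw [mul_pow, ← mul_assoc]
  have := norm_sq_le_sqNorm v
  gcongr

end Vandermonde

end DerivativeControl

/-! ### Feasibility of the dissipation inequality for small delays. -/

section SmallDelay

open Set Filter Topology

variable {n m l : ℕ}

theorem sqNorm_sum_le {ι : Type*} (s : Finset ι) (f : ι → Fin m → ℝ) :
    sqNorm (∑ i ∈ s, f i) ≤ s.card * ∑ i ∈ s, sqNorm (f i) := by
  simp only [sqNorm_eq_sum, Finset.sum_apply]
  rw [Finset.sum_comm, Finset.mul_sum]
  exact Finset.sum_le_sum fun a _ => sq_sum_le_card_mul_sum_sq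

theorem sqNorm_add_le (v w : Fin m → ℝ) : sqNorm (v + w) ≤ 2 * sqNorm v + 2 * sqNorm w := by
  simp only [sqNorm_eq_sum, Finset.mul_sum, ← Finset.sum_add_distrib, Pi.add_apply]
  exact Finset.sum_le_sum fun a _ => by nlinarith [sq_nonneg (v a - w a)]

theorem two_mul_dotProduct_le (v w : Fin m → ℝ) {ε : ℝ} (hε : 0 < ε) :
    2 * (v ⬝ᵥ w) ≤ ε * sqNorm v + ε⁻¹ * sqNorm w := by
  simp only [sqNorm_eq_sum, dotProduct, Finset.mul_sum, ← Finset.sum_add_distrib]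
  refine Finset.sum_le_sum fun a _ => ?_
  have h1 : 0 ≤ ε⁻¹ * (ε * v a - w a) ^ 2 := by positivity
  have h2 : ε⁻¹ * (ε * v a - w a) ^ 2 = ε * v a ^ 2 + ε⁻¹ * w a ^ 2 - 2 * (v a * w a) := by
    field_simp
    ring
  linarith

theorem exists_sqNorm_mulVec_le_sqNorm {k : ℕ} (M : Matrix (Fin m) (Fin k) ℝ) :
    ∃ b : ℝ, 0 ≤ b ∧ ∀ v, sqNorm (M *ᵥ v) ≤ b * sqNorm v := by
  obtain ⟨b, hb0, hb⟩ := exists_sqNorm_mulVec_le M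
  exact ⟨b, hb0, fun v => (hb v).trans (mul_le_mul_of_nonneg_left (norm_sq_le_sqNorm v) hb0)⟩

theorem dotProduct_smul_one_mulVec (c : ℝ) (w : Fin m → ℝ) :
    w ⬝ᵥ (c • (1 : Matrix (Fin m) (Fin m) ℝ)) *ᵥ w = c * sqNorm w := by
  rw [Matrix.smul_mulVec, Matrix.one_mulVec, dotProduct_smul, smul_eq_mul, sqNorm]

/-- The inequality between the coefficients that remains once all matrices have been estimated. -/
theorem small_delay_arith {V E c₁ c₂ c₃ c₀ η : ℝ} (hV : 0 ≤ V) (hE : 0 ≤ E)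
    (hc₃ : 0 ≤ c₃) (hη : 0 < η) (hη1 : η ≤ 1) (h1 : η * (4 * c₂ + 1) ≤ 1)
    (h2 : η * (c₁ + c₃) ≤ c₀) :
    -(1 / 2) * V + (1 / 4 * V + c₁ * E) + η * (c₂ * V + c₃ * E) ≤ c₀ / η * E := by
  have h3 : c₁ + c₃ ≤ c₀ / η := by
    rw [le_div_iff₀ hη]; linarith
  have h4 : η * c₂ ≤ 1 / 4 := by nlinarith
  have h5 : η * c₃ ≤ c₃ := by nlinarith
  nlinarith [mul_le_mul_of_nonneg_right h3 hE, mul_le_mul_of_nonneg_right h4 hV,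
    mul_le_mul_of_nonneg_right h5 hE]

theorem exp_delay_lower_bound {α η : ℝ} (hα : 0 ≤ α) (hη1 : η ≤ 1) {i k : ℕ} (hi : i ≤ k) :
    Real.exp (-2 * α * (k : ℝ)) ≤ Real.exp (-2 * α * ((i : ℝ) * η)) := by
  have h1 : (i : ℝ) * η ≤ k := by
    have h2 : (i : ℝ) ≤ k := by exact_mod_cast hi
    nlinarith [(Nat.cast_nonneg i : (0 : ℝ) ≤ i)]
  refine Real.exp_le_exp.2 ?_
  nlinarith

/-- Delays are at most `k + 1`, which bounds the exponential, and `π² / 4 ≥ 1`. The division by `(k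
+ 1)^(k + 1)` is wasteful here, but lets sampling and Taylor errors share one constant. -/
theorem weight_lower_bound_sampling {α η : ℝ} (hα : 0 ≤ α) (hη : 0 < η) (hη1 : η ≤ 1) (k : ℕ)
    (d : ℕ → Fin m → ℝ) :
    Real.exp (-2 * α * ((k + 1 : ℕ) : ℝ)) / ((k + 1 : ℕ) : ℝ) ^ (k + 1) / η *
        ∑ i ∈ Finset.range (k + 1), sqNorm (d i) ≤
      ∑ i ∈ Finset.range (k + 1), Real.pi ^ 2 / 4 * Real.exp (-2 * α * ((i : ℝ) * η)) *
          (η⁻¹ * sqNorm (d i)) := by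
  rw [Finset.mul_sum]
  refine Finset.sum_le_sum fun i hi => ?_
  have h1 := exp_delay_lower_bound hα hη1 (Finset.mem_range.1 hi).le
  have h2 : 1 ≤ Real.pi ^ 2 / 4 := by nlinarith [Real.two_le_pi]
  have h3 : (1 : ℝ) ≤ ((k + 1 : ℕ) : ℝ) ^ (k + 1) :=
    one_le_pow₀ (by exact_mod_cast Nat.le_add_left 1 k)
  have h4 : Real.exp (-2 * α * ((k + 1 : ℕ) : ℝ)) / ((k + 1 : ℕ) : ℝ) ^ (k + 1) ≤
      Real.pi ^ 2 / 4 * Real.exp (-2 * α * ((i : ℝ) * η)) := by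
    refine (div_le_self (Real.exp_nonneg _) h3).trans (h1.trans ?_)
    exact le_mul_of_one_le_left (Real.exp_nonneg _) h2
  rw [div_eq_mul_inv _ η, mul_assoc]
  exact mul_le_mul_of_nonneg_right h4 (mul_nonneg (inv_nonneg.2 hη.le) (sqNorm_nonneg _))

/-- The power `η^k` from `R` reduces `η^(-(k+1))` to `η⁻¹`, matching the scale of the sampling
weights. -/
theorem weight_lower_bound_taylor {α η : ℝ} (hα : 0 ≤ α) (hη : 0 < η) (hη1 : η ≤ 1) (k : ℕ)
    (e : ℕ → Fin m → ℝ) :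
    Real.exp (-2 * α * ((k + 1 : ℕ) : ℝ)) / ((k + 1 : ℕ) : ℝ) ^ (k + 1) / η *
        ∑ i ∈ Finset.range k, sqNorm (e (i + 1)) ≤
      ∑ i ∈ Finset.range k, ((k + 1)! : ℝ) ^ 2 / (((i + 1 : ℕ) : ℝ) * η) ^ (k + 1) *
          Real.exp (-2 * α * (((i + 1 : ℕ) : ℝ) * η)) * (η ^ k * sqNorm (e (i + 1))) := by
  rw [Finset.mul_sum]
  refine Finset.sum_le_sum fun i hi => ?_
  have hi := Finset.mem_range.1 hi
  have h1 := exp_delay_lower_bound hα hη1 (show i + 1 ≤ k + 1 by omega)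
  have h2 : (1 : ℝ) ≤ ((k + 1)! : ℝ) ^ 2 :=
    one_le_pow₀ (by exact_mod_cast Nat.one_le_iff_ne_zero.2 (Nat.factorial_ne_zero _))
  have h3 : ((i + 1 : ℕ) : ℝ) ≤ ((k + 1 : ℕ) : ℝ) := by exact_mod_cast (by omega : i + 1 ≤ k + 1)
  have h4 : (0 : ℝ) < ((i + 1 : ℕ) : ℝ) := by positivity
  have h5 := sqNorm_nonneg (e (i + 1))
  set ι : ℝ := ((i + 1 : ℕ) : ℝ)
  set ρ : ℝ := ((k + 1 : ℕ) : ℝ)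
  calc Real.exp (-2 * α * ρ) / ρ ^ (k + 1) / η * sqNorm (e (i + 1)) =
        1 / ρ ^ (k + 1) * Real.exp (-2 * α * ρ) * (η⁻¹ * sqNorm (e (i + 1))) := by ring
    _ ≤ ((k + 1)! : ℝ) ^ 2 / ι ^ (k + 1) * Real.exp (-2 * α * (ι * η)) *
        (η⁻¹ * sqNorm (e (i + 1))) := by gcongr
    _ = _ := by
      rw [mul_pow, pow_succ η]
      field_simp

/-- Count powers of `η`. As `h² ≤ (2η)^(2r)` and squared gains are `O(η^(-2(r-1)))`, the sampling
terms have order `2r - 1 - 2(r - 1) = 1`. The Taylor terms have order `r + (r - 1) - 2(r - 1) = 1`.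
The errors on the right carry weight of order `1/η`, which absorbs the cross term. -/
theorem exists_small_delay (A D P : Matrix (Fin n) (Fin n) ℝ) (B : Matrix (Fin n) (Fin m) ℝ)
    (C : Matrix (Fin l) (Fin n) ℝ) {r : ℕ} (hr : 2 ≤ r) {α L : ℝ} (hα : 0 ≤ α) (hL : 0 ≤ L)
    (hP : ∀ v, 2 * (v ⬝ᵥ P *ᵥ (D *ᵥ v)) + 2 * α * (v ⬝ᵥ P *ᵥ v) ≤ -(1 / 2) * sqNorm v) :
    ∃ η₀ : ℝ, 0 < η₀ ∧ η₀ ≤ 1 ∧ ∀ (h η : ℝ) (K : ℕ → Matrix (Fin m) (Fin l) ℝ),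
      0 < h → h ≤ 1 → 0 < η → η ≤ η₀ → h ≤ (2 * η) ^ r →
      (∀ i < r, ∀ v, (η ^ (r - 1)) ^ 2 * sqNorm (K i *ᵥ v) ≤ L * sqNorm v) →
      ∀ (v y : Fin n → ℝ) (d e : ℕ → Fin m → ℝ),
      y = D *ᵥ v + B *ᵥ ∑ i ∈ Finset.range r, d i +
        B *ᵥ ∑ i ∈ Finset.range (r - 1), e (i + 1) →
      2 * (v ⬝ᵥ P *ᵥ y) + 2 * α * (v ⬝ᵥ P *ᵥ v) +
        ∑ i ∈ Finset.range r, h ^ 2 * Real.exp (2 * α * h) *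
          (η⁻¹ * sqNorm (K i *ᵥ ((C * A) *ᵥ v))) +
        ∑ i ∈ Finset.range (r - 1), (((i + 1 : ℕ) : ℝ) * η) ^ r *
          (η ^ (r - 1) * sqNorm (K (i + 1) *ᵥ ((C * A ^ (r - 1)) *ᵥ y))) ≤
      ∑ i ∈ Finset.range r, Real.pi ^ 2 / 4 * Real.exp (-2 * α * ((i : ℝ) * η)) *
          (η⁻¹ * sqNorm (d i)) +
        ∑ i ∈ Finset.range (r - 1), (r ! : ℝ) ^ 2 / (((i + 1 : ℕ) : ℝ) * η) ^ r *
          Real.exp (-2 * α * (((i + 1 : ℕ) : ℝ) * η)) *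
            (η ^ (r - 1) * sqNorm (e (i + 1))) := by
  obtain ⟨b₁, hb₁0, hb₁⟩ := exists_sqNorm_mulVec_le_sqNorm (P * B)
  obtain ⟨b₂, hb₂0, hb₂⟩ := exists_sqNorm_mulVec_le_sqNorm (C * A)
  obtain ⟨b₃, hb₃0, hb₃⟩ := exists_sqNorm_mulVec_le_sqNorm (C * A ^ (r - 1) * D)
  obtain ⟨b₄, hb₄0, hb₄⟩ := exists_sqNorm_mulVec_le_sqNorm (C * A ^ (r - 1) * B)
  set ρ : ℝ := (r : ℝ) with hρ
  have hρ0 : 0 < ρ := by rw [hρ]; exact_mod_cast (by omega : 0 < r)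
  set a₃ := ρ * (4 ^ r * L * Real.exp (2 * α) * b₂)
  set a₄ := ρ * (ρ ^ r * L)
  have ha₃ : 0 ≤ a₃ := by positivity
  have ha₄ : 0 ≤ a₄ := by positivity
  set c₁ := 4 * (b₁ * (2 * ρ))
  set c₂ := a₃ + a₄ * (2 * b₃)
  set c₃ := a₄ * (2 * (b₄ * (2 * ρ)))
  set c₀ := Real.exp (-2 * α * ρ) / ρ ^ r
  have hc₁ : 0 ≤ c₁ := by positivity
  have hc₂ : 0 ≤ c₂ := by positivity
  have hc₃ : 0 ≤ c₃ := by positivity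
  have hc₀ : 0 < c₀ := by positivity
  -- The second entry makes the `O(η)` state terms at most `|v|² / 4`. The third lets `c₀ / η`
  -- dominate all error coefficients.
  refine ⟨min 1 (min (1 / (4 * c₂ + 1)) (c₀ / (c₁ + c₃ + 1))), by positivity, min_le_left _ _, ?_⟩
  intro h η K hh hh1 hη hηle hhη hK v y d e hy
  have hη1 : η ≤ 1 := hηle.trans (min_le_left _ _)
  have hs1 : η * (4 * c₂ + 1) ≤ 1 := by
    rw [← le_div_iff₀ (by positivity)]
    exact hηle.trans ((min_le_right _ _).trans (min_le_left _ _))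
  have hs2 : η * (c₁ + c₃) ≤ c₀ := by
    have : η * (c₁ + c₃ + 1) ≤ c₀ := by
      rw [← le_div_iff₀ (by positivity)]
      exact hηle.trans ((min_le_right _ _).trans (min_le_right _ _))
    linarith
  obtain ⟨k, rfl⟩ : ∃ k, r = k + 1 := ⟨r - 1, by omega⟩
  simp only [Nat.add_sub_cancel] at *
  set sd := ∑ i ∈ Finset.range (k + 1), d i
  set se := ∑ i ∈ Finset.range k, e (i + 1)
  set E := ∑ i ∈ Finset.range (k + 1), sqNorm (d i) + ∑ i ∈ Finset.range k, sqNorm (e (i + 1))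
  have hE1 : 0 ≤ ∑ i ∈ Finset.range (k + 1), sqNorm (d i) :=
    Finset.sum_nonneg fun i _ => sqNorm_nonneg _
  have hE2 : 0 ≤ ∑ i ∈ Finset.range k, sqNorm (e (i + 1)) :=
    Finset.sum_nonneg fun i _ => sqNorm_nonneg _
  have hsE : sqNorm (sd + se) ≤ 2 * ρ * E := by
    have h1 := sqNorm_sum_le (Finset.range (k + 1)) d
    have h2 := sqNorm_sum_le (Finset.range k) fun i => e (i + 1)
    rw [Finset.card_range] at h1 h2
    have h3 : (k : ℝ) * ∑ i ∈ Finset.range k, sqNorm (e (i + 1)) ≤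
        ρ * ∑ i ∈ Finset.range k, sqNorm (e (i + 1)) := by
      rw [hρ]; push_cast; nlinarith
    have h4 := sqNorm_add_le sd se
    simp only [E, mul_add]
    linarith
  have hy' : y = D *ᵥ v + B *ᵥ (sd + se) := by rw [hy, Matrix.mulVec_add]; abel
  -- the cross term
  have hcross : 2 * (v ⬝ᵥ P *ᵥ y) + 2 * α * (v ⬝ᵥ P *ᵥ v) ≤
      -(1 / 2) * sqNorm v + (1 / 4 * sqNorm v + c₁ * E) := by
    -- Young's inequality with `ε = 1/4` spends half of the Lyapunov margin `1/2`; the other half is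
    -- left for the `O(η)` terms.
    have h1 := two_mul_dotProduct_le v ((P * B) *ᵥ (sd + se)) (ε := 1 / 4) (by norm_num)
    have h2 : sqNorm ((P * B) *ᵥ (sd + se)) ≤ b₁ * (2 * ρ * E) :=
      (hb₁ _).trans (mul_le_mul_of_nonneg_left hsE hb₁0)
    have h3 : v ⬝ᵥ P *ᵥ y = v ⬝ᵥ P *ᵥ (D *ᵥ v) + v ⬝ᵥ (P * B) *ᵥ (sd + se) := by
      rw [hy', Matrix.mulVec_add, dotProduct_add, Matrix.mulVec_mulVec (sd + se)]
    have h4 := hP v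
    rw [h3]
    simp only [c₁]
    norm_num at h1
    linarith
  -- the sampling terms
  have hW : ∑ i ∈ Finset.range (k + 1), h ^ 2 * Real.exp (2 * α * h) *
      (η⁻¹ * sqNorm (K i *ᵥ ((C * A) *ᵥ v))) ≤ η * (a₃ * sqNorm v) := by
    have h1 : ∀ i ∈ Finset.range (k + 1), h ^ 2 * Real.exp (2 * α * h) *
        (η⁻¹ * sqNorm (K i *ᵥ ((C * A) *ᵥ v))) ≤
        4 ^ (k + 1) * η * Real.exp (2 * α) * (L * (b₂ * sqNorm v)) := fun i hi => by
      have h2 := (hK i (Finset.mem_range.1 hi) ((C * A) *ᵥ v)).trans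
        (mul_le_mul_of_nonneg_left (hb₂ v) hL)
      have h3 : h ^ 2 ≤ 4 ^ (k + 1) * (η ^ k) ^ 2 * η ^ 2 := by
        refine (pow_le_pow_left₀ hh.le hhη 2).trans (le_of_eq ?_)
        rw [pow_right_comm, show (2 * η) ^ 2 = 4 * η ^ 2 by ring, mul_pow]
        ring
      have h4 : Real.exp (2 * α * h) ≤ Real.exp (2 * α) := by
        refine Real.exp_le_exp.2 ?_
        nlinarith [mul_nonneg hα (sub_nonneg.2 hh1)]
      have h5 := sqNorm_nonneg (K i *ᵥ ((C * A) *ᵥ v))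
      calc _ ≤ 4 ^ (k + 1) * (η ^ k) ^ 2 * η ^ 2 * Real.exp (2 * α) *
            (η⁻¹ * sqNorm (K i *ᵥ ((C * A) *ᵥ v))) := by gcongr
        _ = 4 ^ (k + 1) * η * Real.exp (2 * α) *
            ((η ^ k) ^ 2 * sqNorm (K i *ᵥ ((C * A) *ᵥ v))) := by
          field_simp
        _ ≤ _ := by gcongr
    refine (Finset.sum_le_sum h1).trans (le_of_eq ?_)
    rw [Finset.sum_const, Finset.card_range, nsmul_eq_mul]
    simp only [a₃, hρ]
    ring
  have hz : sqNorm ((C * A ^ k) *ᵥ y) ≤ 2 * b₃ * sqNorm v + 2 * (b₄ * (2 * ρ)) * E := by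
    have h1 : (C * A ^ k) *ᵥ y = (C * A ^ k * D) *ᵥ v + (C * A ^ k * B) *ᵥ (sd + se) := by
      rw [hy', Matrix.mulVec_add, Matrix.mulVec_mulVec, Matrix.mulVec_mulVec]
    rw [h1]
    have h2 := sqNorm_add_le ((C * A ^ k * D) *ᵥ v) ((C * A ^ k * B) *ᵥ (sd + se))
    have h3 := hb₃ v
    have h4 := (hb₄ (sd + se)).trans (mul_le_mul_of_nonneg_left hsE hb₄0)
    linarith
  -- the Taylor terms
  have hR : ∑ i ∈ Finset.range k, (((i + 1 : ℕ) : ℝ) * η) ^ (k + 1) *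
      (η ^ k * sqNorm (K (i + 1) *ᵥ ((C * A ^ k) *ᵥ y))) ≤
      η * (a₄ * (2 * b₃ * sqNorm v + 2 * (b₄ * (2 * ρ)) * E)) := by
    have hz0 : 0 ≤ 2 * b₃ * sqNorm v + 2 * (b₄ * (2 * ρ)) * E := (sqNorm_nonneg _).trans hz
    have h1 : ∀ i ∈ Finset.range k, (((i + 1 : ℕ) : ℝ) * η) ^ (k + 1) *
        (η ^ k * sqNorm (K (i + 1) *ᵥ ((C * A ^ k) *ᵥ y))) ≤
        η * (ρ ^ (k + 1) * (L * (2 * b₃ * sqNorm v + 2 * (b₄ * (2 * ρ)) * E))) := fun i hi => by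
      have hi := Finset.mem_range.1 hi
      have h2 := (hK (i + 1) (by omega) ((C * A ^ k) *ᵥ y)).trans
        (mul_le_mul_of_nonneg_left hz hL)
      have h3 : ((i + 1 : ℕ) : ℝ) ≤ ρ := by
        rw [hρ]; exact_mod_cast (by omega : i + 1 ≤ k + 1)
      have h5 := sqNorm_nonneg (K (i + 1) *ᵥ ((C * A ^ k) *ᵥ y))
      calc _ = η * (((i + 1 : ℕ) : ℝ) ^ (k + 1) *
            ((η ^ k) ^ 2 * sqNorm (K (i + 1) *ᵥ ((C * A ^ k) *ᵥ y)))) := by ring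
        _ ≤ _ := by gcongr
    refine (Finset.sum_le_sum h1).trans ?_
    rw [Finset.sum_const, Finset.card_range, nsmul_eq_mul]
    have h6 : (k : ℝ) ≤ ρ := by rw [hρ]; push_cast; linarith
    calc _ ≤ ρ * (η * (ρ ^ (k + 1) * (L * (2 * b₃ * sqNorm v + 2 * (b₄ * (2 * ρ)) * E)))) := by
          gcongr
      _ = _ := by simp only [a₄]; ring
  have hd := weight_lower_bound_sampling hα hη hη1 k d
  have he := weight_lower_bound_taylor hα hη hη1 k e
  have hfin := small_delay_arith (V := sqNorm v) (E := E) (sqNorm_nonneg v) (add_nonneg hE1 hE2)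
    hc₃ hη hη1 hs1 hs2
  have e1 : η * (c₂ * sqNorm v + c₃ * E) = η * (a₃ * sqNorm v) +
      η * (a₄ * (2 * b₃ * sqNorm v + 2 * (b₄ * (2 * ρ)) * E)) := by
    simp only [c₂, c₃]; ring
  have e2 : c₀ / η * E = c₀ / η * ∑ i ∈ Finset.range (k + 1), sqNorm (d i) +
      c₀ / η * ∑ i ∈ Finset.range k, sqNorm (e (i + 1)) := by
    simp only [E]; ring
  linarith

/-- The number of sampling periods in the smallest delay, and the size of that delay. -/
theorem smallest_delay {r : ℕ} (hr : 2 ≤ r) {h : ℝ} (hh : 0 < h) (hh1 : h ≤ 1) :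
    0 < ⌊h ^ ((1 : ℝ) / (r : ℝ) - 1)⌋₊ ∧
    (⌊h ^ ((1 : ℝ) / (r : ℝ) - 1)⌋₊ : ℝ) * h ≤ h ^ ((1 : ℝ) / (r : ℝ)) ∧
    h ≤ (2 * ((⌊h ^ ((1 : ℝ) / (r : ℝ) - 1)⌋₊ : ℝ) * h)) ^ r := by
  have hr0 : (0 : ℝ) < r := by exact_mod_cast (by omega : 0 < r)
  have hr1 : (1 : ℝ) / r ≤ 1 := by
    rw [div_le_one hr0]; exact_mod_cast (by omega : 1 ≤ r)
  set s := h ^ ((1 : ℝ) / (r : ℝ) - 1)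
  have hs1 : 1 ≤ s := Real.one_le_rpow_of_pos_of_le_one_of_nonpos hh hh1 (by linarith)
  have hsh : s * h = h ^ ((1 : ℝ) / (r : ℝ)) := by
    calc s * h = s * h ^ (1 : ℝ) := by rw [Real.rpow_one]
      _ = _ := by rw [← Real.rpow_add hh]; congr 1; ring
  have hfl : 1 ≤ ⌊s⌋₊ := Nat.le_floor (by exact_mod_cast hs1)
  refine ⟨hfl, ?_, ?_⟩
  · rw [← hsh]
    exact mul_le_mul_of_nonneg_right (Nat.floor_le (by linarith)) hh.le
  · have h1 : s ≤ 2 * ⌊s⌋₊ := by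
      have h2 := Nat.lt_floor_add_one s
      have h3 : (1 : ℝ) ≤ ⌊s⌋₊ := by exact_mod_cast hfl
      linarith
    calc h = (h ^ ((1 : ℝ) / (r : ℝ))) ^ r := by
          rw [one_div, Real.rpow_inv_natCast_pow hh.le (by omega)]
      _ = (s * h) ^ r := by rw [hsh]
      _ ≤ (2 * (⌊s⌋₊ * h)) ^ r := by
          rw [← mul_assoc]
          gcongr

theorem posDef_smul_one {c : ℝ} (hc : 0 < c) : (c • (1 : Matrix (Fin m) (Fin m) ℝ)).PosDef :=
  Matrix.PosDef.one.smul hc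

/-- Sampled-data implementation of a stabilizing derivative-dependent controller. -/
theorem exists_sampling_threshold {A : Matrix (Fin n) (Fin n) ℝ} {B : Matrix (Fin n) (Fin m) ℝ}
    {C : Matrix (Fin l) (Fin n) ℝ} {r : ℕ} (hr : 2 ≤ r)
    (hCB : ∀ i, i + 2 ≤ r → C * A ^ i * B = 0) {Kbar : ℕ → Matrix (Fin m) (Fin l) ℝ} {α α' : ℝ}
    (hα : 0 ≤ α) (hαα' : α < α') (hstab : IsExpStable (IsDerivativeLoop A B C r Kbar) α') :
    ∃ h₀ : ℝ, 0 < h₀ ∧ ∀ h : ℝ, 0 < h → h < h₀ →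
      ∀ q : ℕ → ℕ, (∀ i : ℕ, q i = i * ⌊h ^ ((1 : ℝ) / (r : ℝ) - 1)⌋₊) →
        (∀ i : ℕ, i + 1 < r → q i < q (i + 1)) ∧
        IsUnit (vandermondeM l r h q).det ∧
        ∀ K : ℕ → Matrix (Fin m) (Fin l) ℝ,
          gainRow r K = gainRow r Kbar * (vandermondeM l r h q)⁻¹ →
          IsExpStable (IsSampledLoop A B C r h q K) α := by
  obtain ⟨c, hc⟩ := exists_flow_bound hCB hstab
  obtain ⟨P, hP, hlyap⟩ := exists_lyapunov hαα' hc
  obtain ⟨L, hL0, hL⟩ := exists_gain_bound r Kbar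
  obtain ⟨η₀, hη₀, hη₀1, hsmall⟩ := exists_small_delay A _ P B C hr hα hL0 hlyap
  have hr0 : (0 : ℝ) < r := by exact_mod_cast (by omega : 0 < r)
  -- Chosen so that the smallest delay, at most `h^(1/r)`, stays below `η₀`.
  refine ⟨η₀ ^ r, by positivity, fun h hh hhlt q hq => ?_⟩
  have hh1 : h ≤ 1 := hhlt.le.trans (pow_le_one₀ hη₀.le hη₀1)
  obtain ⟨hp, hη1, hη2⟩ := smallest_delay hr hh hh1
  set p := ⌊h ^ ((1 : ℝ) / (r : ℝ) - 1)⌋₊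
  have hη0 : 0 < (p : ℝ) * h := by positivity
  have hηη₀ : (p : ℝ) * h ≤ η₀ := by
    refine hη1.trans ?_
    calc h ^ ((1 : ℝ) / (r : ℝ)) ≤ (η₀ ^ r) ^ ((1 : ℝ) / (r : ℝ)) := by gcongr
      _ = η₀ := by rw [one_div, Real.pow_rpow_inv_natCast hη₀.le (by omega)]
  have hqlt : ∀ i : ℕ, i + 1 < r → q i < q (i + 1) := fun i _ => by
    rw [hq, hq, add_mul, one_mul]; omega
  have hM := isUnit_det_vandermondeM (r := r) (h := h) l hq hη0.ne'
  refine ⟨hqlt, hM, fun K hK => ?_⟩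
  -- The prescribed gains cancel `M`, so `D` is the closed-loop matrix of the derivative controller
  -- for every `h`.
  have hD : matD A B C r h q K = A + B * (gainRow r Kbar * outputCol A C r) := by
    rw [matD, hK, Matrix.nonsing_inv_mul_cancel_right _ _ hM]
  have hqh : ∀ i : ℕ, (q i : ℝ) * h = (i : ℝ) * (p * h) := fun i => by
    rw [hq]; push_cast; ring
  refine isExpStable_of_quadraticForms (P := P) (W := fun _ => (((p : ℝ) * h)⁻¹) • 1)
    (R := fun _ => ((p : ℝ) * h) ^ (r - 1) • 1) hr hCB hh (by rw [hq, zero_mul]) hqlt hα hP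
    (fun i _ => (posDef_smul_one (by positivity)).posSemidef)
    (fun i _ _ => (posDef_smul_one (by positivity)).posSemidef) fun v y d e hy => ?_
  rw [hD] at hy
  have key := hsmall h (p * h) K hh hh1 hη0 hηη₀ hη2
    (hL h q p K hq hη0 (hηη₀.trans hη₀1) hK) v y d e hy
  simp only [dotProduct_smul_one_mulVec, hqh]
  exact key

end SmallDelay

end SampledData

end

theorem theorem1 {n m l : ℕ} (r : ℕ) (hr : 2 ≤ r)
    (A : Matrix (Fin n) (Fin n) ℝ) (B : Matrix (Fin n) (Fin m) ℝ) (C : Matrix (Fin l) (Fin n) ℝ)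
    (hrel : SampledData.HasRelativeDegree A B C r) :
    -- Part (i): feasibility of the LMI gives exponential stability with decay rate `α`.
    (∀ (h : ℝ) (q : ℕ → ℕ) (K : ℕ → Matrix (Fin m) (Fin l) ℝ) (α : ℝ),
      0 < h → q 0 = 0 → (∀ i : ℕ, i + 1 < r → q i < q (i + 1)) → 0 < α →
      (∃ (P : Matrix (Fin n) (Fin n) ℝ) (W R : ℕ → Matrix (Fin m) (Fin m) ℝ),
        P.PosDef ∧ (∀ i : ℕ, i < r → (W i).PosDef) ∧
        (∀ i : ℕ, 1 ≤ i → i < r → (R i).PosDef) ∧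
        (-SampledData.Phi A B C r h q K α P W R).PosSemidef) →
      SampledData.IsExpStable (SampledData.IsSampledLoop A B C r h q K) α) ∧
    -- Part (ii): any decay rate `α < α'` is preserved for all small enough `h`.
    (∀ (Kbar : ℕ → Matrix (Fin m) (Fin l) ℝ) (α' : ℝ), 0 < α' →
      SampledData.IsExpStable (SampledData.IsDerivativeLoop A B C r Kbar) α' →
      ∀ α : ℝ, α < α' → ∃ h₀ : ℝ, 0 < h₀ ∧ ∀ h : ℝ, 0 < h → h < h₀ →
        ∀ q : ℕ → ℕ, (∀ i : ℕ, q i = i * ⌊h ^ ((1 : ℝ) / (r : ℝ) - 1)⌋₊) →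
          (∀ i : ℕ, i + 1 < r → q i < q (i + 1)) ∧
          IsUnit (SampledData.vandermondeM l r h q).det ∧
          ∀ K : ℕ → Matrix (Fin m) (Fin l) ℝ,
            SampledData.gainRow r K =
              SampledData.gainRow r Kbar * (SampledData.vandermondeM l r h q)⁻¹ →
            SampledData.IsExpStable (SampledData.IsSampledLoop A B C r h q K) α) := by 
  obtain ⟨hCB, _⟩ := hrel
  refine ⟨fun h q K α hh hq0 hq hα => ?_, fun Kbar α' hα' hstab α hα => ?_⟩
  · rintro ⟨P, W, R, hP, hW, hR, hPhi⟩
    exact SampledData.isExpStable_of_Phi hr hCB hh hq0 hq hα.le hP hW hR hPhi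
  -- The rate `α` may be negative, whereas the weighted estimates need a nonnegative one. The result
  -- is proved for `max α 0`, still below `α'`, and then weakened.
  · obtain ⟨h₀, hh₀, H⟩ := SampledData.exists_sampling_threshold hr hCB (le_max_right α 0)
      (max_lt hα hα') hstab
    refine ⟨h₀, hh₀, fun h hh hlt q hq => ?_⟩
    obtain ⟨h1, h2, h3⟩ := H h hh hlt q hq
    exact ⟨h1, h2, fun K hK => (h3 K hK).mono (le_max_left α 0)⟩
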